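/- Let $A$ be a finite alphabet, $M$ a finite monoid, $\mu:A^*\to M$ a morphism and $K\ge 0$ (for instance $K=3|M|$). Write $\hat A=A\uplus\{\langle,\rangle\}$. **Forests.** A $\mu$-factorization $\mathcal F$ of a word $w$ is either a letter $a$ (with $w=a$), or $\langle\mathcal F_1\rangle\cdots\langle\mathcal F_n\rangle$, $n\ge 0$, where $w=w_1\cdots w_n$, each $\mathcal F_i$ is a $\mu$-factorization of the non-empty word $w_i$, and, if $n\ge 3$, $\mu(w)=\mu(w_1)=\dots=\mu(w_n)$ is idempotent (for $n=0$ this is $\mathcal F=\varepsilon$, $w=\varepsilon$). Put $\mu(\mathcal F)=\mu(w)$. Letters and $\varepsilon$ have height $0$; otherwise the height is $1+\max_i\mathrm{height}(\mathcal F_i)$. Forests are also words in $\hat A^*$. A node is *iterable* if it has a left and a right sibling. A set $T$ of iterable nodes is *independent* if no $t\in T$ is an ancestor of another $t'\in T$, or an immediate sibling of $t'$ or of an ancestor of $t'$; $\mathrm{Ind}^k(\mathcal F)$ is the set of independent sets of $k$ nodes. The *frontier word* of a node is read off the leaves reached from it by going to first or last children only. The *linearization* $m[u]m'$ of a node $t$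 in $\mathcal F$ consists of its frontier word $u\in A^*$ and of the values $m,m'\in M$ of the parts of $w$ to the left and to the right of the subforest at $t$; the *type* of $t$ is its linearization together with its depth, and $\mathrm{types}_{\mathcal F}(T)$ is the multiset of the types of the nodes of $T$. **Architectures.** The architecture $\mathrm{arch}_{\mathcal F}(T)$ of $T\in\mathrm{Ind}^k(\mathcal F)$ is: $a$ if $\mathcal F=a$; $\varepsilon$ if $\mathcal F=\varepsilon$; and for $\mathcal F=\langle\mathcal F_1\rangle\cdots\langle\mathcal F_n\rangle$, $n\ge1$: $\langle\mu(\mathcal F)\rangle$ if $T=\varnothing$; otherwise $\langle\mathrm{arch}_{\mathcal F_1}(T_1)\rangle\,\mathrm{arch}_{\langle\mathcal F_2\rangle\cdots\langle\mathcal F_n\rangle}(T\smallsetminus T_1)$ if $\mathcal F_1$ contains a non-empty part $T_1$ of $T$; otherwise $\mathrm{arch}_{\langle\mathcal F_1\rangle\cdots\langle\mathcal F_{n-1}\rangle}(T\smallsetminus T_n)\,\langle\mathrm{arch}_{\mathcal F_n}(T_n)\rangle$ if $\mathcal F_n$ contains a non-empty part $T_n$ of $T$; otherwise $\langle\mathrm{types}_{\mathcal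 F}(T)\rangle$. It is an architecture *of rank $k$* if $\mathcal F$ has height at most $K$. For such an $\mathbb A$, $\mathsf{count}_{\mathbb A}:\hat A^*\to\mathbb N$ maps a $\mu$-factorization $\mathcal F$ of height at most $K$ to $|\{T\in\mathrm{Ind}^k(\mathcal F):\mathrm{arch}_{\mathcal F}(T)=\mathbb A\}|$ and every other word to $0$. **Functions.** A bimachine over a finite alphabet $B$ with external functions consists of a morphism $\nu$ from $B^*$ to a finite monoid $N$ and a function $h$ that selects an external function $h_i$ from the value under $\nu$ of the prefix before a position $i$, the letter at $i$ and the value of the suffix after $i$. The $0$-pebble and $0$-blind functions are the constants; a $(k+1)$-pebble function is $w\mapsto\sum_i h_i(w\bullet i)$ with $k$-pebble functions $h_i$ over $B\uplus\underline B$, where $w\bullet i$ is $w$ with position $i$ underlined; a $(k+1)$-blind function is $w\mapsto\sum_i h_i(w)$ with $k$-blind functions $h_i$ over $B$. A function $B^*\to\mathbb N$ is *polyregular* (*polyblind*) if on non-empty words it is a $k$-pebble ($k$-blind) function for some $k\ge1$ (its value on $\varepsilon$ is arbitrary). It has *growth at most $r$* if $f(w)=O(|w|^r)$. **Claim.** Let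 $\mathbb A$ be an architecture of rank $k\ge 0$. (1) There are functions $\mathsf{count}'_{\mathbb A},\mathsf{count}''_{\mathbb A}:\hat A^*\to\mathbb N$ with $\mathsf{count}_{\mathbb A}=\mathsf{count}'_{\mathbb A}+\mathsf{count}''_{\mathbb A}$ such that $\mathsf{count}'_{\mathbb A}$ is polyblind with growth at most $k$, and $\mathsf{count}''_{\mathbb A}$ is polyregular with growth at most $k-1$ (identically $0$ if $k=0$). (2) Let $\mathbb A=\langle\mathbb T\rangle$ for a multiset $\mathbb T=\mathbb T_1\uplus\{\tau,\dots,\tau\}$ of types, with $r>0$ copies of $\tau=(m[u]m',d)$, $\tau\notin\mathbb T_1$, and $d\le d'$ for every type of depth $d'$ in $\mathbb T_1$. Let $k_1=|\mathbb T_1|$ and $e=m\mu(u)m'$. For $\mathcal F=\langle\mathcal F_1\rangle\cdots\langle\mathcal F_n\rangle$ call the nodes of $\langle\mathcal F_2\rangle\cdots\langle\mathcal F_{n-1}\rangle$ interior, and let $A(\mathcal F)$ be the set of interior iterable nodes of type $\tau$. Let $P_r(X)$ be the number of words in $\{0,1\}^X$ with exactly $r$ ones, no two of them consecutive. On $\mu$-factorizations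 $\mathcal F$ of height at most $K$ let $g'(\mathcal F)=P_r(|A(\mathcal F)|-3k_1)$ if $|A(\mathcal F)|\ge 3k_1+2r$ and $g'(\mathcal F)=0$ otherwise, and let $\mathsf{count}_{\langle\mathbb T_1\rangle}(\mathcal F)$ be the number of $T\in\mathrm{Ind}^{k_1}(\mathcal F)$ consisting of interior nodes with $\mathrm{types}_{\mathcal F}(T)=\mathbb T_1$ if $n\ge3$ and $\mu(\mathcal F)=e$, and $0$ otherwise; both functions are $0$ on all other words. Then $g'$ is polyblind with growth at most $r$, and there is a polyregular function $g''$ with growth at most $k-1$ such that $\mathsf{count}_{\mathbb A}=g'\times\mathsf{count}_{\langle\mathbb T_1\rangle}+g''$. -/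

import Mathlib

universe u v

namespace PolyCount

/-! ### Polyblind and polyregular functions (unary output), by nested bimachines -/

/-- The word `w` in which position `i` is underlined: underlined letters are `Sum.inr`. -/
def underline {A : Type u} (w : List A) (i : Fin w.length) : List (A ⊕ A) :=
  (w.take i).map Sum.inl ++ Sum.inr w[i] :: (w.drop (i + 1)).map Sum.inl

/-- A bimachine consists of a morphism `μ` into a finite monoid and an output function `out`.
At position `i` of `w` it selects an object by the value of the prefix strictly before `i`,
the letter at `i`, and the value of the suffix strictly after `i`. -/
def select {A : Type u} {N : Type} [Monoid N] {H : Type v} (μ : FreeMonoid A →* N)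
    (out : N → A → N → H) (w : List A) (i : Fin w.length) : H :=
  out (μ (FreeMonoid.ofList (w.take i))) w[i] (μ (FreeMonoid.ofList (w.drop (i + 1))))

/-- Functions computed by `k`-pebble bimachines. A `(k+1)`-pebble bimachine sums, over the
positions `i` of its input `w`, the value on `w` with `i` underlined of a function selected at `i`
and computed by a `k`-pebble bimachine. For `k = 0` these are constants, so that a `1`-pebble
bimachine is a bimachine that outputs a natural number at each position. -/
def IsPebble : ℕ → (A : Type u) → (List A → ℕ) → Prop
  | 0, _, f => ∃ c : ℕ, ∀ w, f w = c
  | k + 1, A, f =>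
    ∃ (N : Type) (_ : Monoid N) (_ : Finite N) (μ : FreeMonoid A →* N)
      (h : N → A → N → List (A ⊕ A) → ℕ),
      (∀ m a n, IsPebble k (A ⊕ A) (h m a n)) ∧
      ∀ w, f w = ∑ i : Fin w.length, select μ h w i (underline w i)

/-- Functions computed by `k`-blind bimachines: as for pebbles, but the selected function is
applied to the word itself, without a mark. -/
def IsBlind {A : Type u} : ℕ → (List A → ℕ) → Prop
  | 0, f => ∃ c : ℕ, ∀ w, f w = c
  | k + 1, f =>
    ∃ (N : Type) (_ : Monoid N) (_ : Finite N) (μ : FreeMonoid A →* N)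
      (h : N → A → N → List A → ℕ),
      (∀ m a n, IsBlind k (h m a n)) ∧
      ∀ w, f w = ∑ i : Fin w.length, select μ h w i w

/-- `f` is polyregular: computed by a `k`-pebble bimachine for some `k ≥ 1`. The output on the
empty word, which has no position, is free (as for two-way machines with end markers). -/
def IsPolyregular {A : Type u} (f : List A → ℕ) : Prop :=
  ∃ k, 1 ≤ k ∧ ∃ g, IsPebble k A g ∧ ∀ w, w ≠ [] → f w = g w

/-- `f` is polyblind: computed by a `k`-blind bimachine for some `k ≥ 1`, with a free output on
the empty word. -/
def IsPolyblind {A : Type u} (f : List A → ℕ) : Prop :=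
  ∃ k, 1 ≤ k ∧ ∃ g, IsBlind k g ∧ ∀ w, w ≠ [] → f w = g w

/-- `f` has growth at most `r`, that is, `f w = O(|w| ^ r)`. -/
def HasGrowth {A : Type u} (f : List A → ℕ) (r : ℕ) : Prop :=
  ∃ C : ℕ, ∀ w, w ≠ [] → f w ≤ C * w.length ^ r

/-! ### Factorization forests -/

/-- Bracketed forests over `A`: `letter a` is the forest `a`, and `node [F₁, …, Fₙ]` is
`⟨F₁⟩⋯⟨Fₙ⟩`; in particular `node []` is the empty forest `ε`. -/
inductive Forest (A : Type u) : Type u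
  | letter (a : A) : Forest A
  | node (children : List (Forest A)) : Forest A

/-- The alphabet `A ⊎ {⟨, ⟩}`. -/
inductive Bracketed (A : Type u) : Type u
  | letter (a : A) : Bracketed A
  | opening : Bracketed A
  | closing : Bracketed A

namespace Forest

variable {A : Type u} {M : Type v} [Monoid M]

/-- The word over `A ⊎ {⟨, ⟩}` that writes a forest down. -/
def encode : Forest A → List (Bracketed A)
  | letter a => [Bracketed.letter a]
  | node l => l.flatMap fun c =>
      Bracketed.opening :: (encode c ++ [Bracketed.closing])

/-- The word over `A` that the forest factors. -/
def word : Forest A → List A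
  | letter a => [a]
  | node l => l.flatMap fun c => word c

/-- The height of a forest; letters and the empty forest have height `0`. -/
def height : Forest A → ℕ
  | letter _ => 0
  | node l => (l.map fun c => height c + 1).foldr max 0

/-- The value `μ(F)`. -/
def value (μ : FreeMonoid A →* M) (F : Forest A) : M :=
  μ (FreeMonoid.ofList F.word)

/-- `F` is a `μ`-factorization (of the word `F.word`). -/
def IsFactorization (μ : FreeMonoid A →* M) : Forest A → Prop
  | letter _ => True
  | node l =>
    (∀ c ∈ l, IsFactorization μ c ∧ c.word ≠ []) ∧
    (3 ≤ l.length → IsIdempotentElem ((node l).value μ) ∧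
      ∀ c ∈ l, c.value μ = (node l).value μ)

/-- `F` is a `μ`-factorization of height at most `K`. -/
def IsFactorizationLE (μ : FreeMonoid A →* M) (K : ℕ) (F : Forest A) : Prop :=
  F.IsFactorization μ ∧ F.height ≤ K

/-- The number of children of the root. -/
def arity : Forest A → ℕ
  | letter _ => 0
  | node l => l.length

/-! Nodes are given by paths from the root: `i :: p` leads to the node `p` of the child number
`i` (counted from `0`). Hence equal subforests at different places are different nodes. -/

/-- The subforest at a path, if the path leads to a node. -/
def subforest : Forest A → List ℕ → Option (Forest A)
  | F, [] => some F
  | letter _, _ :: _ => none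
  | node l, i :: p => l[i]?.bind fun c => subforest c p

/-- A node is iterable if it has both a left and a right sibling. -/
def IsIterable (F : Forest A) (t : List ℕ) : Prop :=
  ∃ (q : List ℕ) (i : ℕ) (G : Forest A),
    t = q ++ [i] ∧ F.subforest q = some G ∧ 0 < i ∧ i + 1 < G.arity

end Forest

/-- `s` is an ancestor of `t` (possibly `t` itself), or an immediate left or right sibling of an
ancestor of `t` (possibly of `t` itself). -/
def Observes (t s : List ℕ) : Prop :=
  s <+: t ∨ ∃ (q : List ℕ) (i : ℕ),
    ((q ++ [i + 1]) <+: t ∧ s = q ++ [i]) ∨ ((q ++ [i]) <+: t ∧ s = q ++ [i + 1])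

namespace Forest

variable {A : Type u} {M : Type v} [Monoid M]

/-- The independent sets of `k` nodes: sets of iterable nodes, none of which is an ancestor, or an
immediate sibling of an ancestor, of another one. -/
def IsIndependent (F : Forest A) (k : ℕ) (T : Finset (List ℕ)) : Prop :=
  T.card = k ∧ (∀ t ∈ T, F.IsIterable t) ∧ ∀ t ∈ T, ∀ s ∈ T, t ≠ s → ¬ Observes t s

/-- Keep only the first and the last word of a list of words. -/
def firstLast : List (List A) → List A
  | [] => []
  | [x] => x
  | x :: y :: l => x ++ (y :: l).getLast (by simp)

/-- The word `w[Fr(F)]` carried by the frontier of the root: the frontier consists of the leaves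
reached from the root by going only to first or last children. -/
def frontier : Forest A → List A
  | letter a => [a]
  | node l => firstLast (l.map fun c => frontier c)

end Forest

/-- The `1`-multicontext `m⟦u⟧m'`. -/
structure Context (A : Type u) (M : Type v) where
  left : M
  word : List A
  right : M

/-- A type of nodes: a linearization together with a depth. -/
abbrev NodeType (A : Type u) (M : Type v) := Context A M × ℕ

namespace Forest

variable {A : Type u} {M : Type v} [Monoid M]

/-- The linearization of a node: its frontier word, surrounded by the values of what lies to the
left and to the right (the last two cases are never met on nodes). -/
def lin (μ : FreeMonoid A →* M) : Forest A → List ℕ → Context A M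
  | F, [] => ⟨1, F.frontier, 1⟩
  | letter _, _ :: _ => ⟨1, [], 1⟩
  | node l, i :: p =>
    match l[i]? with
    | some c =>
      ⟨(node (l.take i)).value μ * (lin μ c p).left, (lin μ c p).word,
        (lin μ c p).right * (node (l.drop (i + 1))).value μ⟩
    | none => ⟨1, [], 1⟩

/-- The type of a node: its linearization and its depth. -/
def nodeType (μ : FreeMonoid A →* M) (F : Forest A) (t : List ℕ) : NodeType A M :=
  (F.lin μ t, t.length)

/-- The multiset of the types of the nodes of a set. -/
def types (μ : FreeMonoid A →* M) (F : Forest A) (T : Finset (List ℕ)) :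
    Multiset (NodeType A M) :=
  T.val.map (F.nodeType μ)

end Forest

/-! ### Architectures -/

/-- The building blocks of architectures: a letter `a`, a value `⟨m⟩`, a multiset of types `⟨𝕋⟩`,
and `⟨𝔸⟩` for an architecture `𝔸`. -/
inductive Block (A : Type u) (M : Type v) : Type (max u v)
  | letter (a : A) : Block A M
  | value (m : M) : Block A M
  | types (T : Multiset (Context A M × ℕ)) : Block A M
  | node (l : List (Block A M)) : Block A M

/-- Architectures are words of blocks. -/
abbrev Architecture (A : Type u) (M : Type v) := List (Block A M)

/-- The nodes of `T` below the child number `i`, as nodes of this child. -/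
def below (T : Finset (List ℕ)) (i : ℕ) : Finset (List ℕ) :=
  (T.filter fun t => t.head? = some i).image List.tail

/-- The nodes of `T` that are not below the child number `0`, as nodes of the forest from which
this child is removed. -/
def dropFirst (T : Finset (List ℕ)) : Finset (List ℕ) :=
  (T.filter fun t => t.head? ≠ some 0).image (List.modifyHead fun i => i - 1)

/-- The nodes of `T` that are not below the child number `i`. -/
def dropAt (T : Finset (List ℕ)) (i : ℕ) : Finset (List ℕ) :=
  T.filter fun t => t.head? ≠ some i

namespace Forest

variable {A : Type u} {M : Type v} [Monoid M]

theorem sizeOf_node_dropLast_lt (c : Forest A) (l : List (Forest A)) :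
    sizeOf (node (c :: l).dropLast) < sizeOf (node (c :: l)) := by
  have key : ∀ (l : List (Forest A)) (c : Forest A),
      sizeOf (c :: l).dropLast < sizeOf (c :: l) := by
    intro l
    induction l with
    | nil => intro c; simp
    | cons d l ih =>
      intro c
      have := ih d
      simp only [List.dropLast_cons_cons, List.cons.sizeOf_spec] at this ⊢
      omega
  have := key l c
  simp only [node.sizeOf_spec]
  omega

theorem sizeOf_getLast_lt (c : Forest A) (l : List (Forest A)) :
    sizeOf ((c :: l).getLast (List.cons_ne_nil c l)) < sizeOf (node (c :: l)) := by
  have := List.sizeOf_lt_of_mem (List.getLast_mem (List.cons_ne_nil c l))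
  simp only [node.sizeOf_spec]
  omega

/-- The architecture of an independent set `T` of nodes of a forest. If `T` is empty, it is the
letter, the empty architecture, or the value. Otherwise the first child is split off if it contains
nodes of `T`, else the last child if it does; if neither does, the types are collected. -/
def arch (μ : FreeMonoid A →* M) : Forest A → Finset (List ℕ) → Architecture A M
  | letter a, _ => [Block.letter a]
  | node [], _ => []
  | node (c :: l), T =>
    if T = ∅ then [Block.value ((node (c :: l)).value μ)]
    else if (below T 0).Nonempty then
      Block.node (arch μ c (below T 0)) :: arch μ (node l) (dropFirst T)
    else if (below T l.length).Nonempty then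
      arch μ (node (c :: l).dropLast) (dropAt T l.length) ++
        [Block.node (arch μ ((c :: l).getLast (List.cons_ne_nil c l)) (below T l.length))]
    else [Block.types ((node (c :: l)).types μ T)]
termination_by F => sizeOf F
decreasing_by
  · simp only [node.sizeOf_spec, List.cons.sizeOf_spec]; omega
  · simp only [node.sizeOf_spec, List.cons.sizeOf_spec]
    have : 0 < sizeOf c := by cases c <;> simp
    omega
  · exact sizeOf_node_dropLast_lt c l
  · exact sizeOf_getLast_lt c l

/-- A forest can be recovered from the word that writes it down. -/
theorem encode_injective : Function.Injective (encode (A := A)) := by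
  -- The encoding of a forest followed by a closing bracket (or the end) is uniquely readable.
  have key : ∀ n (F G : Forest A) (x y : List (Bracketed A)), sizeOf F ≤ n →
      F.encode ++ Bracketed.closing :: x = G.encode ++ Bracketed.closing :: y →
      F = G ∧ x = y := by
    intro n
    induction n with
    | zero => intro F G x y h; cases F <;> simp at h
    | succ n ih =>
      have list : ∀ (l m : List (Forest A)) (x y : List (Bracketed A)),
          (∀ c ∈ l, sizeOf c ≤ n) →
          (node l).encode ++ Bracketed.closing :: x = (node m).encode ++ Bracketed.closing :: y →
          l = m ∧ x = y := by
        intro l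
        induction l with
        | nil =>
          intro m x y _ h
          cases m with
          | nil => simpa [encode] using h
          | cons d m => simp [encode] at h
        | cons c l ihl =>
          intro m x y hl h
          cases m with
          | nil => simp [encode] at h
          | cons d m =>
            simp only [encode, List.flatMap_cons, List.cons_append, List.append_assoc,
              List.cons.injEq, true_and, List.nil_append] at h
            obtain ⟨hc, h⟩ := ih c d _ _ (hl c (by simp)) h
            have := ihl m x y (fun e he => hl e (by simp [he])) (by simpa [encode] using h)
            exact ⟨by rw [hc, this.1], this.2⟩
      intro F G x y hn h
      cases F with
      | letter a =>
        cases G with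
        | letter b => simpa [encode] using h
        | node m => cases m <;> simp [encode] at h
      | node l =>
        cases G with
        | letter b => cases l <;> simp [encode] at h
        | node m =>
          have := list l m x y (fun c hc => by
            have := List.sizeOf_lt_of_mem hc
            simp only [node.sizeOf_spec] at hn
            omega) h
          exact ⟨by rw [this.1], this.2⟩
  intro F G h
  exact (key _ F G [] [] le_rfl (by rw [h])).1

end Forest

variable {A : Type u} {M : Type v} [Monoid M]

/-- The function on words over `A ⊎ {⟨, ⟩}` that is `φ F` on the word of a `μ`-factorization `F`
of height at most `K`, and `0` on all other words. -/
noncomputable def onForests (μ : FreeMonoid A →* M) (K : ℕ) (φ : Forest A → ℕ)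
    (w : List (Bracketed A)) : ℕ :=
  open Classical in
  if h : ∃ F : Forest A, F.IsFactorizationLE μ K ∧ F.encode = w then φ h.choose else 0

theorem onForests_encode (μ : FreeMonoid A →* M) (K : ℕ) (φ : Forest A → ℕ) (F : Forest A)
    (hF : F.IsFactorizationLE μ K) : onForests μ K φ F.encode = φ F := by
  have h : ∃ G : Forest A, G.IsFactorizationLE μ K ∧ G.encode = F.encode := ⟨F, hF, rfl⟩
  rw [onForests, dif_pos h, Forest.encode_injective h.choose_spec.2]

/-- The architectures of rank `k` of the `μ`-factorizations of height at most `K`. -/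
def architectures (μ : FreeMonoid A →* M) (K k : ℕ) : Set (Architecture A M) :=
  {𝔸 | ∃ (F : Forest A) (T : Finset (List ℕ)),
    F.IsFactorizationLE μ K ∧ F.IsIndependent k T ∧ F.arch μ T = 𝔸}

/-- `count_𝔸`: the number of independent sets of `k` nodes whose architecture is `𝔸`. -/
noncomputable def count (μ : FreeMonoid A →* M) (K k : ℕ) (𝔸 : Architecture A M) :
    List (Bracketed A) → ℕ :=
  onForests μ K fun F =>
    {T : Finset (List ℕ) | F.IsIndependent k T ∧ F.arch μ T = 𝔸}.ncard

/-! ### The ingredients of the decomposition for a multiset of types -/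

/-- The nodes of the middle children: in `⟨F₁⟩⋯⟨Fₙ⟩`, the nodes of `⟨F₂⟩⋯⟨Fₙ₋₁⟩`. -/
def IsInterior (F : Forest A) (t : List ℕ) : Prop :=
  ∃ (i : ℕ) (p : List ℕ), t = i :: p ∧ 0 < i ∧ i + 1 < F.arity

/-- `count_⟨𝕋⟩`, for a multiset of types that may be empty: on `F = ⟨F₁⟩⋯⟨Fₙ⟩` with `n ≥ 3` and
value `e`, the number of independent sets of interior nodes whose multiset of types is `𝕋`. -/
noncomputable def countTypes (μ : FreeMonoid A →* M) (K : ℕ) (e : M)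
    (𝕋 : Multiset (NodeType A M)) : List (Bracketed A) → ℕ :=
  onForests μ K fun F =>
    open Classical in
    if 3 ≤ F.arity ∧ F.value μ = e then
      {T : Finset (List ℕ) | F.IsIndependent 𝕋.card T ∧ (∀ t ∈ T, IsInterior F t) ∧
        F.types μ T = 𝕋}.ncard
    else 0

/-- The set `A(F)` of the interior iterable nodes of type `τ`. -/
def nodesOfType (μ : FreeMonoid A →* M) (τ : NodeType A M) (F : Forest A) : Set (List ℕ) :=
  {t | F.IsIterable t ∧ IsInterior F t ∧ F.nodeType μ t = τ}

/-- `P_r(X)`: the number of words in `{0,1}^X` with exactly `r` ones, no two of them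
consecutive. -/
def sparseWords (r X : ℕ) : ℕ :=
  Fintype.card {s : Fin X → Bool //
    (Finset.univ.filter fun i => s i = true).card = r ∧
    ∀ i j : Fin X, (i : ℕ) + 1 = j → ¬ (s i = true ∧ s j = true)}

/-- The function `F ↦ P_r(|A(F)| - 3k₁)` where `|A(F)| ≥ 3k₁ + 2r`, and `0` elsewhere. -/
noncomputable def sparseFactor (μ : FreeMonoid A →* M) (K : ℕ) (τ : NodeType A M) (r k₁ : ℕ) :
    List (Bracketed A) → ℕ :=
  onForests μ K fun F =>
    if 3 * k₁ + 2 * r ≤ (nodesOfType μ τ F).ncard then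
      sparseWords r ((nodesOfType μ τ F).ncard - 3 * k₁)
    else 0

end PolyCount

/-! A node is identified with the position of its opening bracket in the encoding. Since heights are
bounded by `K`, a finite monoid can match brackets: the set of factorizations and the relations
"ancestor", "next sibling", "iterable", "of type τ" are regular, and so is everything first-order
definable from them (`NReg`). Hence the number of `k`-element sets of nodes with such a property is
polyregular (`IsPolyregular.setCount`), and the number of single nodes with such a property is the
length of a rational image of the word (`NReg.exists_rational`). The difficulty is to isolate a main
part that can be computed without marks.

The sums of a polyblind function of growth `k` and a polyregular one of growth `k - 1` (`Decomp`)
are stable under sums, products (growths add) and composition with rational functions.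
`decomp_count` is an induction on the architecture. A block ⟨𝔸⟩ at the beginning stems from the
first child. Nodes selected below that child do not interfere with the rest of the forest, except
for the adjacent sibling, which is no longer iterable once the child is removed. So the count is a
sum of products of counts for the child and for the rest (`IsSplitting.ncard_eq`), and both are
extracted from the encoding by rational functions. The end of the forest is symmetric, and rank 0 is
a regular test.

There remains ⟨𝕋⟩ (`exists_countTypes_eq`). Let τ be a type of least depth d in 𝕋, occurring r
times, let 𝕋₁ be the rest, of size k₁, and A the set of interior iterable nodes of type τ. Fix an
independent set T₁ with types 𝕋₁. As its nodes have depth at least d, each conflicts with at most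
three nodes of A: its ancestor at depth d and the two neighbours of that ancestor. So at least |A| -
3k₁ nodes of A are free. Two distinct nodes of A conflict only as adjacent siblings, and then no
node of depth d lies between them. Hence any choice of r among the first |A| - 3k₁ free nodes, no
two consecutive among the free ones, is compatible with T₁, and the number P_r(|A| - 3k₁) of these
choices does not depend on T₁. The sets obtained this way are the spread ones; when |A| ≥ 3k₁ + 2r
they account for the product exactly (`ncard_spread`). In any other set some node is determined by
the others up to boundedly many possibilities, so there are O(n^(k-1)) of them
(`ncard_not_spread_le`); as spreadness is regular, their number is polyregular.

Finally P_r(X) is the binomial coefficient of X + 1 - r over r, which is polyblind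
(`LenBlind.choose`): splitting the argument into quotient and remainder modulo r! avoids the
division by r!. The value e = m μ(u) m' is the value of the whole forest because a frontier word has
the value of its forest (`map_frontier`). -/

namespace PolyCount

/-! ### Regular languages -/

section Regular

variable {B : Type u} {C : Type v}

/-- A regular language, as a predicate: it has finitely many left quotients. -/
def Reg (P : List B → Prop) : Prop :=
  (Set.range fun (u : List B) (v : List B) => P (u ++ v)).Finite

/-- The Myhill–Nerode criterion in the form used throughout: words in the same state have the same
quotient. One implication suffices because `u` and `v` may be exchanged. -/
theorem Reg.of_state {σ : Type*} {P : List B → Prop} (st : List B → σ)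
    (hst : (Set.range st).Finite) (h : ∀ u v, st u = st v → ∀ z, P (u ++ z) → P (v ++ z)) :
    Reg P := by
  have key : ∀ u v, st u = st v → (fun z => P (u ++ z)) = fun z => P (v ++ z) := by
    intro u v huv
    funext z
    exact propext ⟨h u v huv z, h v u huv.symm z⟩
  classical
  refine (hst.image fun s z => ∃ u, st u = s ∧ P (u ++ z)).subset ?_
  rintro _ ⟨u, rfl⟩
  refine ⟨st u, ⟨u, rfl⟩, ?_⟩
  funext z
  refine propext ⟨?_, fun hz => ⟨u, rfl, hz⟩⟩
  rintro ⟨v, hv, hz⟩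
  exact h v u hv z hz

/-- The left quotient of a language by a word. -/
def quot (P : List B → Prop) (u v : List B) : Prop := P (u ++ v)

theorem quot_iff {P : List B → Prop} {u v : List B} (h : quot P u = quot P v) (z : List B) :
    P (u ++ z) ↔ P (v ++ z) := iff_of_eq (congrFun h z)

theorem Reg.finite {P : List B → Prop} (h : Reg P) : (Set.range (quot P)).Finite := h

theorem Reg.congr {P Q : List B → Prop} (h : Reg P) (hPQ : ∀ w, P w ↔ Q w) : Reg Q := by
  have : P = Q := funext fun w => propext (hPQ w)
  exact this ▸ h

theorem Reg.const (p : Prop) : Reg fun _ : List B => p :=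
  Reg.of_state (fun _ => ()) (Set.toFinite _) fun _ _ _ _ h => h

theorem Reg.not {P : List B → Prop} (h : Reg P) : Reg fun w => ¬ P w :=
  Reg.of_state (quot P) h.finite fun _ _ huv z hz hv => hz ((quot_iff huv z).2 hv)

theorem Reg.and {P Q : List B → Prop} (hP : Reg P) (hQ : Reg Q) : Reg fun w => P w ∧ Q w := by
  refine Reg.of_state (fun u => (quot P u, quot Q u))
    ((hP.finite.prod hQ.finite).subset ?_) fun u v huv z hz => ?_
  · rintro _ ⟨u, rfl⟩
    exact ⟨⟨u, rfl⟩, ⟨u, rfl⟩⟩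
  · rw [Prod.ext_iff] at huv
    exact ⟨(quot_iff huv.1 z).1 hz.1, (quot_iff huv.2 z).1 hz.2⟩

theorem Reg.or {P Q : List B → Prop} (hP : Reg P) (hQ : Reg Q) : Reg fun w => P w ∨ Q w :=
  (hP.not.and hQ.not).not.congr fun w => by tauto

theorem Reg.exists_finset {ι : Type*} {P : ι → List B → Prop} (s : Finset ι)
    (h : ∀ i ∈ s, Reg (P i)) : Reg fun w => ∃ i ∈ s, P i w := by
  classical
  induction s using Finset.induction_on with
  | empty => exact (Reg.const False).congr fun w => by simp
  | insert i s _ ih =>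
    refine ((h i (by simp)).or (ih fun j hj => h j (by simp [hj]))).congr fun w => ?_
    simp

theorem Reg.exists_finite {ι : Type*} [Finite ι] {P : ι → List B → Prop}
    (h : ∀ i, Reg (P i)) : Reg fun w => ∃ i, P i w := by
  have := Fintype.ofFinite ι
  exact (Reg.exists_finset Finset.univ fun i _ => h i).congr fun w => by simp

theorem Reg.comap {P : List B → Prop} (h : Reg P) (f : C → B) : Reg fun w => P (w.map f) := by
  refine Reg.of_state (fun u => quot P (u.map f)) (h.finite.subset ?_) fun u v huv z hz => ?_
  · rintro _ ⟨u, rfl⟩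
    exact ⟨u.map f, rfl⟩
  · rw [List.map_append] at hz ⊢
    exact (quot_iff huv _).1 hz

theorem Reg.of_hom {N : Type*} [Monoid N] [Finite N] (φ : FreeMonoid B →* N) (S : N → Prop) :
    Reg fun w => S (φ (FreeMonoid.ofList w)) := by
  refine Reg.of_state (fun u => φ (FreeMonoid.ofList u)) (Set.toFinite _) fun u v huv z hz => ?_
  rw [FreeMonoid.ofList_append, map_mul] at hz ⊢
  rw [← huv]
  exact hz

/-- Three kinds of states: nothing read, one letter read (with its verdict), and dead. A single
rejected letter may share the dead state. -/
theorem Reg.singleton (S : B → Prop) : Reg fun w => ∃ b, w = [b] ∧ S b := by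
  classical
  refine Reg.of_state (σ := Option Prop)
    (fun u => match u with
      | [] => none
      | [b] => some (S b)
      | _ :: _ :: _ => some False) (Set.toFinite _) ?_
  intro u v huv z
  match u, v with
  | [], [] => simp
  | [], [b] => simp at huv
  | [], b :: c :: l => simp at huv
  | [a], [] => simp at huv
  | [a], [b] =>
    simp only [Option.some.injEq] at huv
    cases z <;> simp [huv]
  | [a], b :: c :: l =>
    simp only [Option.some.injEq] at huv
    cases z <;> simp [huv]
  | a :: d :: l, [] => simp at huv
  | a :: d :: l, [b] => simp
  | a :: d :: l, b :: c :: l' => simp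

theorem Reg.eq_nil : Reg fun w : List B => w = [] := by
  refine Reg.of_state (σ := Prop) (fun u => u = []) (Set.toFinite _) fun u v huv z => ?_
  simp only [List.append_eq_nil_iff]
  rw [← iff_of_eq huv]
  exact id

/-- The concatenation of two languages. -/
def Cat (P Q : List B → Prop) (w : List B) : Prop := ∃ u v, w = u ++ v ∧ P u ∧ Q v

/-- Subset construction: the state records the quotient of `P` and the set of quotients of `Q` by
those suffixes of `u` that are left after a prefix in `P`. -/
theorem Reg.cat {P Q : List B → Prop} (hP : Reg P) (hQ : Reg Q) : Reg (Cat P Q) := by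
  refine Reg.of_state
    (fun u => (quot P u, {q | ∃ u₁ u₂, u = u₁ ++ u₂ ∧ P u₁ ∧ q = quot Q u₂}))
    ((hP.finite.prod hQ.finite.finite_subsets).subset ?_) fun u v huv z hz => ?_
  · rintro _ ⟨u, rfl⟩
    refine ⟨⟨u, rfl⟩, ?_⟩
    rintro q ⟨_, u₂, _, _, rfl⟩
    exact ⟨u₂, rfl⟩
  · rw [Prod.ext_iff] at huv
    obtain ⟨h₁, h₂⟩ := huv
    dsimp only at h₁ h₂
    obtain ⟨a, b, hab, ha, hb⟩ := hz
    rcases List.append_eq_append_iff.1 hab with ⟨c, rfl, rfl⟩ | ⟨c, rfl, rfl⟩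
    · exact ⟨v ++ c, b, by simp, (quot_iff h₁ c).1 ha, hb⟩
    · have : quot Q c ∈ {q | ∃ v₁ v₂, v = v₁ ++ v₂ ∧ P v₁ ∧ q = quot Q v₂} :=
        by
        rw [← h₂]
        exact ⟨a, c, rfl, ha, rfl⟩
      obtain ⟨v₁, v₂, rfl, hv, hq⟩ := this
      exact ⟨v₁, v₂ ++ z, by simp, hv, (quot_iff hq z).1 hb⟩

/-- The words that are a concatenation of words in a language. -/
def Star (P : List B → Prop) (w : List B) : Prop := ∃ L : List (List B), w = L.flatten ∧ ∀ y ∈ L, P y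

/-- `u₂ ++ z₁` is the factor that meets the border between `u` and `z`. A factor that ends exactly
at the border also counts, with `z₁ = []`; as `u` is non-empty there is always such a factor. -/
theorem star_append_iff {P : List B → Prop} {u z : List B} (hu : u ≠ []) :
    Star P (u ++ z) ↔ ∃ u₁ u₂ z₁ z₂, u = u₁ ++ u₂ ∧ z = z₁ ++ z₂ ∧ Star P u₁ ∧
      P (u₂ ++ z₁) ∧ Star P z₂ := by
  constructor
  · rintro ⟨L, hL, hP⟩
    induction L generalizing u with
    | nil => simp [hu] at hL
    | cons k L ih =>
      simp only [List.flatten_cons] at hL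
      rcases List.append_eq_append_iff.1 hL with ⟨c, rfl, rfl⟩ | ⟨c, rfl, hc⟩
      · exact ⟨[], u, c, L.flatten, rfl, rfl, ⟨[], by simp⟩, hP _ (by simp), L, rfl,
          fun y hy => hP y (by simp [hy])⟩
      · by_cases h : c = []
        · subst h
          exact ⟨[], k, [], z, by simp, rfl, ⟨[], by simp⟩, by simpa using hP k (by simp), L,
            by simpa using hc.symm, fun y hy => hP y (by simp [hy])⟩
        · obtain ⟨u₁, u₂, z₁, z₂, rfl, rfl, ⟨L', rfl, hL'⟩, h₂, h₃⟩ :=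
            ih h hc.symm fun y hy => hP y (by simp [hy])
          refine ⟨k ++ L'.flatten, u₂, z₁, z₂, by simp, rfl, ⟨k :: L', by simp, ?_⟩, h₂, h₃⟩
          intro y hy
          rcases List.mem_cons.1 hy with rfl | hy
          · exact hP _ (by simp)
          · exact hL' y hy
  · rintro ⟨u₁, u₂, z₁, z₂, rfl, rfl, ⟨L₁, rfl, h₁⟩, h₂, ⟨L₂, rfl, h₃⟩⟩
    refine ⟨L₁ ++ (u₂ ++ z₁) :: L₂, by simp, ?_⟩
    intro y hy
    rcases List.mem_append.1 hy with hy | hy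
    · exact h₁ y hy
    · rcases List.mem_cons.1 hy with rfl | hy
      · exact h₂
      · exact h₃ y hy

/-- Subset construction along `star_append_iff`. Emptiness of `u` is recorded because the criterion
is available only for non-empty `u`. -/
theorem Reg.star {P : List B → Prop} (hP : Reg P) : Reg (Star P) := by
  refine Reg.of_state
    (fun u => ((u = [] : Prop), {q | ∃ u₁ u₂, u = u₁ ++ u₂ ∧ Star P u₁ ∧ q = quot P u₂}))
    (((Set.toFinite (Set.univ : Set Prop)).prod hP.finite.finite_subsets).subset ?_)
    fun u v huv z hz => ?_
  · rintro _ ⟨u, rfl⟩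
    refine ⟨Set.mem_univ _, ?_⟩
    rintro q ⟨_, u₂, _, _, rfl⟩
    exact ⟨u₂, rfl⟩
  · rw [Prod.ext_iff] at huv
    obtain ⟨h₁, h₂⟩ := huv
    dsimp only at h₁ h₂
    replace h₁ : u = [] ↔ v = [] := iff_of_eq h₁
    by_cases hu : u = []
    · rw [h₁.1 hu]
      rwa [hu] at hz
    · have hv := fun h => hu (h₁.2 h)
      obtain ⟨u₁, u₂, z₁, z₂, rfl, rfl, h₃, h₄, h₅⟩ := (star_append_iff hu).1 hz
      have : quot P u₂ ∈ {q | ∃ v₁ v₂, v = v₁ ++ v₂ ∧ Star P v₁ ∧ q = quot P v₂} :=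
        by
        rw [← h₂]
        exact ⟨u₁, u₂, rfl, h₃, rfl⟩
      obtain ⟨v₁, v₂, rfl, h₆, hq⟩ := this
      exact (star_append_iff hv).2 ⟨v₁, v₂, z₁, z₂, rfl, rfl, h₆, (quot_iff hq z₁).1 h₄, h₅⟩

/-- A regular language is recognized by a morphism to a finite monoid. -/
theorem Reg.exists_hom {P : List B → Prop} (h : Reg P) :
    ∃ (N : Type) (_ : Monoid N) (_ : Finite N) (φ : FreeMonoid B →* N) (S : N → Prop),
      ∀ w, P w ↔ S (φ (FreeMonoid.ofList w)) := by
  have := h.finite.to_subtype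
  obtain ⟨n, ⟨e⟩⟩ := Finite.exists_equiv_fin (Set.range (quot P))
  choose r hr using fun q : Set.range (quot P) => q.2
  let q : List B → Set.range (quot P) := fun u => ⟨quot P u, Set.mem_range_self u⟩
  have hstep : ∀ (u : List B) (b : B), q (r (q u) ++ [b]) = q (u ++ [b]) := by
    intro u b
    refine Subtype.ext ?_
    funext z
    have := quot_iff (hr (q u)) (b :: z)
    simpa [q, quot] using this
  -- The quotients are numbered by `Fin n` so that the transition monoid lives in `Type`, as
  -- bimachines require, whatever the universe of the alphabet.
  let step : B → Function.End (Fin n) := fun b i => e (q (r (e.symm i) ++ [b]))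
  have hstep' : ∀ (u : List B) (b : B), step b (e (q u)) = e (q (u ++ [b])) := by
    intro u b
    simp only [step, Equiv.symm_apply_apply, hstep]
  -- The opposite monoid appears because the first letter of a word acts first.
  let φ : FreeMonoid B →* (Function.End (Fin n))ᵐᵒᵖ :=
    FreeMonoid.lift fun b => MulOpposite.op (step b)
  have hφ : ∀ w u : List B, (φ (FreeMonoid.ofList w)).unop (e (q u)) = e (q (u ++ w)) := by
    intro w
    induction w with
    | nil =>
      intro u
      rw [FreeMonoid.ofList_nil, map_one, MulOpposite.unop_one, List.append_nil]
      rfl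
    | cons b w ih =>
      intro u
      rw [FreeMonoid.ofList_cons, map_mul, MulOpposite.unop_mul]
      have h₁ : (φ (FreeMonoid.of b)).unop = step b := rfl
      rw [h₁]
      change (φ (FreeMonoid.ofList w)).unop (step b (e (q u))) = _
      rw [hstep', ih (u ++ [b])]
      simp
  have : Finite (Function.End (Fin n)) := inferInstanceAs (Finite (Fin n → Fin n))
  refine ⟨(Function.End (Fin n))ᵐᵒᵖ, inferInstance,
    Finite.of_injective _ MulOpposite.unop_injective, φ,
    fun f => (e.symm (f.unop (e (q [])))).1 [], fun w => ?_⟩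
  have := congrArg (fun i => (e.symm i).1 []) (hφ w [])
  simp only [Equiv.symm_apply_apply] at this
  have h' : P w ↔ (q ([] ++ w)).1 [] := by simp [q, quot]
  exact h'.trans (iff_of_eq this.symm)

end Regular

/-! ### First-order definable relations between positions of words -/

section WordRelations

variable {B : Type u} {C : Type v}

/-- The words that split into a prefix in `P`, a letter in `S` and a suffix in `Q`. -/
def Mid (P : List B → Prop) (S : B → Prop) (Q : List B → Prop) (w : List B) : Prop :=
  ∃ (i : ℕ) (h : i < w.length), P (w.take i) ∧ S w[i] ∧ Q (w.drop (i + 1))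

theorem take_append_cons_drop {w : List B} {i : ℕ} (h : i < w.length) :
    w.take i ++ w[i] :: w.drop (i + 1) = w := by simp

theorem Reg.mid {P : List B → Prop} {S : B → Prop} {Q : List B → Prop} (hP : Reg P)
    (hQ : Reg Q) : Reg (Mid P S Q) := by
  refine (hP.cat ((Reg.singleton S).cat hQ)).congr fun w => ⟨?_, ?_⟩
  · rintro ⟨u, _, rfl, hu, _, v, rfl, ⟨b, rfl, hb⟩, hv⟩
    exact ⟨u.length, by simp, by simpa using hu, by simpa using hb, by simpa using hv⟩
  · rintro ⟨i, h, h₁, h₂, h₃⟩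
    exact ⟨_, _, (take_append_cons_drop h).symm, h₁, [w[i]], _, rfl, ⟨_, rfl, h₂⟩, h₃⟩

/-- The projection behind existential quantifiers over positions: the values of prefix and suffix in
a monoid recognizing `P` range over a finite set and can be guessed. -/
theorem Reg.exists_mark {P : List C → Prop} (hP : Reg P) (f g : B → C) :
    Reg fun w => ∃ (i : ℕ) (h : i < w.length),
      P ((w.take i).map f ++ g w[i] :: (w.drop (i + 1)).map f) := by
  obtain ⟨N, _, _, φ, S, hS⟩ := hP.exists_hom
  have hf : ∀ n : N, Reg fun w : List B => φ (FreeMonoid.ofList (w.map f)) = n := fun n =>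
    (Reg.of_hom φ fun m => m = n).comap f
  refine (Reg.exists_finite (ι := N × N) (P := fun n w =>
    Mid (fun w => φ (FreeMonoid.ofList (w.map f)) = n.1)
      (fun b => S (n.1 * (φ (FreeMonoid.of (g b)) * n.2)))
      (fun w => φ (FreeMonoid.ofList (w.map f)) = n.2) w)
    fun n => Reg.mid (hf _) (hf _)).congr fun w => ?_
  simp only [hS, FreeMonoid.ofList_append, FreeMonoid.ofList_cons, map_mul]
  constructor
  · rintro ⟨n, i, h, h₁, h₂, h₃⟩
    exact ⟨i, h, by rwa [h₁, h₃]⟩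
  · rintro ⟨i, h, h₁⟩
    exact ⟨(_, _), i, h, rfl, h₁, rfl⟩

/-- The word `w` in which each position `i` carries the set of all `j` with `x j = i`. -/
def ann {n : ℕ} (w : List C) (x : Fin n → ℕ) : List (C × (Fin n → Bool)) :=
  w.mapIdx fun i c => (c, fun j => decide (x j = i))

@[simp] theorem length_ann {n : ℕ} (w : List C) (x : Fin n → ℕ) :
    (ann w x).length = w.length := by simp [ann]

@[simp] theorem getElem_ann {n : ℕ} (w : List C) (x : Fin n → ℕ) (i : ℕ)
    (h : i < (ann w x).length) :
    (ann w x)[i] = (w[i]'(by simpa using h), fun j => decide (x j = i)) := by simp [ann]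

@[simp] theorem map_fst_ann {n : ℕ} (w : List C) (x : Fin n → ℕ) :
    (ann w x).map Prod.fst = w := by
  refine List.ext_getElem (by simp) fun i h₁ h₂ => by simp

/-- The relations between `n` positions of a word that are regular. -/
def WReg (n : ℕ) (P : List C → (Fin n → ℕ) → Prop) : Prop :=
  ∃ L : List (C × (Fin n → Bool)) → Prop, Reg L ∧
    ∀ w x, (∀ j, x j < w.length) → (P w x ↔ L (ann w x))

variable {n : ℕ}

theorem WReg.congr {P Q : List C → (Fin n → ℕ) → Prop} (h : WReg n P)
    (hPQ : ∀ w x, (∀ j, x j < w.length) → (P w x ↔ Q w x)) : WReg n Q := by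
  obtain ⟨L, hL, h⟩ := h
  exact ⟨L, hL, fun w x hx => (hPQ w x hx).symm.trans (h w x hx)⟩

theorem WReg.of_reg {P : List C → Prop} (h : Reg P) : WReg n fun w _ => P w :=
  ⟨fun v => P (v.map Prod.fst), h.comap _, fun w x _ => by simp⟩

theorem WReg.const (p : Prop) : WReg n fun (_ : List C) _ => p := WReg.of_reg (Reg.const p)

theorem WReg.not {P : List C → (Fin n → ℕ) → Prop} (h : WReg n P) :
    WReg n fun w x => ¬ P w x := by
  obtain ⟨L, hL, h⟩ := h
  exact ⟨_, hL.not, fun w x hx => not_congr (h w x hx)⟩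

theorem WReg.and {P Q : List C → (Fin n → ℕ) → Prop} (hP : WReg n P) (hQ : WReg n Q) :
    WReg n fun w x => P w x ∧ Q w x := by
  obtain ⟨L, hL, h⟩ := hP
  obtain ⟨L', hL', h'⟩ := hQ
  exact ⟨_, hL.and hL', fun w x hx => and_congr (h w x hx) (h' w x hx)⟩

/-- Annotating by the extended tuple amounts to adding a track 0 that carries a single mark, so
`Reg.exists_mark` projects it away. -/
theorem WReg.ex {P : List C → (Fin n → ℕ) → ℕ → Prop}
    (h : WReg (n + 1) fun w y => P w (fun j => y j.succ) (y 0)) :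
    WReg n fun w x => ∃ i < w.length, P w x i := by
  obtain ⟨L, hL, h⟩ := h
  refine ⟨_, hL.exists_mark (fun c : C × (Fin n → Bool) => (c.1, Fin.cons false c.2))
    (fun c => (c.1, Fin.cons true c.2)), fun w x hx => ?_⟩
  simp only [length_ann]
  have key : ∀ (i : ℕ) (hi : i < w.length),
      P w x i ↔ L (ann w (Fin.cons i x : Fin (n + 1) → ℕ)) := by
    intro i hi
    rw [← h w _ fun j => by refine Fin.cases ?_ (fun j => ?_) j <;> simp [hi, hx]]
    simp
  have key' : ∀ (i : ℕ) (hi : i < (ann w x).length),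
      ann w (Fin.cons i x : Fin (n + 1) → ℕ) =
        ((ann w x).take i).map (fun c => (c.1, Fin.cons false c.2)) ++
          ((ann w x)[i].1, Fin.cons true (ann w x)[i].2) ::
          ((ann w x).drop (i + 1)).map fun c => (c.1, Fin.cons false c.2) := by
    intro i hi
    rw [length_ann] at hi
    refine List.ext_getElem ?_ fun k h₁ h₂ => ?_
    · simp; omega
    · simp only [getElem_ann, List.getElem_append, List.length_map, List.length_take, length_ann,
        min_eq_left hi.le, List.getElem_map, List.getElem_take, List.getElem_cons,
        List.getElem_drop]
      split_ifs with h₃ h₄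
      · refine Prod.ext rfl (funext fun j => ?_)
        refine Fin.cases ?_ (fun j => ?_) j <;> simp; omega
      · obtain rfl : k = i := by omega
        refine Prod.ext rfl (funext fun j => ?_)
        refine Fin.cases ?_ (fun j => ?_) j <;> simp
      · have h₅ : i + 1 + (k - i - 1) = k := by omega
        refine Prod.ext (by simp [h₅]) (funext fun j => ?_)
        refine Fin.cases ?_ (fun j => ?_) j <;> simp [h₅]; omega
  constructor
  · rintro ⟨i, hi, hp⟩
    exact ⟨i, hi, by rw [← key' i (by simpa using hi)]; exact (key i hi).1 hp⟩
  · rintro ⟨i, hi, hp⟩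
    exact ⟨i, hi, (key i hi).2 (by rw [key' i (by simpa using hi)]; exact hp)⟩

theorem WReg.reindex {m : ℕ} {P : List C → (Fin m → ℕ) → Prop} (h : WReg m P)
    (f : Fin m → Fin n) : WReg n fun w x => P w fun j => x (f j) := by
  obtain ⟨L, hL, h⟩ := h
  refine ⟨_, hL.comap fun c : C × (Fin n → Bool) => (c.1, fun j => c.2 (f j)), fun w x hx => ?_⟩
  dsimp only
  rw [h w _ fun j => hx (f j)]
  refine iff_of_eq (congrArg L ?_)
  exact List.ext_getElem (by simp) fun i h₁ h₂ => by simp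

/-- The position `x j` is the only one whose track `j` is set, so it can serve as the middle letter
of `Mid`. -/
theorem WReg.split {P : List C → Prop} {S : C → Prop} {Q : List C → Prop} (hP : Reg P)
    (hQ : Reg Q) (j : Fin n) : WReg n fun w x =>
      P (w.take (x j)) ∧ (∃ c, w[x j]? = some c ∧ S c) ∧ Q (w.drop (x j + 1)) := by
  refine ⟨_, Reg.mid (S := fun c => S c.1 ∧ c.2 j = true) (hP.comap Prod.fst)
    (hQ.comap Prod.fst), fun w x hx => ⟨?_, ?_⟩⟩
  · rintro ⟨h₁, ⟨c, hc, h₂⟩, h₃⟩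
    rw [List.getElem?_eq_some_iff] at hc
    obtain ⟨hj, rfl⟩ := hc
    exact ⟨x j, by simpa using hj, by simpa [List.map_take] using h₁, by simpa using h₂,
      by simpa [List.map_drop] using h₃⟩
  · rintro ⟨i, hi, h₁, ⟨h₂, h₄⟩, h₃⟩
    simp only [List.map_take, map_fst_ann, getElem_ann, decide_eq_true_eq, List.map_drop] at *
    subst h₄
    exact ⟨h₁, ⟨_, List.getElem?_eq_getElem (hx j), h₂⟩, h₃⟩

theorem WReg.take {P : List C → Prop} (hP : Reg P) (j : Fin n) :
    WReg n fun w x => P (w.take (x j)) :=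
  (WReg.split hP (S := fun _ => True) (Reg.const True) j).congr fun w x hx => by simp [hx j]

theorem WReg.drop {Q : List C → Prop} (hQ : Reg Q) (j : Fin n) :
    WReg n fun w x => Q (w.drop (x j + 1)) :=
  (WReg.split (Reg.const True) (S := fun _ => True) hQ j).congr fun w x hx => by simp [hx j]

theorem WReg.letter (S : C → Prop) (j : Fin n) :
    WReg n fun w x => ∃ c, w[x j]? = some c ∧ S c :=
  (WReg.split (Reg.const True) (S := S) (Reg.const True) j).congr fun w x hx => by simp

theorem WReg.factor {P : List C → Prop} (hP : Reg P) (j k : Fin n) :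
    WReg n fun w x => x j < x k ∧ P ((w.take (x k)).drop (x j + 1)) := by
  refine ⟨_, Reg.mid (S := fun c => c.2 j = true) (Reg.const True)
    (Reg.mid (S := fun c => c.2 k = true) (hP.comap Prod.fst) (Reg.const True)),
    fun w x hx => ⟨?_, ?_⟩⟩
  · rintro ⟨h₁, h₂⟩
    have hk := hx k
    refine ⟨x j, by simpa using hx j, trivial, by simp, x k - (x j + 1), by simp; omega, ?_, ?_,
      trivial⟩
    · dsimp only
      rw [List.map_take, List.map_drop, map_fst_ann, ← List.drop_take]
      exact h₂
    · simp; omega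
  · rintro ⟨i, hi, -, h₁, l, hl, h₂, h₃, -⟩
    simp only [getElem_ann, List.getElem_drop, decide_eq_true_eq, List.map_take, List.map_drop,
      map_fst_ann, List.take_drop] at *
    subst h₁
    rw [h₃]
    exact ⟨by omega, h₂⟩

theorem WReg.lt (j k : Fin n) : WReg n fun (_ : List C) x => x j < x k :=
  (WReg.factor (Reg.const True) j k).congr fun w x _ => by simp

theorem WReg.le (j k : Fin n) : WReg n fun (_ : List C) x => x j ≤ x k :=
  (WReg.lt k j).not.congr fun w x _ => by simp

theorem WReg.eq (j k : Fin n) : WReg n fun (_ : List C) x => x j = x k :=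
  ((WReg.le j k).and (WReg.le k j)).congr fun w x _ => by omega

theorem WReg.succ (j k : Fin n) : WReg n fun (_ : List C) x => x j + 1 = x k := by
  refine (WReg.factor Reg.eq_nil j k).congr fun w x hx => ?_
  have := hx k
  simp only [List.drop_eq_nil_iff, List.length_take]
  omega

/-- Turns counting up to a threshold into nested existential quantifiers: `i` is the least element,
and the others come after it. -/
theorem succ_le_ncard_iff (m : ℕ) (p : ℕ → Prop) (c : ℕ) :
    c + 1 ≤ {i | i < m ∧ p i}.ncard ↔
      ∃ i < m, p i ∧ c ≤ {k | k < m ∧ p k ∧ i < k}.ncard := by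
  classical
  have hfin : ∀ q : ℕ → Prop, {i | i < m ∧ q i}.Finite := fun q =>
    (Set.finite_lt_nat m).subset fun i hi => hi.1
  constructor
  · intro h
    have hex : ∃ i, i < m ∧ p i := by
      by_contra hne
      push Not at hne
      have : {i | i < m ∧ p i} = ∅ := Set.eq_empty_of_forall_notMem fun i hi => hne i hi.1 hi.2
      simp [this] at h
    refine ⟨Nat.find hex, (Nat.find_spec hex).1, (Nat.find_spec hex).2, ?_⟩
    have : {k | k < m ∧ p k ∧ Nat.find hex < k} = {i | i < m ∧ p i} \ {Nat.find hex} := by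
      ext k
      simp only [Set.mem_ofPred_eq, Set.mem_sdiff, Set.mem_singleton_iff]
      constructor
      · rintro ⟨h₁, h₂, h₃⟩
        exact ⟨⟨h₁, h₂⟩, h₃.ne'⟩
      · rintro ⟨⟨h₁, h₂⟩, h₃⟩
        exact ⟨h₁, h₂, lt_of_le_of_ne (Nat.find_min' hex ⟨h₁, h₂⟩) (Ne.symm h₃)⟩
    rw [this, Set.ncard_sdiff_singleton_of_mem
      (show Nat.find hex ∈ {i | i < m ∧ p i} from Nat.find_spec hex)]
    omega
  · rintro ⟨i, hi, hp, hc⟩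
    refine (Nat.succ_le_succ hc).trans ?_
    have hni : i ∉ {k | k < m ∧ p k ∧ i < k} := by simp
    rw [Nat.succ_eq_add_one, ← Set.ncard_insert_of_notMem hni (hfin fun k => p k ∧ i < k)]
    refine Set.ncard_le_ncard (fun k hk => ?_) (hfin p)
    rcases hk with rfl | hk
    · exact ⟨hi, hp⟩
    · exact ⟨hk.1, hk.2.1⟩

theorem WReg.le_ncard {P : List C → (Fin n → ℕ) → ℕ → Prop} (c : ℕ)
    (h : WReg (n + 1) fun w y => P w (fun j => y j.succ) (y 0)) :
    WReg n fun w x => c ≤ {i | i < w.length ∧ P w x i}.ncard := by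
  induction c generalizing n with
  | zero => exact (WReg.const True).congr fun w x _ => by simp
  | succ c ih =>
    have h₂ : WReg (n + 1) fun w y =>
        c ≤ {k | k < w.length ∧ P w (fun j => y j.succ) k ∧ y 0 < k}.ncard := by
      refine ih (P := fun w y k => P w (fun j => y j.succ) k ∧ y 0 < k) ?_
      -- Variable 0 is the new position `k` and variable 1 is the least position `i`, which `P` does
      -- not see; the parameters start at 2.
      refine ((WReg.reindex h (Fin.cons 0 fun j => j.succ.succ)).and (WReg.lt 1 0)).congr ?_
      intro w x _
      simp
    refine (WReg.ex (P := fun w x i => P w x i ∧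
      c ≤ {k | k < w.length ∧ P w x k ∧ i < k}.ncard) (h.and h₂)).congr fun w x _ => ?_
    rw [succ_le_ncard_iff]

/-- A relation between no positions is a regular language. -/
theorem WReg.reg {P : List C → Prop} (h : WReg 0 fun w _ => P w) : Reg P := by
  obtain ⟨L, hL, h⟩ := h
  refine (hL.comap fun c : C => (c, Fin.elim0)).congr fun w => ?_
  refine Iff.trans (iff_of_eq (congrArg L ?_)) (h w Fin.elim0 fun j => j.elim0).symm
  refine List.ext_getElem (by simp) fun i h₁ h₂ => ?_
  simp only [List.getElem_map, getElem_ann]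
  exact Prod.ext rfl (funext fun j => j.elim0)

end WordRelations

/-! ### Closure properties of polyblind and polyregular functions -/

section Closure

variable {A : Type u} {B : Type v}

/-- The sum over all ways to split a word into a prefix, a letter and a suffix. -/
def splitSum (G : List A → A → List A → ℕ) (w : List A) : ℕ :=
  ∑ i : Fin w.length, G (w.take i) w[i] (w.drop (i + 1))

@[simp] theorem splitSum_nil (G : List A → A → List A → ℕ) : splitSum G [] = 0 := rfl

theorem splitSum_cons (G : List A → A → List A → ℕ) (a : A) (w : List A) :
    splitSum G (a :: w) = G [] a w + splitSum (fun u b v => G (a :: u) b v) w := by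
  simp [splitSum, Fin.sum_univ_succ]

theorem splitSum_append (G : List A → A → List A → ℕ) (u v : List A) :
    splitSum G (u ++ v) = splitSum (fun x b y => G x b (y ++ v)) u +
      splitSum (fun x b y => G (u ++ x) b y) v := by
  induction u generalizing G with
  | nil => simp
  | cons a u ih => simp only [List.cons_append, splitSum_cons, ih]; ring

theorem splitSum_congr {G H : List A → A → List A → ℕ} {w : List A}
    (h : ∀ u a v, u ++ a :: v = w → G u a v = H u a v) : splitSum G w = splitSum H w :=
  Finset.sum_congr rfl fun i _ => h _ _ _ (take_append_cons_drop i.2)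

/-- The letter-to-letter-or-nothing function computed by a bimachine, in a context that has values
`p` and `q`. -/
def filt {N : Type} [Monoid N] (ν : FreeMonoid A →* N) (out : N → A → N → Option B) (p q : N) :
    List A → List B
  | [] => []
  | a :: w => (out p a (ν (FreeMonoid.ofList w) * q)).toList ++
      filt ν out (p * ν (FreeMonoid.of a)) q w

/-- The functions on words that relabel or erase each letter, as chosen by a bimachine. -/
def IsRational (σ : List A → List B) : Prop :=
  ∃ (N : Type) (_ : Monoid N) (_ : Finite N) (ν : FreeMonoid A →* N)
    (out : N → A → N → Option B), ∀ w, σ w = filt ν out 1 1 w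

section Filt

variable {N : Type} [Monoid N] (ν : FreeMonoid A →* N) (out : N → A → N → Option B)

theorem filt_append (p q : N) (u v : List A) :
    filt ν out p q (u ++ v) = filt ν out p (ν (FreeMonoid.ofList v) * q) u ++
      filt ν out (p * ν (FreeMonoid.ofList u)) q v := by
  induction u generalizing p with
  | nil => simp [filt]
  | cons a u ih => simp [filt, ih, mul_assoc]

theorem length_filt_le (p q : N) (w : List A) : (filt ν out p q w).length ≤ w.length := by
  induction w generalizing p with
  | nil => simp [filt]
  | cons a w ih =>
    have := ih (p * ν (FreeMonoid.of a))
    have h : (out p a (ν (FreeMonoid.ofList w) * q)).toList.length ≤ 1 := by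
      cases out p a (ν (FreeMonoid.ofList w) * q) <;> simp
    simp only [filt, List.length_append, List.length_cons]
    omega

/-- Erased positions contribute nothing, so a sum over the image is a sum over the source. The
images of the two sides are taken in contexts enlarged by the values of the letter and of the
opposite side. This is how bimachines are pulled back along rational functions. -/
theorem splitSum_filt (G : List B → B → List B → ℕ) (p q : N) (w : List A) :
    splitSum G (filt ν out p q w) = splitSum (fun u a v =>
      (out (p * ν (FreeMonoid.ofList u)) a (ν (FreeMonoid.ofList v) * q)).elim 0 fun b =>
        G (filt ν out p (ν (FreeMonoid.of a) * (ν (FreeMonoid.ofList v) * q)) u) b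
          (filt ν out (p * ν (FreeMonoid.ofList u) * ν (FreeMonoid.of a)) q v)) w := by
  induction w generalizing p G with
  | nil => simp [filt]
  | cons a w ih =>
    rw [splitSum_cons]
    conv_lhs => rw [filt, splitSum_append, ih]
    congr 1
    · cases h : out p a (ν (FreeMonoid.ofList w) * q) <;>
        simp [h, splitSum_cons, filt]
    · refine splitSum_congr fun u b v h => ?_
      subst h
      simp [filt, mul_assoc]

end Filt

/-- The monoid of the bimachine that evaluates a morphism to `M` on the image of a rational
function: a word acts by its value and, for each context, by the value of its image. -/
structure Bilateral (N M : Type) where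
  val : N
  img : N → N → M

namespace Bilateral

@[ext] theorem ext' {N M : Type} {x y : Bilateral N M} (h₁ : x.val = y.val) (h₂ : x.img = y.img) : x = y := by
  cases x; cases y; simp_all

variable {N M : Type} [Monoid N] [Monoid M]

instance : Monoid (Bilateral N M) where
  mul x y := ⟨x.val * y.val, fun p q => x.img p (y.val * q) * y.img (p * x.val) q⟩
  one := ⟨1, fun _ _ => 1⟩
  mul_assoc x y z := by
    refine ext' (mul_assoc _ _ _) ?_
    funext p q
    change x.img p (y.val * (z.val * q)) * y.img (p * x.val) (z.val * q) *
        z.img (p * (x.val * y.val)) q =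
      x.img p (y.val * z.val * q) *
        (y.img (p * x.val) (z.val * q) * z.img (p * x.val * y.val) q)
    simp only [mul_assoc]
  one_mul x := by
    refine ext' (one_mul _) ?_
    funext p q
    change 1 * x.img (p * 1) q = x.img p q
    simp
  mul_one x := by
    refine ext' (mul_one _) ?_
    funext p q
    change x.img p (1 * q) * 1 = x.img p q
    simp

theorem val_mul (x y : Bilateral N M) : (x * y).val = x.val * y.val := rfl

theorem img_mul (x y : Bilateral N M) (p q : N) :
    (x * y).img p q = x.img p (y.val * q) * y.img (p * x.val) q := rfl

instance [Finite N] [Finite M] : Finite (Bilateral N M) :=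
  Finite.of_injective (fun x : Bilateral N M => (x.val, x.img)) fun x y h => by
    rw [Prod.ext_iff] at h
    exact ext' h.1 h.2

/-- The morphism that evaluates words under `ν` and their images under `μ`. -/
def hom (ν : FreeMonoid A →* N) (out : N → A → N → Option B) (μ : FreeMonoid B →* M) :
    FreeMonoid A →* Bilateral N M :=
  FreeMonoid.lift fun a =>
    ⟨ν (FreeMonoid.of a), fun p q => μ (FreeMonoid.ofList (out p a q).toList)⟩

variable (ν : FreeMonoid A →* N) (out : N → A → N → Option B) (μ : FreeMonoid B →* M)

theorem hom_ofList (w : List A) : hom ν out μ (FreeMonoid.ofList w) =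
    ⟨ν (FreeMonoid.ofList w), fun p q => μ (FreeMonoid.ofList (filt ν out p q w))⟩ := by
  induction w with
  | nil => simp [filt]; rfl
  | cons a w ih =>
    rw [FreeMonoid.ofList_cons, map_mul, ih]
    refine ext' ?_ ?_
    · simp [val_mul, hom]
    · funext p q
      simp [img_mul, hom, filt]

end Bilateral

theorem isPebble_succ_iff {k : ℕ} {f : List A → ℕ} : IsPebble (k + 1) A f ↔
    ∃ (N : Type) (_ : Monoid N) (_ : Finite N) (μ : FreeMonoid A →* N)
      (h : N → A → N → List (A ⊕ A) → ℕ),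
      (∀ m a n, IsPebble k (A ⊕ A) (h m a n)) ∧
      ∀ w, f w = splitSum (fun u a v => h (μ (FreeMonoid.ofList u)) a (μ (FreeMonoid.ofList v))
        (u.map Sum.inl ++ Sum.inr a :: v.map Sum.inl)) w := Iff.rfl

theorem isBlind_succ_iff {k : ℕ} {f : List A → ℕ} : IsBlind (k + 1) f ↔
    ∃ (N : Type) (_ : Monoid N) (_ : Finite N) (μ : FreeMonoid A →* N)
      (h : N → A → N → List A → ℕ), (∀ m a n, IsBlind k (h m a n)) ∧
      ∀ w, f w = splitSum (fun u a v =>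
        h (μ (FreeMonoid.ofList u)) a (μ (FreeMonoid.ofList v)) w) w := Iff.rfl

theorem IsPebble.zero (k : ℕ) (A : Type u) : IsPebble k A fun _ => 0 := by
  induction k generalizing A with
  | zero => exact ⟨0, fun _ => rfl⟩
  | succ k ih =>
    exact isPebble_succ_iff.2 ⟨Unit, inferInstance, inferInstance, 1, fun _ _ _ _ => 0,
      fun _ _ _ => ih _, fun w => by simp [splitSum]⟩

theorem IsBlind.zero (k : ℕ) : IsBlind k fun _ : List A => 0 := by
  induction k with
  | zero => exact ⟨0, fun _ => rfl⟩
  | succ k ih =>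
    exact isBlind_succ_iff.2 ⟨Unit, inferInstance, inferInstance, 1, fun _ _ _ _ => 0,
      fun _ _ _ => ih, fun w => by simp [splitSum]⟩

/-- At a position of the source, the `Bilateral` values of prefix and suffix give the values under
`μ` of their images, once the contexts seen from that position are supplied. -/
theorem IsBlind.comp {k : ℕ} {f : List B → ℕ} (hf : IsBlind k f) {σ : List A → List B}
    (hσ : IsRational σ) : IsBlind k fun w => f (σ w) := by
  induction k generalizing f with
  | zero =>
    obtain ⟨c, hc⟩ := hf
    exact ⟨c, fun w => hc _⟩
  | succ k ih =>
    obtain ⟨M, _, _, μ, h, hh, hf⟩ := isBlind_succ_iff.1 hf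
    obtain ⟨N, _, _, ν, out, hσ'⟩ := hσ
    refine isBlind_succ_iff.2 ⟨Bilateral N M, inferInstance, inferInstance,
      Bilateral.hom ν out μ, fun x a y => (out x.val a y.val).elim (fun _ => 0) fun b w =>
        h (x.img 1 (ν (FreeMonoid.of a) * y.val)) b (y.img (x.val * ν (FreeMonoid.of a)) 1) (σ w),
      fun x a y => ?_, fun w => ?_⟩
    · dsimp only
      cases out x.val a y.val with
      | none => exact IsBlind.zero k
      | some b => exact ih (hh _ _ _)
    · rw [hf, hσ', splitSum_filt]
      refine splitSum_congr fun u a v _ => ?_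
      simp only [Bilateral.hom_ofList, one_mul, mul_one]
      cases out (ν (FreeMonoid.ofList u)) a (ν (FreeMonoid.ofList v)) <;> simp [hσ']

/-- A rational function acts on words with marks. -/
theorem IsRational.underline {N : Type} [Monoid N] (ν : FreeMonoid A →* N)
    (out : N → A → N → Option B) : ∃ (ν' : FreeMonoid (A ⊕ A) →* N)
      (out' : N → A ⊕ A → N → Option (B ⊕ B)), ∀ (u v : List A) (a : A) (b : B),
      out (ν (FreeMonoid.ofList u)) a (ν (FreeMonoid.ofList v)) = some b →
      filt ν' out' 1 1 (u.map Sum.inl ++ Sum.inr a :: v.map Sum.inl) =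
        (filt ν out 1 (ν (FreeMonoid.of a) * ν (FreeMonoid.ofList v)) u).map Sum.inl ++
          Sum.inr b :: (filt ν out (ν (FreeMonoid.ofList u) * ν (FreeMonoid.of a)) 1 v).map
            Sum.inl := by
  let ν' : FreeMonoid (A ⊕ A) →* N := ν.comp (FreeMonoid.map (Sum.elim id id))
  let out' : N → A ⊕ A → N → Option (B ⊕ B) := fun p c q =>
    Sum.elim (fun a => (out p a q).map Sum.inl) (fun a => (out p a q).map Sum.inr) c
  have hν : ∀ w : List A, ν' (FreeMonoid.ofList (w.map Sum.inl)) = ν (FreeMonoid.ofList w) := by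
    intro w
    induction w with
    | nil => simp
    | cons a w ih =>
      rw [List.map_cons, FreeMonoid.ofList_cons, map_mul, ih, FreeMonoid.ofList_cons, map_mul]
      simp [ν']
  have h₁ : ∀ (a : A), ν' (FreeMonoid.of (Sum.inr a)) = ν (FreeMonoid.of a) := by
    intro a
    simp [ν']
  have h₂ : ∀ (a : A), ν' (FreeMonoid.of (Sum.inl a)) = ν (FreeMonoid.of a) := by
    intro a
    simp [ν']
  have key : ∀ (w : List A) (p q : N), filt ν' out' p q (w.map Sum.inl) =
      (filt ν out p q w).map Sum.inl := by
    intro w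
    induction w with
    | nil => intro p q; rfl
    | cons a w ih =>
      intro p q
      simp only [List.map_cons, filt, List.map_append, ih, hν, h₂, out', Sum.elim_inl]
      cases out p a (ν (FreeMonoid.ofList w) * q) <;> simp
  refine ⟨ν', out', fun u v a b hb => ?_⟩
  rw [filt_append, key, filt, key, hν, hν, FreeMonoid.ofList_cons, map_mul, h₁, hν]
  simp [out', hb]

/-- As in the blind case, but the inner functions read marked words, so the rational function is
replaced by one that carries the mark along. The inner function is only selected at positions that
are not erased, where `IsRational.underline` applies. -/
theorem IsPebble.comp {k : ℕ} {A : Type u} {B : Type v} {f : List B → ℕ} (hf : IsPebble k B f)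
    {σ : List A → List B} (hσ : IsRational σ) : IsPebble k A fun w => f (σ w) := by
  induction k generalizing A B f with
  | zero =>
    obtain ⟨c, hc⟩ := hf
    exact ⟨c, fun w => hc _⟩
  | succ k ih =>
    obtain ⟨M, _, _, μ, h, hh, hf⟩ := isPebble_succ_iff.1 hf
    obtain ⟨N, _, _, ν, out, hσ'⟩ := hσ
    obtain ⟨ν', out', hu⟩ := IsRational.underline ν out
    refine isPebble_succ_iff.2 ⟨Bilateral N M, inferInstance, inferInstance,
      Bilateral.hom ν out μ, fun x a y => (out x.val a y.val).elim (fun _ => 0) fun b w =>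
        h (x.img 1 (ν (FreeMonoid.of a) * y.val)) b (y.img (x.val * ν (FreeMonoid.of a)) 1)
          (filt ν' out' 1 1 w),
      fun x a y => ?_, fun w => ?_⟩
    · dsimp only
      cases out x.val a y.val with
      | none => exact IsPebble.zero k _
      | some b => exact ih (hh _ _ _) ⟨N, _, ‹_›, ν', out', fun _ => rfl⟩
    · rw [hf, hσ', splitSum_filt]
      refine splitSum_congr fun u a v _ => ?_
      simp only [Bilateral.hom_ofList, one_mul, mul_one]
      cases hb : out (ν (FreeMonoid.ofList u)) a (ν (FreeMonoid.ofList v)) with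
      | none => rfl
      | some b => simp [hu u v a b hb]

theorem filt_unit (g : A → Option B) (w : List A) :
    filt (N := Unit) 1 (fun _ a _ => g a) 1 1 w = w.filterMap g := by
  induction w with
  | nil => rfl
  | cons a w ih =>
    rw [filt, List.filterMap_cons]
    change (g a).toList ++ filt (N := Unit) 1 (fun _ a _ => g a) 1 1 w = _
    rw [ih]
    cases g a <;> rfl

theorem isRational_map (g : A → B) : IsRational (List.map g) :=
  ⟨Unit, inferInstance, inferInstance, 1, fun _ a _ => some (g a), fun w => by
    rw [filt_unit fun a => some (g a)]; simp⟩

end Closure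

section Closure

variable {A : Type u} {B : Type v}

theorem Reg.rational {P : List B → Prop} (hP : Reg P) {σ : List A → List B} (hσ : IsRational σ) :
    Reg fun w => P (σ w) := by
  obtain ⟨M, _, _, φ, S, hS⟩ := hP.exists_hom
  obtain ⟨N, _, _, ν, out, hσ⟩ := hσ
  refine (Reg.of_hom (Bilateral.hom ν out φ) fun x => S (x.img 1 1)).congr fun w => ?_
  rw [Bilateral.hom_ofList, hS, hσ]

theorem splitSum_zero (w : List A) : splitSum (fun _ _ _ => 0) w = 0 := by simp [splitSum]

theorem splitSum_add (G H : List A → A → List A → ℕ) (w : List A) :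
    splitSum (fun u a v => G u a v + H u a v) w = splitSum G w + splitSum H w :=
  Finset.sum_add_distrib

theorem splitSum_mul (G : List A → A → List A → ℕ) (c : ℕ) (w : List A) :
    splitSum (fun u a v => G u a v * c) w = splitSum G w * c :=
  (Finset.sum_mul _ _ _).symm

/-- A bimachine outputs a value exactly once by doing so at the first position only; this is why the
empty word has to be excluded. -/
theorem splitSum_first {c : ℕ} {w : List A} (hw : w ≠ []) (G : List A → A → List A → ℕ)
    (h : ∀ u a v, u ++ a :: v = w → G u a v = if u = [] then c else 0) :
    splitSum G w = c := by
  obtain ⟨a, w, rfl⟩ := List.exists_cons_of_ne_nil hw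
  rw [splitSum_cons, h [] a w rfl, splitSum_congr (H := fun _ _ _ => 0), splitSum_zero]
  · simp
  · intro u b v huv
    rw [h (a :: u) b v (by simp [huv])]
    simp

/-! #### Blind bimachines -/

theorem IsBlind.add {k : ℕ} {f g : List A → ℕ} (hf : IsBlind k f) (hg : IsBlind k g) :
    IsBlind k fun w => f w + g w := by
  induction k generalizing f g with
  | zero =>
    obtain ⟨c, hc⟩ := hf
    obtain ⟨d, hd⟩ := hg
    exact ⟨c + d, fun w => by simp only [hc, hd]⟩
  | succ k ih =>
    obtain ⟨N, _, _, μ, h, hh, hf⟩ := isBlind_succ_iff.1 hf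
    obtain ⟨N', _, _, μ', h', hh', hg⟩ := isBlind_succ_iff.1 hg
    refine isBlind_succ_iff.2 ⟨N × N', inferInstance, inferInstance, μ.prod μ',
      fun x a y w => h x.1 a y.1 w + h' x.2 a y.2 w, fun x a y => ih (hh _ _ _) (hh' _ _ _),
      fun w => ?_⟩
    rw [hf, hg, ← splitSum_add]
    rfl

/-- The second function is nested below the innermost level of the first one, where it is multiplied
by a constant, that is, added to itself. -/
theorem IsBlind.mul {k l : ℕ} {f g : List A → ℕ} (hf : IsBlind k f) (hg : IsBlind l g) :
    IsBlind (k + l) fun w => f w * g w := by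
  induction k generalizing f with
  | zero =>
    obtain ⟨c, hc⟩ := hf
    simp only [hc, zero_add]
    clear hc
    induction c with
    | zero => simpa using IsBlind.zero l
    | succ c ih => simpa only [Nat.succ_mul] using ih.add hg
  | succ k ih =>
    obtain ⟨N, _, _, μ, h, hh, hf⟩ := isBlind_succ_iff.1 hf
    rw [show k + 1 + l = k + l + 1 by omega]
    refine isBlind_succ_iff.2 ⟨N, inferInstance, inferInstance, μ,
      fun x a y w => h x a y w * g w, fun x a y => ih (hh _ _ _), fun w => ?_⟩
    rw [hf, ← splitSum_mul]

open Classical in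
-- The test is made at the first position, recognized by its empty prefix. There the values of
-- prefix, letter and suffix give the value of the whole word.
theorem IsBlind.ite {k : ℕ} {f : List A → ℕ} (hf : IsBlind k f) {P : List A → Prop}
    (hP : Reg P) : ∃ g : List A → ℕ, IsBlind (k + 1) g ∧
      ∀ w, w ≠ [] → g w = if P w then f w else 0 := by
  obtain ⟨N, _, _, φ, S, hS⟩ := hP.exists_hom
  obtain ⟨N', _, _, φ', S', hS'⟩ := (Reg.eq_nil (B := A)).exists_hom
  refine ⟨_, isBlind_succ_iff.2 ⟨N × N', inferInstance, inferInstance, φ.prod φ',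
    fun x a y w => if S' x.2 ∧ S (x.1 * (φ (FreeMonoid.of a) * y.1)) then f w else 0,
    fun x a y => ?_, fun w => rfl⟩, fun w hw => splitSum_first hw _ fun u a v huv => ?_⟩
  · by_cases h : S' x.2 ∧ S (x.1 * (φ (FreeMonoid.of a) * y.1))
    · simpa only [h, and_self, if_true] using hf
    · simpa only [h, if_false] using IsBlind.zero k
  · subst huv
    simp only [MonoidHom.prod_apply, hS, hS', FreeMonoid.ofList_append, FreeMonoid.ofList_cons,
      map_mul]
    by_cases h₁ : S' (φ' (FreeMonoid.ofList u)) <;> simp [h₁]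

theorem IsBlind.raise {k l : ℕ} (hkl : k ≤ l) {f : List A → ℕ} (hf : IsBlind k f) :
    ∃ g : List A → ℕ, IsBlind l g ∧ ∀ w, w ≠ [] → g w = f w := by
  induction l, hkl using Nat.le_induction with
  | base => exact ⟨f, hf, fun _ _ => rfl⟩
  | succ l _ ih =>
    obtain ⟨g, hg, h⟩ := ih
    obtain ⟨g', hg', h'⟩ := hg.ite (Reg.const True)
    exact ⟨g', hg', fun w hw => by simp [h' w hw, h w hw]⟩

theorem IsPolyblind.congr {f g : List A → ℕ} (hf : IsPolyblind f)
    (h : ∀ w, w ≠ [] → f w = g w) : IsPolyblind g := by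
  obtain ⟨k, hk, f', hf', h'⟩ := hf
  exact ⟨k, hk, f', hf', fun w hw => by rw [← h w hw, h' w hw]⟩

theorem IsPolyblind.add {f g : List A → ℕ} (hf : IsPolyblind f) (hg : IsPolyblind g) :
    IsPolyblind fun w => f w + g w := by
  obtain ⟨k, hk, f', hf', h⟩ := hf
  obtain ⟨l, hl, g', hg', h'⟩ := hg
  obtain ⟨f'', hf'', h₁⟩ := hf'.raise (le_max_left k l)
  obtain ⟨g'', hg'', h₂⟩ := hg'.raise (le_max_right k l)
  exact ⟨_, hk.trans (le_max_left k l), _, hf''.add hg'', fun w hw => by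
    simp only [h w hw, h' w hw, h₁ w hw, h₂ w hw]⟩

theorem IsPolyblind.mul {f g : List A → ℕ} (hf : IsPolyblind f) (hg : IsPolyblind g) :
    IsPolyblind fun w => f w * g w := by
  obtain ⟨k, hk, f', hf', h⟩ := hf
  obtain ⟨l, hl, g', hg', h'⟩ := hg
  exact ⟨_, by omega, _, hf'.mul hg', fun w hw => by simp only [h w hw, h' w hw]⟩

open Classical in
theorem IsPolyblind.indicator {P : List A → Prop} (hP : Reg P) (c : ℕ) :
    IsPolyblind fun w => if P w then c else 0 := by
  obtain ⟨g, hg, h⟩ := IsBlind.ite (k := 0) (f := fun _ : List A => c) ⟨c, fun _ => rfl⟩ hP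
  exact ⟨1, le_rfl, g, hg, fun w hw => (h w hw).symm⟩

theorem IsPolyblind.const (c : ℕ) : IsPolyblind fun _ : List A => c :=
  (IsPolyblind.indicator (Reg.const True) c).congr fun w _ => by simp

theorem IsBlind.apply_nil {k : ℕ} {f : List A → ℕ} (hf : IsBlind (k + 1) f) : f [] = 0 := by
  obtain ⟨N, _, _, μ, h, hh, hf⟩ := isBlind_succ_iff.1 hf
  simp [hf]

/-- A rational function may erase a whole non-empty word. The bimachine gives 0 on the empty word,
and the free value `f []` is added back by an indicator. -/
theorem IsPolyblind.comp {f : List B → ℕ} (hf : IsPolyblind f) {σ : List A → List B}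
    (hσ : IsRational σ) : IsPolyblind fun w => f (σ w) := by
  obtain ⟨k, hk, f', hf', h⟩ := hf
  obtain ⟨k, rfl⟩ : ∃ l, k = l + 1 := ⟨k - 1, by omega⟩
  have h₁ : IsPolyblind fun w => f' (σ w) := ⟨_, hk, _, hf'.comp hσ, fun w _ => rfl⟩
  refine (h₁.add (IsPolyblind.indicator (Reg.eq_nil.rational hσ) (f []))).congr fun w _ => ?_
  by_cases hw : σ w = []
  · simp [hw, hf'.apply_nil]
  · simp [hw, h]

/-! #### Pebble bimachines -/

theorem IsPebble.add {k : ℕ} {A : Type u} {f g : List A → ℕ} (hf : IsPebble k A f)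
    (hg : IsPebble k A g) : IsPebble k A fun w => f w + g w := by
  induction k generalizing A with
  | zero =>
    obtain ⟨c, hc⟩ := hf
    obtain ⟨d, hd⟩ := hg
    exact ⟨c + d, fun w => by simp only [hc, hd]⟩
  | succ k ih =>
    obtain ⟨N, _, _, μ, h, hh, hf⟩ := isPebble_succ_iff.1 hf
    obtain ⟨N', _, _, μ', h', hh', hg⟩ := isPebble_succ_iff.1 hg
    refine isPebble_succ_iff.2 ⟨N × N', inferInstance, inferInstance, μ.prod μ',
      fun x a y w => h x.1 a y.1 w + h' x.2 a y.2 w, fun x a y => ih (hh _ _ _) (hh' _ _ _),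
      fun w => ?_⟩
    rw [hf, hg, ← splitSum_add]
    rfl

theorem map_elim_underlined (u v : List A) (a : A) :
    (u.map Sum.inl ++ Sum.inr a :: v.map Sum.inl).map (Sum.elim id id) = u ++ a :: v := by
  simp

/-- As for blind functions, except that the second factor must forget the marks set by the first,
which is composition with a letter-to-letter map. -/
theorem IsPebble.mul {k l : ℕ} {A : Type u} {f g : List A → ℕ} (hf : IsPebble k A f)
    (hg : IsPebble l A g) : IsPebble (k + l) A fun w => f w * g w := by
  induction k generalizing A with
  | zero =>
    obtain ⟨c, hc⟩ := hf
    simp only [hc, zero_add]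
    clear hc
    induction c with
    | zero => simpa using IsPebble.zero l A
    | succ c ih => simpa only [Nat.succ_mul] using ih.add hg
  | succ k ih =>
    obtain ⟨N, _, _, μ, h, hh, hf⟩ := isPebble_succ_iff.1 hf
    rw [show k + 1 + l = k + l + 1 by omega]
    refine isPebble_succ_iff.2 ⟨N, inferInstance, inferInstance, μ,
      fun x a y w => h x a y w * g (w.map (Sum.elim id id)),
      fun x a y => ih (hh _ _ _) (hg.comp (isRational_map _)), fun w => ?_⟩
    rw [hf, ← splitSum_mul]
    refine splitSum_congr fun u a v huv => ?_
    simp only [map_elim_underlined, huv]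

theorem IsBlind.isPebble {k : ℕ} {f : List A → ℕ} (hf : IsBlind k f) : IsPebble k A f := by
  induction k generalizing f with
  | zero => exact hf
  | succ k ih =>
    obtain ⟨N, _, _, μ, h, hh, hf⟩ := isBlind_succ_iff.1 hf
    refine isPebble_succ_iff.2 ⟨N, inferInstance, inferInstance, μ,
      fun x a y w => h x a y (w.map (Sum.elim id id)),
      fun x a y => (ih (hh _ _ _)).comp (isRational_map _), fun w => ?_⟩
    rw [hf]
    refine splitSum_congr fun u a v huv => ?_
    simp only [map_elim_underlined, huv]

theorem IsPolyblind.isPolyregular {f : List A → ℕ} (hf : IsPolyblind f) : IsPolyregular f := by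
  obtain ⟨k, hk, g, hg, h⟩ := hf
  exact ⟨k, hk, g, hg.isPebble, h⟩

theorem IsPebble.raise {k l : ℕ} (hkl : k ≤ l) {f : List A → ℕ} (hf : IsPebble k A f) :
    ∃ g : List A → ℕ, IsPebble l A g ∧ ∀ w, w ≠ [] → g w = f w := by
  induction l, hkl using Nat.le_induction with
  | base => exact ⟨f, hf, fun _ _ => rfl⟩
  | succ l _ ih =>
    obtain ⟨g, hg, h⟩ := ih
    obtain ⟨g', hg', h'⟩ := IsBlind.ite (k := 0) (f := fun _ : List A => 1) ⟨1, fun _ => rfl⟩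
      (Reg.const True)
    exact ⟨_, hg.mul hg'.isPebble, fun w hw => by simp [h' w hw, h w hw]⟩

theorem IsPolyregular.congr {f g : List A → ℕ} (hf : IsPolyregular f)
    (h : ∀ w, w ≠ [] → f w = g w) : IsPolyregular g := by
  obtain ⟨k, hk, f', hf', h'⟩ := hf
  exact ⟨k, hk, f', hf', fun w hw => by rw [← h w hw, h' w hw]⟩

theorem IsPolyregular.add {f g : List A → ℕ} (hf : IsPolyregular f) (hg : IsPolyregular g) :
    IsPolyregular fun w => f w + g w := by
  obtain ⟨k, hk, f', hf', h⟩ := hf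
  obtain ⟨l, hl, g', hg', h'⟩ := hg
  obtain ⟨f'', hf'', h₁⟩ := hf'.raise (le_max_left k l)
  obtain ⟨g'', hg'', h₂⟩ := hg'.raise (le_max_right k l)
  exact ⟨_, hk.trans (le_max_left k l), _, hf''.add hg'', fun w hw => by
    simp only [h w hw, h' w hw, h₁ w hw, h₂ w hw]⟩

theorem IsPolyregular.mul {f g : List A → ℕ} (hf : IsPolyregular f) (hg : IsPolyregular g) :
    IsPolyregular fun w => f w * g w := by
  obtain ⟨k, hk, f', hf', h⟩ := hf
  obtain ⟨l, hl, g', hg', h'⟩ := hg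
  exact ⟨_, by omega, _, hf'.mul hg', fun w hw => by simp only [h w hw, h' w hw]⟩

theorem IsPebble.apply_nil {k : ℕ} {f : List A → ℕ} (hf : IsPebble (k + 1) A f) : f [] = 0 := by
  obtain ⟨N, _, _, μ, h, hh, hf⟩ := isPebble_succ_iff.1 hf
  simp [hf]

theorem IsPolyregular.comp {f : List B → ℕ} (hf : IsPolyregular f) {σ : List A → List B}
    (hσ : IsRational σ) : IsPolyregular fun w => f (σ w) := by
  obtain ⟨k, hk, f', hf', h⟩ := hf
  obtain ⟨k, rfl⟩ : ∃ l, k = l + 1 := ⟨k - 1, by omega⟩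
  have h₁ : IsPolyregular fun w => f' (σ w) := ⟨_, hk, _, hf'.comp hσ, fun w _ => rfl⟩
  refine (h₁.add (IsPolyblind.indicator (Reg.eq_nil.rational hσ) (f [])).isPolyregular).congr
    fun w _ => ?_
  by_cases hw : σ w = []
  · simp [hw, hf'.apply_nil]
  · simp [hw, h]

theorem IsPolyregular.sum_underline {f : List (A ⊕ A) → ℕ} (hf : IsPolyregular f) :
    IsPolyregular fun w : List A => ∑ i : Fin w.length, f (underline w i) := by
  obtain ⟨k, hk, f', hf', h⟩ := hf
  refine ⟨k + 1, by omega, _, isPebble_succ_iff.2 ⟨Unit, inferInstance, inferInstance, 1,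
    fun _ _ _ => f', fun _ _ _ => hf', fun w => rfl⟩, fun w _ => ?_⟩
  exact Finset.sum_congr rfl fun i _ => h _ (by simp [underline])

/-! #### Counting sets of positions -/

/-- The word `w` in which the positions in `T` are underlined. -/
def mark (w : List A) (T : Finset ℕ) : List (A ⊕ A) :=
  w.mapIdx fun i a => if i ∈ T then Sum.inr a else Sum.inl a

@[simp] theorem length_mark (w : List A) (T : Finset ℕ) : (mark w T).length = w.length := by
  simp [mark]

@[simp] theorem getElem_mark (w : List A) (T : Finset ℕ) (i : ℕ) (h : i < (mark w T).length) :
    (mark w T)[i] = if i ∈ T then Sum.inr (w[i]'(by simpa using h))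
      else Sum.inl (w[i]'(by simpa using h)) := by simp [mark]

theorem map_elim_mark (w : List A) (T : Finset ℕ) : (mark w T).map (Sum.elim id id) = w :=
  List.ext_getElem (by simp) fun i h₁ h₂ => by
    simp only [List.getElem_map, getElem_mark]
    split_ifs <;> rfl

theorem underline_eq_mark (w : List A) (i : Fin w.length) :
    underline w i = mark w {(i : ℕ)} := by
  refine List.ext_getElem ?_ fun k h₁ h₂ => ?_
  · simp [underline]; omega
  · simp only [underline, List.getElem_append, List.length_map, List.length_take,
      min_eq_left i.2.le, List.getElem_map, List.getElem_take, List.getElem_cons,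
      List.getElem_drop, getElem_mark, Finset.mem_singleton]
    split_ifs with h₃ h₄ h₅ h₆ h₇
    · omega
    · rfl
    · have h₈ : k = i := by omega
      simp [h₈]
    · omega
    · omega
    · have h₈ : (i : ℕ) + 1 + (k - i - 1) = k := by omega
      simp [h₈]

open Classical in
/-- The number of sets of `k` positions of `w` that, when underlined, yield a word in `P`. -/
noncomputable def setCount (P : List (A ⊕ A) → Prop) (k : ℕ) (w : List A) : ℕ :=
  (((Finset.range w.length).powersetCard k).filter fun T => P (mark w T)).card

/-- Forget whether a letter carries the outer or the inner mark. -/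
def mergeMarks : (A ⊕ A) ⊕ (A ⊕ A) → A ⊕ A := Sum.elim id fun c => Sum.inr (Sum.elim id id c)

theorem map_mergeMarks (w : List A) (i : ℕ) (T : Finset ℕ) :
    (mark (mark w {i}) T).map mergeMarks = mark w (insert i T) := by
  refine List.ext_getElem (by simp) fun k h₁ h₂ => ?_
  simp only [List.getElem_map, getElem_mark, Finset.mem_singleton, Finset.mem_insert, mergeMarks]
  split_ifs <;> simp_all

theorem Reg.forall_letter (S : A → Prop) : Reg fun w : List A => ∀ a ∈ w, S a := by
  refine (Reg.mid (S := fun a => ¬ S a) (Reg.const True) (Reg.const True)).not.congr fun w => ?_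
  simp only [Mid, true_and, and_true, not_exists, not_not, List.forall_mem_iff_getElem]

/-- Expresses by a regular language that the outer mark precedes all inner marks. The prefix carries
no mark at all, and the shape of the middle letter excludes an inner mark on the outer position. -/
theorem mid_mark_iff (w : List A) {i : ℕ} (hi : i < w.length) (T : Finset ℕ) :
    Mid (fun v => ∀ c ∈ v, ∃ a : A, c = Sum.inl (Sum.inl a)) (fun c => ∃ a, c = Sum.inl (Sum.inr a))
      (fun _ => True) (mark (mark w {i}) T) ↔ ∀ j ∈ T, j < w.length → i < j := by
  simp only [Mid, length_mark, getElem_mark, Finset.mem_singleton, and_true,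
    List.forall_mem_iff_getElem, List.getElem_take, List.length_take]
  constructor
  · rintro ⟨k, hk, h₁, a, h₂⟩ j hj hjw
    split_ifs at h₂ with h₃ h₄
    · subst h₄
      by_contra hlt
      rcases Nat.lt_or_eq_of_le (not_lt.1 hlt) with hlt | rfl
      · obtain ⟨b, hb⟩ := h₁ j (by omega)
        simp [hj] at hb
      · exact h₃ hj
    · simp at h₂
  · intro h
    have hi' : i ∉ T := fun hi' => lt_irrefl _ (h i hi' hi)
    refine ⟨i, hi, fun j hj => ?_, w[i], by simp [hi']⟩
    have hj' : j ∉ T := fun hj' => by have := h j hj' (by omega); omega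
    have hji : j ≠ i := by omega
    exact ⟨w[j], by simp [hj', hji]⟩

open Classical in
-- Each set is counted exactly once, namely when the outer mark is at its minimum.
theorem setCount_succ (P : List (A ⊕ A) → Prop) (k : ℕ) (w : List A) :
    setCount P (k + 1) w = ∑ i : Fin w.length, setCount (fun v =>
      Mid (fun v => ∀ c ∈ v, ∃ a : A, c = Sum.inl (Sum.inl a))
        (fun c => ∃ a, c = Sum.inl (Sum.inr a)) (fun _ => True) v ∧ P (v.map mergeMarks)) k
      (underline w i) := by
  simp only [setCount, underline_eq_mark, map_mergeMarks, length_mark]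
  rw [← Finset.card_sigma]
  symm
  simp only [mid_mark_iff _ (Fin.is_lt _)]
  refine Finset.card_nbij (fun x => insert (x.1 : ℕ) x.2) ?_ ?_ ?_
  · rintro ⟨i, T⟩ hT
    simp only [Finset.coe_sigma, Set.mem_sigma_iff, Finset.mem_univ, true_and,
      Finset.mem_filter, Finset.mem_powersetCard, SetLike.mem_coe] at hT ⊢
    obtain ⟨⟨h₁, h₂⟩, h₃, h₄⟩ := hT
    refine ⟨⟨Finset.insert_subset (by simp) h₁, ?_⟩, h₄⟩
    rw [Finset.card_insert_of_notMem fun hi => lt_irrefl _ (h₃ i hi i.2), h₂]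
  · rintro ⟨i, T⟩ hT ⟨j, T'⟩ hT' h
    simp only [Finset.coe_sigma, Set.mem_sigma_iff, SetLike.mem_coe,
      Finset.mem_univ, true_and, Finset.mem_filter, Finset.mem_powersetCard] at hT hT' h
    have hlt : ∀ k ∈ T, (i : ℕ) < k := fun k hk =>
      hT.2.1 k hk (Finset.mem_range.1 (hT.1.1 hk))
    have hlt' : ∀ k ∈ T', (j : ℕ) < k := fun k hk =>
      hT'.2.1 k hk (Finset.mem_range.1 (hT'.1.1 hk))
    have hij : i = j := by
      have h₁ : (i : ℕ) ∈ insert (j : ℕ) T' := h ▸ Finset.mem_insert_self _ _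
      have h₂ : (j : ℕ) ∈ insert (i : ℕ) T := h ▸ Finset.mem_insert_self _ _
      rcases Finset.mem_insert.1 h₁ with h₁ | h₁
      · exact Fin.ext h₁
      rcases Finset.mem_insert.1 h₂ with h₂ | h₂
      · exact Fin.ext h₂.symm
      · exact absurd (hlt _ h₂) (hlt' _ h₁).not_gt
    subst hij
    have hT₁ := Finset.erase_insert fun hi => lt_irrefl _ (hlt i hi)
    have hT₂ := Finset.erase_insert fun hi => lt_irrefl _ (hlt' i hi)
    rw [← hT₁, ← hT₂, h]
  · intro T hT
    simp only [SetLike.mem_coe, Finset.mem_filter, Finset.mem_powersetCard] at hT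
    obtain ⟨⟨h₁, h₂⟩, h₃⟩ := hT
    have hne : T.Nonempty := Finset.card_pos.1 (by omega)
    have hmem := T.min'_mem hne
    refine ⟨⟨⟨T.min' hne, Finset.mem_range.1 (h₁ hmem)⟩, T.erase (T.min' hne)⟩, ?_,
      Finset.insert_erase hmem⟩
    simp only [Finset.coe_sigma, Set.mem_sigma_iff, SetLike.mem_coe, Finset.mem_univ,
      true_and, Finset.mem_filter, Finset.mem_powersetCard, Finset.insert_erase hmem,
      Finset.card_erase_of_mem hmem, h₂]
    refine ⟨⟨(Finset.erase_subset _ _).trans h₁, rfl⟩, fun j hj _ => ?_, h₃⟩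
    rw [Finset.mem_erase] at hj
    exact lt_of_le_of_ne (T.min'_le j hj.2) (Ne.symm hj.1)

/-- One pebble per element, dropped in increasing order, followed by a regular test of the marked
word. -/
theorem IsPolyregular.setCount {P : List (A ⊕ A) → Prop} (hP : Reg P) (k : ℕ) :
    IsPolyregular (setCount P k) := by
  classical
  induction k generalizing A with
  | zero =>
    refine (IsPolyblind.indicator (hP.comap Sum.inl) 1).isPolyregular.congr fun w _ => ?_
    have : mark w ∅ = w.map Sum.inl := List.ext_getElem (by simp) fun i h₁ h₂ => by simp
    simp [PolyCount.setCount, Finset.filter_singleton, this, apply_ite Finset.card]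
  | succ k ih =>
    refine (IsPolyregular.sum_underline (ih ?_)).congr fun w _ => (setCount_succ P k w).symm
    exact (Reg.mid (Reg.forall_letter _) (Reg.const True)).and (hP.comap mergeMarks)

/-! #### Growth -/

theorem HasGrowth.mono {f : List A → ℕ} {r s : ℕ} (hf : HasGrowth f r) (h : r ≤ s) :
    HasGrowth f s := by
  obtain ⟨C, hC⟩ := hf
  refine ⟨C, fun w hw => (hC w hw).trans (Nat.mul_le_mul_left _ ?_)⟩
  exact Nat.pow_le_pow_right (List.length_pos_iff.2 hw) h

theorem HasGrowth.add {f g : List A → ℕ} {r : ℕ} (hf : HasGrowth f r) (hg : HasGrowth g r) :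
    HasGrowth (fun w => f w + g w) r := by
  obtain ⟨C, hC⟩ := hf
  obtain ⟨D, hD⟩ := hg
  exact ⟨C + D, fun w hw => (Nat.add_le_add (hC w hw) (hD w hw)).trans_eq (by ring)⟩

theorem HasGrowth.mul {f g : List A → ℕ} {r s : ℕ} (hf : HasGrowth f r) (hg : HasGrowth g s) :
    HasGrowth (fun w => f w * g w) (r + s) := by
  obtain ⟨C, hC⟩ := hf
  obtain ⟨D, hD⟩ := hg
  exact ⟨C * D, fun w hw => (Nat.mul_le_mul (hC w hw) (hD w hw)).trans_eq (by ring)⟩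

theorem HasGrowth.const (c r : ℕ) : HasGrowth (fun _ : List A => c) r :=
  ⟨c, fun _ hw => Nat.le_mul_of_pos_right _ (Nat.pow_pos (List.length_pos_iff.2 hw))⟩

theorem HasGrowth.of_le {f g : List A → ℕ} {r : ℕ} (hg : HasGrowth g r) (h : ∀ w, f w ≤ g w) :
    HasGrowth f r := by
  obtain ⟨C, hC⟩ := hg
  exact ⟨C, fun w hw => (h w).trans (hC w hw)⟩

theorem IsRational.length_le {σ : List A → List B} (hσ : IsRational σ) (w : List A) :
    (σ w).length ≤ w.length := by
  obtain ⟨N, _, _, ν, out, hσ⟩ := hσ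
  rw [hσ]
  exact length_filt_le _ _ _ _ _

theorem HasGrowth.comp {f : List B → ℕ} {r : ℕ} (hf : HasGrowth f r) {σ : List A → List B}
    (hσ : IsRational σ) : HasGrowth (fun w => f (σ w)) r := by
  obtain ⟨C, hC⟩ := hf
  -- The growth bound for `f` says nothing about the empty word, which may be the image of a
  -- non-empty one.
  refine ⟨C + f [], fun w hw => ?_⟩
  by_cases h : σ w = []
  · simp only [h, add_mul]
    exact (Nat.le_mul_of_pos_right _ (Nat.pow_pos (List.length_pos_iff.2 hw))).trans
      (Nat.le_add_left _ _)
  · refine (hC _ h).trans (Nat.mul_le_mul (Nat.le_add_right _ _) ?_)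
    exact Nat.pow_le_pow_left (hσ.length_le w) r

/-! #### Polyblind functions up to polyregular functions of smaller growth -/

/-- `f` is a polyblind function of growth at most `k` plus a polyregular function of growth at
most `k - 1` (which is zero if `k = 0`). -/
def Decomp (f : List A → ℕ) (k : ℕ) : Prop :=
  ∃ f' f'' : List A → ℕ, (∀ w, f w = f' w + f'' w) ∧ IsPolyblind f' ∧ HasGrowth f' k ∧
    IsPolyregular f'' ∧ (1 ≤ k → HasGrowth f'' (k - 1)) ∧ (k = 0 → ∀ w, f'' w = 0)

theorem Decomp.congr {f g : List A → ℕ} {k : ℕ} (hf : Decomp f k) (h : ∀ w, g w = f w) :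
    Decomp g k := by
  rwa [show g = f from funext h]

theorem Decomp.of_isPolyblind {f : List A → ℕ} {k : ℕ} (hf : IsPolyblind f)
    (hk : HasGrowth f k) : Decomp f k :=
  ⟨f, fun _ => 0, fun _ => rfl, hf, hk, (IsPolyblind.const 0).isPolyregular,
    fun _ => HasGrowth.const 0 _, fun _ _ => rfl⟩

theorem Decomp.zero (k : ℕ) : Decomp (fun _ : List A => 0) k :=
  Decomp.of_isPolyblind (IsPolyblind.const 0) (HasGrowth.const 0 k)

open Classical in
theorem Decomp.indicator {P : List A → Prop} (hP : Reg P) :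
    Decomp (fun w => if P w then 1 else 0) 0 := by
  refine Decomp.of_isPolyblind (IsPolyblind.indicator hP 1)
    ((HasGrowth.const 1 0).of_le fun w => ?_)
  split_ifs <;> simp

theorem Decomp.add {f g : List A → ℕ} {k : ℕ} (hf : Decomp f k) (hg : Decomp g k) :
    Decomp (fun w => f w + g w) k := by
  obtain ⟨f', f'', h, h₁, h₂, h₃, h₄, h₅⟩ := hf
  obtain ⟨g', g'', h', h₁', h₂', h₃', h₄', h₅'⟩ := hg
  exact ⟨_, _, fun w => by simp only [h, h']; ring, h₁.add h₁', h₂.add h₂', h₃.add h₃',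
    fun hk => (h₄ hk).add (h₄' hk), fun hk w => by rw [h₅ hk, h₅' hk]⟩

theorem Decomp.sum {ι : Type*} {s : Finset ι} {f : ι → List A → ℕ} {k : ℕ}
    (h : ∀ i ∈ s, Decomp (f i) k) : Decomp (fun w => ∑ i ∈ s, f i w) k := by
  classical
  induction s using Finset.induction_on with
  | empty => exact (Decomp.zero k).congr fun w => by simp
  | insert i s hi ih =>
    refine ((h i (by simp)).add (ih fun j hj => h j (by simp [hj]))).congr fun w => ?_
    rw [Finset.sum_insert hi]

/-- The product is f'g' + (f'g'' + f''(g' + g'')). The bracket loses one degree, and where `k` or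
`l` is 0 the corresponding second part vanishes, so the truncated exponents do no harm. -/
theorem Decomp.mul {f g : List A → ℕ} {k l : ℕ} (hf : Decomp f k) (hg : Decomp g l) :
    Decomp (fun w => f w * g w) (k + l) := by
  obtain ⟨f', f'', h, h₁, h₂, h₃, h₄, h₅⟩ := hf
  obtain ⟨g', g'', h', h₁', h₂', h₃', h₄', h₅'⟩ := hg
  have key₁ : 1 ≤ k + l → HasGrowth (fun w => f' w * g'' w) (k + l - 1) := by
    intro hkl
    rcases Nat.eq_zero_or_pos l with hl | hl
    · simpa [h₅' hl] using HasGrowth.const 0 _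
    · exact (h₂.mul (h₄' hl)).mono (by omega)
  have key₂ : 1 ≤ k + l → HasGrowth (fun w => f'' w * (g' w + g'' w)) (k + l - 1) := by
    intro hkl
    rcases Nat.eq_zero_or_pos k with hk | hk
    · simpa [h₅ hk] using HasGrowth.const 0 _
    · refine ((h₄ hk).mul (h₂'.add (?_ : HasGrowth g'' l))).mono (by omega)
      rcases Nat.eq_zero_or_pos l with hl | hl
      · simpa [h₅' hl] using (HasGrowth.const 0 l).of_le fun w => (h₅' hl w).le
      · exact (h₄' hl).mono (by omega)
  refine ⟨_, _, fun w => ?_, h₁.mul h₁', h₂.mul h₂',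
    (h₁.isPolyregular.mul h₃').add (h₃.mul (h₁'.isPolyregular.add h₃')),
    fun hkl => (key₁ hkl).add (key₂ hkl), fun hkl w => ?_⟩
  · simp only [h, h']
    ring
  · rw [h₅ (by omega), h₅' (by omega)]
    simp

theorem Decomp.comp {f : List B → ℕ} {k : ℕ} (hf : Decomp f k) {σ : List A → List B}
    (hσ : IsRational σ) : Decomp (fun w => f (σ w)) k := by
  obtain ⟨f', f'', h, h₁, h₂, h₃, h₄, h₅⟩ := hf
  exact ⟨_, _, fun w => h _, h₁.comp hσ, h₂.comp hσ, h₃.comp hσ, fun hk => (h₄ hk).comp hσ,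
    fun hk w => h₅ hk _⟩

end Closure

/-! ### Nodes of forests as positions of the encoding -/

section Nodes

open Forest Bracketed

variable {A : Type u}

@[simp] theorem encode_nil : encode (node ([] : List (Forest A))) = [] := by simp [encode]

@[simp] theorem encode_letter (a : A) : encode (.letter a) = [Bracketed.letter a] := by
  simp [encode]

theorem encode_cons (c : Forest A) (l : List (Forest A)) :
    encode (node (c :: l)) = opening :: (encode c ++ closing :: encode (node l)) := by
  simp [encode]

theorem encode_append (l m : List (Forest A)) :
    encode (node (l ++ m)) = encode (node l) ++ encode (node m) := by
  simp [encode]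

theorem encode_singleton (c : Forest A) :
    encode (node [c]) = opening :: (encode c ++ [closing]) := by
  simp [encode_cons]

theorem height_node_le_iff {l : List (Forest A)} {n : ℕ} :
    (node l).height ≤ n ↔ ∀ c ∈ l, c.height + 1 ≤ n := by
  rw [height]
  induction l with
  | nil => simp
  | cons c l ih => simp only [List.map_cons, List.foldr_cons, max_le_iff, ih, List.forall_mem_cons]

theorem height_lt_of_mem {c : Forest A} {l : List (Forest A)} (h : c ∈ l) :
    c.height + 1 ≤ (node l).height := height_node_le_iff.1 le_rfl c h

/-- Induction on forests. -/
theorem forest_induction {P : Forest A → Prop} (letter : ∀ a, P (.letter a))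
    (node : ∀ l, (∀ c ∈ l, P c) → P (.node l)) (F : Forest A) : P F := by
  induction h : sizeOf F using Nat.strong_induction_on generalizing F with
  | _ n ih =>
    subst h
    cases F with
    | letter a => exact letter a
    | node l =>
      refine node l fun c hc => ih (sizeOf c) ?_ c rfl
      have := List.sizeOf_lt_of_mem hc
      simp only [Forest.node.sizeOf_spec]
      omega

/-- The number of opening brackets minus the number of closing brackets. -/
def depth : List (Bracketed A) → ℤ
  | [] => 0
  | .letter _ :: w => depth w
  | .opening :: w => depth w + 1
  | .closing :: w => depth w - 1

@[simp] theorem depth_nil : depth ([] : List (Bracketed A)) = 0 := rfl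
@[simp] theorem depth_letter (a : A) (w : List (Bracketed A)) :
    depth (.letter a :: w) = depth w := rfl
@[simp] theorem depth_opening (w : List (Bracketed A)) : depth (opening :: w) = depth w + 1 := rfl
@[simp] theorem depth_closing (w : List (Bracketed A)) : depth (closing :: w) = depth w - 1 := rfl

@[simp] theorem depth_append (u v : List (Bracketed A)) : depth (u ++ v) = depth u + depth v := by
  induction u with
  | nil => simp
  | cons b u ih => cases b <;> simp [ih] <;> ring

@[simp] theorem depth_encode (F : Forest A) : depth F.encode = 0 := by
  induction F using forest_induction with
  | letter a => simp
  | node l ih =>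
    induction l with
    | nil => simp
    | cons c l ihl =>
      rw [encode_cons]
      simp [ih c (by simp), ihl fun d hd => ih d (by simp [hd])]

/-- Non-negativity makes closing brackets uniquely matchable; the upper bound lets a finite monoid
recover the depth from a residue. -/
theorem depth_prefix (F : Forest A) {x y : List (Bracketed A)} (h : F.encode = x ++ y) :
    0 ≤ depth x ∧ depth x ≤ F.height := by
  induction F using forest_induction generalizing x y with
  | letter a =>
    rcases x with _ | ⟨b, x⟩
    · simp
    · simp only [encode_letter, List.cons_append, List.cons.injEq, List.nil_eq,
        List.append_eq_nil_iff] at h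
      obtain ⟨rfl, rfl, rfl⟩ := h
      simp
  | node l ih =>
    -- The height is replaced by an arbitrary bound for all children, so that the induction can pass
    -- to a shorter list of children.
    have key : ∀ n : ℕ, (∀ c ∈ l, c.height + 1 ≤ n) → 0 ≤ depth x ∧ depth x ≤ n := by
      intro n hn
      induction l generalizing x with
      | nil =>
        simp only [encode_nil, List.nil_eq, List.append_eq_nil_iff] at h
        simp [h.1]
      | cons c l ihl =>
        rw [encode_cons] at h
        rcases x with _ | ⟨b, x⟩
        · simp
        simp only [List.cons_append, List.cons.injEq] at h
        obtain ⟨rfl, h⟩ := h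
        rcases List.append_eq_append_iff.1 h with ⟨z, rfl, hz⟩ | ⟨z, hz, -⟩
        · rcases z with _ | ⟨b, z⟩
          · have := hn c (by simp)
            simp only [List.append_nil, depth_opening, depth_encode]
            omega
          · simp only [List.cons_append, List.cons.injEq] at hz
            obtain ⟨rfl, hz⟩ := hz
            have := ihl (fun d hd => ih d (by simp [hd])) hz fun d hd => hn d (by simp [hd])
            simp only [depth_opening, depth_append, depth_encode, depth_closing]
            omega
        · have := ih c (by simp) hz
          have := hn c (by simp)
          simp only [depth_opening]
          omega
    exact key _ fun c hc => height_lt_of_mem hc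

/-- If one encoding were longer, it would have the other one followed by a closing bracket as a
prefix, of depth -1. -/
theorem encode_closing_inj {F G : Forest A} {x y : List (Bracketed A)}
    (h : F.encode ++ closing :: x = G.encode ++ closing :: y) : F = G ∧ x = y := by
  have key : ∀ {F G : Forest A} {x z : List (Bracketed A)}, G.encode = F.encode ++ z →
      closing :: x = z ++ closing :: y → z = [] := by
    intro F G x z hG hz
    rcases z with _ | ⟨b, z⟩
    · rfl
    · simp only [List.cons_append, List.cons.injEq] at hz
      obtain ⟨rfl, -⟩ := hz
      have := (depth_prefix G (x := F.encode ++ [closing]) (y := z) (by simp [hG])).1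
      simp at this
  rcases List.append_eq_append_iff.1 h with ⟨z, hG, hz⟩ | ⟨z, hF, hz⟩
  · have := key hG hz
    subst this
    exact ⟨encode_injective (by simpa using hG.symm), by simpa using hz⟩
  · have : z = [] := by
      rcases z with _ | ⟨b, z⟩
      · rfl
      · simp only [List.cons_append, List.cons.injEq] at hz
        obtain ⟨rfl, -⟩ := hz
        have := (depth_prefix F (x := G.encode ++ [closing]) (y := z) (by simp [hF])).1
        simp at this
    subst this
    exact ⟨encode_injective (by simpa using hF), by simpa using hz.symm⟩

/-- `NodeAt F t pre G post` says that the path `t` leads to a node other than the root, with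
subforest `G`, and that `pre` and `post` are the parts of the encoding of `F` to the left of the
opening bracket and to the right of the closing bracket of this node. -/
inductive NodeAt : Forest A → List ℕ → List (Bracketed A) → Forest A → List (Bracketed A) → Prop
  | child (l₁ : List (Forest A)) (c : Forest A) (l₂ : List (Forest A)) :
    NodeAt (node (l₁ ++ c :: l₂)) [l₁.length] (encode (node l₁)) c (encode (node l₂))
  | desc (l₁ : List (Forest A)) (c : Forest A) (l₂ : List (Forest A)) {p : List ℕ}
      {pre : List (Bracketed A)} {G : Forest A} {post : List (Bracketed A)} :
    NodeAt c p pre G post → NodeAt (node (l₁ ++ c :: l₂)) (l₁.length :: p)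
      (encode (node l₁) ++ opening :: pre) G (post ++ closing :: encode (node l₂))

theorem NodeAt.inv {F : Forest A} {t : List ℕ} {pre : List (Bracketed A)} {G : Forest A}
    {post : List (Bracketed A)} (h : NodeAt F t pre G post) :
    ∃ l₁ c l₂, F = node (l₁ ++ c :: l₂) ∧
      ((t = [l₁.length] ∧ pre = encode (node l₁) ∧ G = c ∧ post = encode (node l₂)) ∨
      ∃ p pre' post', NodeAt c p pre' G post' ∧ t = l₁.length :: p ∧
        pre = encode (node l₁) ++ opening :: pre' ∧
        post = post' ++ closing :: encode (node l₂)) := by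
  cases h with
  | child l₁ c l₂ => exact ⟨l₁, _, l₂, rfl, Or.inl ⟨rfl, rfl, rfl, rfl⟩⟩
  | desc l₁ c l₂ h => exact ⟨l₁, c, l₂, rfl, Or.inr ⟨_, _, _, h, rfl, rfl, rfl⟩⟩

variable {F : Forest A} {t s : List ℕ} {G H : Forest A}
  {pre post pre' post' : List (Bracketed A)}

theorem NodeAt.encode_eq (h : NodeAt F t pre G post) :
    F.encode = pre ++ opening :: (G.encode ++ closing :: post) := by
  induction h with
  | child l₁ c l₂ => rw [encode_append, encode_cons]
  | desc l₁ c l₂ _ ih => rw [encode_append, encode_cons, ih]; simp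

theorem NodeAt.ne_nil (h : NodeAt F t pre G post) : t ≠ [] := by cases h <;> simp

theorem NodeAt.subforest_eq (h : NodeAt F t pre G post) : F.subforest t = some G := by
  induction h with
  | child l₁ c l₂ => simp [subforest]
  | desc l₁ c l₂ _ ih => simp [subforest, ih]

theorem exists_nodeAt (ht : t ≠ []) (h : F.subforest t = some G) :
    ∃ pre post, NodeAt F t pre G post := by
  induction t generalizing F with
  | nil => exact absurd rfl ht
  | cons i p ih =>
    cases F with
    | letter a => simp [subforest] at h
    | node l =>
      rw [subforest, Option.bind_eq_some_iff] at h
      obtain ⟨c, hc, h⟩ := h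
      rw [List.getElem?_eq_some_iff] at hc
      obtain ⟨hi, rfl⟩ := hc
      have hl : l = l.take i ++ l[i] :: l.drop (i + 1) := by simp
      have hlen : (l.take i).length = i := by simp [hi.le]
      cases p with
      | nil =>
        simp only [subforest, Option.some.injEq] at h
        subst h
        have := NodeAt.child (l.take i) l[i] (l.drop (i + 1))
        rw [← hl, hlen] at this
        exact ⟨_, _, this⟩
      | cons j p =>
        obtain ⟨pre, post, hn⟩ := ih (by simp) h
        have := NodeAt.desc (l.take i) l[i] (l.drop (i + 1)) hn
        rw [← hl, hlen] at this
        exact ⟨_, _, this⟩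

theorem NodeAt.unique (h : NodeAt F t pre G post) (h' : NodeAt F t pre' H post') :
    pre = pre' ∧ G = H ∧ post = post' := by
  have hG : G = H := by
    have := h.subforest_eq.symm.trans h'.subforest_eq
    simpa using this
  subst hG
  have hpre : pre = pre' := by
    induction h generalizing pre' post' with
    | child l₁ c l₂ =>
      obtain ⟨l₃, d, l₄, hl, ⟨hlen, hpre, -⟩ | ⟨p, pre'', post'', hn, hp, -⟩⟩ := h'.inv
      · simp only [node.injEq] at hl
        rw [(List.append_inj hl (by simpa using hlen)).1, hpre]
      · simp only [List.cons.injEq] at hp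
        exact absurd hp.2.symm hn.ne_nil
    | desc l₁ c l₂ hn ih =>
      obtain ⟨l₃, d, l₄, hl, ⟨hlen, hpre, -⟩ | ⟨p, pre'', post'', hn', hp, hpre, -⟩⟩ := h'.inv
      · simp only [List.cons.injEq] at hlen
        exact absurd hlen.2 hn.ne_nil
      · simp only [List.cons.injEq] at hp
        simp only [node.injEq] at hl
        obtain ⟨rfl, hl'⟩ := List.append_inj hl hp.1
        simp only [List.cons.injEq] at hl'
        obtain ⟨rfl, rfl⟩ := hl'
        obtain ⟨-, rfl⟩ := hp
        rw [hpre, ih hn']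
  subst hpre
  have := h.encode_eq.symm.trans h'.encode_eq
  exact ⟨rfl, rfl, by simpa using this⟩

theorem exists_nodeAt_of_opening {x y : List (Bracketed A)} (h : F.encode = x ++ opening :: y) :
    ∃ t G post, NodeAt F t x G post := by
  induction F using forest_induction generalizing x y with
  | letter a => rcases x with _ | ⟨b, x⟩ <;> simp at h
  | node l ih =>
    have key : ∀ (l₂ l₁ : List (Forest A)) (x : List (Bracketed A)), l₁ ++ l₂ = l →
        encode (node l₂) = x ++ opening :: y →
        ∃ t G post, NodeAt (node l) t (encode (node l₁) ++ x) G post := by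
      intro l₂
      induction l₂ with
      | nil => intro l₁ x _ h; simp at h
      | cons c l₂ ihl =>
        intro l₁ x hl h
        rw [encode_cons] at h
        rcases x with _ | ⟨b, x⟩
        · subst hl
          exact ⟨_, _, _, by simpa using NodeAt.child l₁ c l₂⟩
        simp only [List.cons_append, List.cons.injEq] at h
        obtain ⟨rfl, h⟩ := h
        rcases List.append_eq_append_iff.1 h with ⟨z, rfl, hz⟩ | ⟨z, hz, hz'⟩
        · rcases z with _ | ⟨b, z⟩
          · simp at hz
          · simp only [List.cons_append, List.cons.injEq] at hz
            obtain ⟨rfl, hz⟩ := hz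
            obtain ⟨t, G, post, hn⟩ := ihl (l₁ ++ [c]) z (by simp [hl]) hz
            exact ⟨t, G, post, by simpa [encode_append, encode_singleton] using hn⟩
        · rcases z with _ | ⟨b, z⟩
          · simp at hz'
          · simp only [List.cons_append, List.cons.injEq] at hz'
            obtain ⟨rfl, -⟩ := hz'
            obtain ⟨t, G, post, hn⟩ := ih c (by simp [← hl]) hz
            subst hl
            exact ⟨_, _, _, NodeAt.desc l₁ c l₂ hn⟩
    simpa using key l [] x rfl h

theorem length_encode_take_le (l : List (Forest A)) {i j : ℕ} (h : i ≤ j) :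
    (encode (node (l.take i))).length ≤ (encode (node (l.take j))).length := by
  obtain ⟨k, rfl⟩ := Nat.exists_eq_add_of_le h
  rw [List.take_add, encode_append]
  simp

/-- The opening brackets of the nodes in different children lie in disjoint intervals, so a position
determines the first entry of the path. -/
theorem NodeAt.length_bounds {l : List (Forest A)} {i : ℕ} {p : List ℕ}
    (h : NodeAt (node l) (i :: p) pre G post) :
    (encode (node (l.take i))).length ≤ pre.length ∧
      pre.length < (encode (node (l.take (i + 1)))).length := by
  obtain ⟨l₁, c, l₂, hl, h'⟩ := h.inv
  simp only [node.injEq] at hl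
  subst hl
  have htake : (l₁ ++ c :: l₂).take (l₁.length + 1) = l₁ ++ [c] := by
    rw [List.take_append, List.take_of_length_le (by omega)]
    simp
  rcases h' with ⟨ht, rfl, rfl, rfl⟩ | ⟨q, pre', post', hn, ht, rfl, rfl⟩
  · simp only [List.cons.injEq] at ht
    rw [ht.1, List.take_left, htake]
    simp [encode_append, encode_singleton]
  · simp only [List.cons.injEq] at ht
    rw [ht.1, List.take_left, htake]
    have := congrArg List.length hn.encode_eq
    simp [encode_append, encode_singleton] at this ⊢
    omega

/-- The position gives the child by `NodeAt.length_bounds`; the child itself and a proper descendant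
of it are told apart by the child's opening bracket. -/
theorem NodeAt.path_eq (h : NodeAt F t pre G post) (h' : NodeAt F s pre' H post')
    (hlen : pre.length = pre'.length) : t = s := by
  induction h generalizing s pre' post' with
  | child l₁ c l₂ =>
    obtain ⟨j, q, rfl⟩ := List.exists_cons_of_ne_nil h'.ne_nil
    have b₁ := (NodeAt.child l₁ c l₂).length_bounds
    have b₂ := h'.length_bounds
    obtain rfl : l₁.length = j := by
      rcases lt_trichotomy l₁.length j with h | h | h
      · have := length_encode_take_le (l₁ ++ c :: l₂) (Nat.succ_le_of_lt h)
        simp only [Nat.succ_eq_add_one] at this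
        omega
      · exact h
      · have := length_encode_take_le (l₁ ++ c :: l₂) (Nat.succ_le_of_lt h)
        simp only [Nat.succ_eq_add_one] at this
        omega
    obtain ⟨l₃, d, l₄, hl, ⟨ht, rfl, rfl, rfl⟩ | ⟨p, pre'', post'', hn, ht, rfl, rfl⟩⟩ := h'.inv
    · simp only [List.cons.injEq] at ht
      rw [ht.2]
    · simp only [List.cons.injEq] at ht
      simp only [node.injEq] at hl
      obtain ⟨rfl, -⟩ := List.append_inj hl ht.1
      simp at hlen
  | desc l₁ c l₂ hn ih =>
    obtain ⟨j, q, rfl⟩ := List.exists_cons_of_ne_nil h'.ne_nil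
    have b₁ := (NodeAt.desc l₁ c l₂ hn).length_bounds
    have b₂ := h'.length_bounds
    obtain rfl : l₁.length = j := by
      rcases lt_trichotomy l₁.length j with h | h | h
      · have := length_encode_take_le (l₁ ++ c :: l₂) (Nat.succ_le_of_lt h)
        simp only [Nat.succ_eq_add_one] at this
        omega
      · exact h
      · have := length_encode_take_le (l₁ ++ c :: l₂) (Nat.succ_le_of_lt h)
        simp only [Nat.succ_eq_add_one] at this
        omega
    obtain ⟨l₃, d, l₄, hl, ⟨ht, rfl, rfl, rfl⟩ | ⟨p, pre'', post'', hn', ht, rfl, rfl⟩⟩ := h'.inv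
    · simp only [List.cons.injEq] at ht
      simp only [node.injEq] at hl
      obtain ⟨rfl, -⟩ := List.append_inj hl ht.1
      simp at hlen
    · simp only [List.cons.injEq] at ht
      simp only [node.injEq] at hl
      obtain ⟨rfl, hl'⟩ := List.append_inj hl ht.1
      simp only [List.cons.injEq] at hl'
      obtain ⟨rfl, rfl⟩ := hl'
      rw [ht.2, ih hn' (by simpa using hlen)]

theorem NodeAt.trans (h : NodeAt F t pre G post) (h' : NodeAt G s pre' H post') :
    NodeAt F (t ++ s) (pre ++ opening :: pre') H (post' ++ closing :: post) := by
  induction h with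
  | child l₁ c l₂ => exact NodeAt.desc l₁ c l₂ h'
  | desc l₁ c l₂ _ ih => simpa using NodeAt.desc l₁ c l₂ (ih h')

/-- An opening bracket right after the closing bracket of a node can only belong to its right
sibling. -/
theorem NodeAt.next {y : List (Bracketed A)} (h : NodeAt F t pre G (opening :: y)) :
    ∃ q i, t = q ++ [i] ∧ ∃ H post',
      NodeAt F (q ++ [i + 1]) (pre ++ opening :: (G.encode ++ [closing])) H post' := by
  generalize hp : opening :: y = post at h
  induction h generalizing y with
  | child l₁ c l₂ =>
    rcases l₂ with _ | ⟨d, l₂⟩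
    · simp at hp
    · have := NodeAt.child (l₁ ++ [c]) d l₂
      simp only [encode_append, encode_singleton, List.append_assoc, List.singleton_append,
        List.length_append, List.length_singleton] at this
      exact ⟨[], l₁.length, rfl, d, _, this⟩
  | @desc l₁ c l₂ p pre G post hn ih =>
    rcases post with _ | ⟨b, post⟩
    · simp at hp
    · simp only [List.cons_append, List.cons.injEq] at hp
      obtain ⟨rfl, -⟩ := hp
      obtain ⟨q, i, rfl, H, post', h⟩ := ih rfl
      exact ⟨l₁.length :: q, i, rfl, H, _, by simpa using NodeAt.desc l₁ c l₂ h⟩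

theorem NodeAt.prev {q : List ℕ} {i : ℕ} (h : NodeAt F (q ++ [i + 1]) pre' H post') :
    ∃ pre G, NodeAt F (q ++ [i]) pre G (opening :: (H.encode ++ closing :: post')) ∧
      pre' = pre ++ opening :: (G.encode ++ [closing]) := by
  generalize hp : q ++ [i + 1] = t at h
  induction h generalizing q with
  | child l₁ c l₂ =>
    rcases q with _ | ⟨j, q⟩
    · simp only [List.nil_append, List.cons.injEq, and_true] at hp
      rcases List.eq_nil_or_concat l₁ with rfl | ⟨m, d, rfl⟩
      · simp at hp
      · have hi : i = m.length := by simpa using hp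
        subst hi
        have := NodeAt.child m d (c :: l₂)
        rw [encode_cons] at this
        exact ⟨_, _, by simpa using this, by simp [encode_append, encode_singleton]⟩
    · simp at hp
  | desc l₁ c l₂ hn ih =>
    rcases q with _ | ⟨j, q⟩
    · simp only [List.nil_append, List.cons.injEq] at hp
      exact absurd hp.2.symm hn.ne_nil
    · simp only [List.cons_append, List.cons.injEq] at hp
      obtain ⟨rfl, hp⟩ := hp
      obtain ⟨pre, G, h, rfl⟩ := ih hp
      exact ⟨_, _, by simpa using NodeAt.desc l₁ c l₂ h, by simp⟩

theorem NodeAt.depth_eq (h : NodeAt F t pre G post) : depth pre + 1 = t.length := by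
  induction h with
  | child l₁ c l₂ => simp
  | desc l₁ c l₂ _ ih => simp [← ih]

theorem NodeAt.height_le (h : NodeAt F t pre G post) : G.height + t.length ≤ F.height := by
  induction h with
  | child l₁ c l₂ => exact height_lt_of_mem (by simp)
  | desc l₁ c l₂ _ ih =>
    have : c.height + 1 ≤ (node (l₁ ++ c :: l₂)).height := height_lt_of_mem (by simp)
    simp only [List.length_cons]
    omega

end Nodes

/-! ### Values, frontiers and the regularity of the set of factorizations -/

section Values

open Forest Bracketed

variable {A : Type u} {M : Type v} [Monoid M] (μ : FreeMonoid A →* M)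

@[simp] theorem value_nil : (node ([] : List (Forest A))).value μ = 1 := by
  simp [value, word]

theorem value_cons (c : Forest A) (l : List (Forest A)) :
    (node (c :: l)).value μ = c.value μ * (node l).value μ := by
  simp [value, word, FreeMonoid.ofList_append]

theorem value_singleton (c : Forest A) : (node [c]).value μ = c.value μ := by
  simp [value_cons]

theorem value_node_of_forall {e : M} (he : e * e = e) {l : List (Forest A)} (hl : l ≠ [])
    (h : ∀ c ∈ l, c.value μ = e) : (node l).value μ = e := by
  induction l with
  | nil => exact absurd rfl hl
  | cons c l ih =>
    rw [value_cons, h c (by simp)]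
    rcases eq_or_ne l [] with rfl | hl'
    · simp
    · rw [ih hl' fun d hd => h d (by simp [hd]), he]

/-- The value of a word with brackets; brackets have no effect. -/
def hat : FreeMonoid (Bracketed A) →* M :=
  FreeMonoid.lift fun b => match b with
    | .letter a => μ (FreeMonoid.of a)
    | .opening => 1
    | .closing => 1

@[simp] theorem hat_nil : hat μ (FreeMonoid.ofList []) = 1 := map_one _

@[simp] theorem hat_of_letter (a : A) :
    hat μ (FreeMonoid.of (.letter a)) = μ (FreeMonoid.of a) := rfl

@[simp] theorem hat_of_opening : hat μ (FreeMonoid.of opening) = 1 := rfl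

@[simp] theorem hat_of_closing : hat μ (FreeMonoid.of closing) = 1 := rfl

theorem hat_opening (w : List (Bracketed A)) :
    hat μ (FreeMonoid.ofList (opening :: w)) = hat μ (FreeMonoid.ofList w) := by simp

theorem hat_closing (w : List (Bracketed A)) :
    hat μ (FreeMonoid.ofList (closing :: w)) = hat μ (FreeMonoid.ofList w) := by simp

@[simp] theorem hat_append (u v : List (Bracketed A)) : hat μ (FreeMonoid.ofList (u ++ v)) =
    hat μ (FreeMonoid.ofList u) * hat μ (FreeMonoid.ofList v) := by
  rw [FreeMonoid.ofList_append, map_mul]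

theorem value_letter (a : A) : (Forest.letter a).value μ = μ (FreeMonoid.of a) := by
  simp [value, word]

theorem hat_encode (F : Forest A) : hat μ (FreeMonoid.ofList F.encode) = F.value μ := by
  induction F using forest_induction with
  | letter a => simp [value_letter]
  | node l ih =>
    induction l with
    | nil => simp
    | cons c l ihl =>
      rw [encode_cons, value_cons, hat_opening, hat_append, hat_closing, ih c (by simp),
        ihl fun d hd => ih d (by simp [hd])]

theorem word_ne_nil_iff (F : Forest A) : F.word ≠ [] ↔ ∃ a, Bracketed.letter a ∈ F.encode := by
  induction F using forest_induction with
  | letter a => simp [word]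
  | node l ih =>
    rw [← not_iff_not]
    push Not
    simp only [word, encode, List.flatMap_eq_nil_iff, List.mem_flatMap, not_exists, not_and]
    constructor
    · intro h a c hc
      have := (not_congr (ih c hc)).1 (not_not.2 (h c hc))
      push Not at this
      simp [this a]
    · intro h c hc
      by_contra hne
      obtain ⟨a, ha⟩ := (ih c hc).1 hne
      exact h a c hc (by simp [ha])

/-- A product of one or more copies of an idempotent is that idempotent, so the value of the parent
need not be mentioned. The condition then concerns each child separately and fits a regular
expression. -/
theorem isFactorization_node {l : List (Forest A)} : (node l).IsFactorization μ ↔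
    (∀ c ∈ l, IsFactorization μ c ∧ c.word ≠ []) ∧
      (3 ≤ l.length → ∃ e : M, e * e = e ∧ ∀ c ∈ l, c.value μ = e) := by
  rw [IsFactorization]
  refine and_congr Iff.rfl (forall_congr' fun hl => ⟨?_, ?_⟩)
  · rintro ⟨h₁, h₂⟩
    exact ⟨_, h₁, h₂⟩
  · rintro ⟨e, he, h⟩
    rw [value_node_of_forall μ he (by rintro rfl; simp at hl) h]
    exact ⟨he, h⟩

variable {μ}

theorem frontier_node (l : List (Forest A)) :
    (node l).frontier = firstLast (l.map frontier) := by simp [Forest.frontier]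

theorem firstLast_map_append {l : List (Forest A)} (c d : Forest A) :
    firstLast ((c :: l ++ [d]).map frontier) = c.frontier ++ d.frontier := by
  cases l with
  | nil => simp [firstLast]
  | cons b l =>
    simp only [List.cons_append, List.map_cons, List.map_append, List.map_nil, firstLast]
    congr 1
    simp

theorem list_cases (l : List (Forest A)) :
    l = [] ∨ (∃ c, l = [c]) ∨ ∃ c m d, l = c :: m ++ [d] := by
  rcases l with _ | ⟨c, l⟩
  · exact Or.inl rfl
  · rcases List.eq_nil_or_concat l with rfl | ⟨m, d, rfl⟩
    · exact Or.inr (Or.inl ⟨c, rfl⟩)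
    · exact Or.inr (Or.inr ⟨c, m, d, by simp⟩)

/-- With three or more children all values equal one idempotent, so dropping the middle children
does not change the product. -/
theorem map_frontier {F : Forest A} (hF : F.IsFactorization μ) :
    μ (FreeMonoid.ofList F.frontier) = F.value μ := by
  induction F using forest_induction with
  | letter a => simp [Forest.frontier, value_letter]
  | node l ih =>
    obtain ⟨h₁, h₂⟩ := (isFactorization_node μ).1 hF
    rw [frontier_node]
    rcases list_cases l with rfl | ⟨c, rfl⟩ | ⟨c, m, d, rfl⟩
    · simp [firstLast]
    · simp [firstLast, value_singleton, ih c (by simp) (h₁ c (by simp)).1]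
    · rw [firstLast_map_append, FreeMonoid.ofList_append, map_mul,
        ih c (by simp) (h₁ c (by simp)).1, ih d (by simp) (h₁ d (by simp)).1]
      rcases m with _ | ⟨b, m⟩
      · simp [value_cons]
      · obtain ⟨e, he, h⟩ := h₂ (by simp)
        rw [value_node_of_forall μ he (by simp) h, h c (by simp), h d (by simp), he]

theorem NodeAt.isFactorizationLE {F G : Forest A} {t : List ℕ} {pre post : List (Bracketed A)}
    (h : NodeAt F t pre G post) {K : ℕ} (hF : F.IsFactorizationLE μ K) :
    G.IsFactorizationLE μ K := by
  obtain ⟨hF, hh⟩ := hF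
  refine ⟨?_, by have := h.height_le; omega⟩
  clear hh
  induction h with
  | child l₁ c l₂ => exact (((isFactorization_node μ).1 hF).1 c (by simp)).1
  | desc l₁ c l₂ _ ih => exact ih (((isFactorization_node μ).1 hF).1 c (by simp)).1

theorem NodeAt.lin_eq {F G : Forest A} {t : List ℕ} {pre post : List (Bracketed A)}
    (h : NodeAt F t pre G post) : F.lin μ t =
      ⟨hat μ (FreeMonoid.ofList pre), G.frontier, hat μ (FreeMonoid.ofList post)⟩ := by
  induction h with
  | child l₁ c l₂ => simp [lin, hat_encode]
  | desc l₁ c l₂ _ ih => simp [lin, hat_encode, ih]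

/-- This is why a single type determines the value of the whole forest. -/
theorem NodeAt.value_eq {F G : Forest A} {t : List ℕ} {pre post : List (Bracketed A)}
    (h : NodeAt F t pre G post) (hF : F.IsFactorization μ) :
    F.value μ = (F.lin μ t).left * μ (FreeMonoid.ofList (F.lin μ t).word) *
      (F.lin μ t).right := by
  have hG := (h.isFactorizationLE ⟨hF, le_rfl⟩).1
  rw [h.lin_eq, map_frontier hG, ← hat_encode, ← hat_encode μ G, h.encode_eq]
  simp [mul_assoc]

/-! #### Regularity -/

/-- The encodings of the forests with property `P`. -/
def Enc (P : Forest A → Prop) (w : List (Bracketed A)) : Prop := ∃ F, P F ∧ F.encode = w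

@[simp] theorem enc_encode (P : Forest A → Prop) (F : Forest A) : Enc P F.encode ↔ P F :=
  ⟨fun ⟨_, hG, h⟩ => encode_injective h ▸ hG, fun h => ⟨F, h, rfl⟩⟩

theorem Reg.enc_and {P Q : Forest A → Prop} (hP : Reg (Enc P)) (hQ : Reg (Enc Q)) :
    Reg (Enc fun F => P F ∧ Q F) := by
  refine (hP.and hQ).congr fun w => ⟨?_, ?_⟩
  · rintro ⟨⟨F, hF, rfl⟩, hQ⟩
    exact ⟨F, ⟨hF, (enc_encode Q F).1 hQ⟩, rfl⟩
  · rintro ⟨F, ⟨h₁, h₂⟩, rfl⟩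
    exact ⟨⟨F, h₁, rfl⟩, F, h₂, rfl⟩

theorem Reg.enc_or {P Q : Forest A → Prop} (hP : Reg (Enc P)) (hQ : Reg (Enc Q)) :
    Reg (Enc fun F => P F ∨ Q F) := by
  refine (hP.or hQ).congr fun w => ⟨?_, ?_⟩
  · rintro (⟨F, hF, rfl⟩ | ⟨F, hF, rfl⟩)
    · exact ⟨F, Or.inl hF, rfl⟩
    · exact ⟨F, Or.inr hF, rfl⟩
  · rintro ⟨F, hF | hF, rfl⟩
    · exact Or.inl ⟨F, hF, rfl⟩
    · exact Or.inr ⟨F, hF, rfl⟩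

theorem Reg.enc_word {P : Forest A → Prop} (hP : Reg (Enc P)) {Q : List (Bracketed A) → Prop}
    (hQ : Reg Q) : Reg (Enc fun F => P F ∧ Q F.encode) := by
  refine (hP.and hQ).congr fun w => ⟨?_, ?_⟩
  · rintro ⟨⟨F, hF, rfl⟩, hQ⟩
    exact ⟨F, ⟨hF, hQ⟩, rfl⟩
  · rintro ⟨F, ⟨h₁, h₂⟩, rfl⟩
    exact ⟨⟨F, h₁, rfl⟩, h₂⟩

theorem Reg.enc_exists {ι : Type*} {P : ι → Forest A → Prop} (s : Finset ι)
    (h : ∀ i ∈ s, Reg (Enc (P i))) : Reg (Enc fun F => ∃ i ∈ s, P i F) := by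
  refine (Reg.exists_finset s h).congr fun w => ⟨?_, ?_⟩
  · rintro ⟨i, hi, F, hF, rfl⟩
    exact ⟨F, ⟨i, hi, hF⟩, rfl⟩
  · rintro ⟨F, ⟨i, hi, hF⟩, rfl⟩
    exact ⟨i, hi, F, hF, rfl⟩

/-- The encodings of the forests `node l` where `l` has property `P`. -/
abbrev LEnc (P : List (Forest A) → Prop) : List (Bracketed A) → Prop :=
  Enc fun F => ∃ l, F = node l ∧ P l

theorem Reg.lenc_nil : Reg (LEnc fun l : List (Forest A) => l = []) := by
  refine Reg.eq_nil.congr fun w => ⟨?_, ?_⟩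
  · rintro rfl
    exact ⟨_, ⟨[], rfl, rfl⟩, by simp⟩
  · rintro ⟨_, ⟨_, rfl, rfl⟩, rfl⟩
    simp

theorem Reg.eq_singleton {B : Type*} (b : B) : Reg fun w => w = [b] :=
  (Reg.singleton fun c => c = b).congr fun w => by simp

theorem Reg.lenc_single {P : Forest A → Prop} (hP : Reg (Enc P)) :
    Reg (LEnc fun l => ∃ c, l = [c] ∧ P c) := by
  refine ((Reg.eq_singleton opening).cat (hP.cat (Reg.eq_singleton closing))).congr
    fun w => ⟨?_, ?_⟩
  · rintro ⟨_, _, rfl, rfl, _, _, rfl, ⟨c, hc, rfl⟩, rfl⟩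
    exact ⟨_, ⟨[c], rfl, c, rfl, hc⟩, by simp [encode_singleton]⟩
  · rintro ⟨_, ⟨_, rfl, c, rfl, hc⟩, rfl⟩
    exact ⟨[opening], _, encode_singleton c, rfl, _, _, rfl, ⟨c, hc, rfl⟩, rfl⟩

theorem Reg.lenc_append {P Q : List (Forest A) → Prop} (hP : Reg (LEnc P)) (hQ : Reg (LEnc Q)) :
    Reg (LEnc fun l => ∃ l₁ l₂, l = l₁ ++ l₂ ∧ P l₁ ∧ Q l₂) := by
  refine (hP.cat hQ).congr fun w => ⟨?_, ?_⟩
  · rintro ⟨_, _, rfl, ⟨_, ⟨l₁, rfl, h₁⟩, rfl⟩, ⟨_, ⟨l₂, rfl, h₂⟩, rfl⟩⟩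
    exact ⟨_, ⟨l₁ ++ l₂, rfl, l₁, l₂, rfl, h₁, h₂⟩, encode_append _ _⟩
  · rintro ⟨_, ⟨_, rfl, l₁, l₂, rfl, h₁, h₂⟩, rfl⟩
    exact ⟨_, _, encode_append l₁ l₂, ⟨_, ⟨l₁, rfl, h₁⟩, rfl⟩, ⟨_, ⟨l₂, rfl, h₂⟩, rfl⟩⟩

theorem Reg.lenc_star {P : Forest A → Prop} (hP : Reg (Enc P)) :
    Reg (LEnc fun l => ∀ c ∈ l, P c) := by
  refine (Reg.lenc_single hP).star.congr fun w => ⟨?_, ?_⟩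
  · rintro ⟨L, rfl, hL⟩
    induction L with
    | nil => exact ⟨_, ⟨[], rfl, by simp⟩, by simp⟩
    | cons k L ih =>
      obtain ⟨_, ⟨_, rfl, c, rfl, hc⟩, hk⟩ := hL k (by simp)
      obtain ⟨_, ⟨l, rfl, hl⟩, h⟩ := ih fun y hy => hL y (by simp [hy])
      refine ⟨_, ⟨c :: l, rfl, ?_⟩, ?_⟩
      · simpa [hc] using hl
      · rw [List.flatten_cons, ← hk, ← h, ← encode_append]
        rfl
  · rintro ⟨_, ⟨l, rfl, hl⟩, rfl⟩
    refine ⟨l.map fun c => encode (node [c]), ?_, ?_⟩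
    · simp [encode, List.flatMap]
    · intro y hy
      obtain ⟨c, hc, rfl⟩ := List.mem_map.1 hy
      exact ⟨_, ⟨[c], rfl, c, rfl, hl c hc⟩, rfl⟩

theorem Reg.lenc_or {P Q : List (Forest A) → Prop} (hP : Reg (LEnc P)) (hQ : Reg (LEnc Q)) :
    Reg (LEnc fun l => P l ∨ Q l) := by
  have : (fun F : Forest A => ∃ l, F = node l ∧ (P l ∨ Q l)) =
      fun F => (∃ l, F = node l ∧ P l) ∨ ∃ l, F = node l ∧ Q l := by
    funext F
    exact propext ⟨by rintro ⟨l, h, h' | h'⟩ <;> [left; right] <;> exact ⟨l, h, h'⟩,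
      by rintro (⟨l, h, h'⟩ | ⟨l, h, h'⟩) <;> exact ⟨l, h, by tauto⟩⟩
  rw [LEnc, this]
  exact hP.enc_or hQ

theorem Reg.enc_letter (S : A → Prop) : Reg (Enc fun F : Forest A => ∃ a, F = .letter a ∧ S a) := by
  refine (Reg.singleton fun b => ∃ a, b = Bracketed.letter a ∧ S a).congr fun w => ⟨?_, ?_⟩
  · rintro ⟨_, rfl, a, rfl, ha⟩
    exact ⟨_, ⟨a, rfl, ha⟩, by simp⟩
  · rintro ⟨_, ⟨a, rfl, ha⟩, rfl⟩
    exact ⟨_, encode_letter a, a, rfl, ha⟩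

theorem Reg.hat_eq [Finite M] (m : M) :
    Reg fun w : List (Bracketed A) => hat μ (FreeMonoid.ofList w) = m :=
  Reg.of_hom (hat μ) fun x => x = m

/-- The form of a regular expression: a letter, at most two children, or any number of children with
a common idempotent value. The alternatives overlap for short lists. -/
theorem isFactorizationLE_succ {h : ℕ} {F : Forest A} : F.IsFactorizationLE μ (h + 1) ↔
    (∃ a, F = .letter a ∧ True) ∨ ∃ l, F = node l ∧
      ((l = [] ∨ (∃ c, l = [c] ∧ c.IsFactorizationLE μ h ∧ c.word ≠ []) ∨
        ∃ l₁ l₂, l = l₁ ++ l₂ ∧ (∃ c, l₁ = [c] ∧ c.IsFactorizationLE μ h ∧ c.word ≠ []) ∧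
          ∃ c, l₂ = [c] ∧ c.IsFactorizationLE μ h ∧ c.word ≠ []) ∨
      ∃ e ∈ {e : M | e * e = e}, ∀ c ∈ l, (c.IsFactorizationLE μ h ∧ c.word ≠ []) ∧
        c.value μ = e) := by
  cases F with
  | letter a =>
    simp only [IsFactorizationLE, IsFactorization, height, Nat.zero_le, and_self, true_iff]
    exact Or.inl ⟨a, rfl, trivial⟩
  | node l =>
    have hh : ∀ c : Forest A, c.height + 1 ≤ h + 1 ↔ c.height ≤ h := fun c => by omega
    simp only [IsFactorizationLE, isFactorization_node, height_node_le_iff, hh, reduceCtorEq,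
      false_and, exists_false, false_or, node.injEq, exists_eq_left', Set.mem_ofPred_eq]
    constructor
    · rintro ⟨⟨h₁, h₂⟩, h₃⟩
      match l, h₁, h₂, h₃ with
      | [], _, _, _ => exact Or.inl (Or.inl rfl)
      | [c], h₁, _, h₃ =>
        exact Or.inl (Or.inr (Or.inl ⟨c, rfl, ⟨(h₁ c (by simp)).1, h₃ c (by simp)⟩,
          (h₁ c (by simp)).2⟩))
      | [c, d], h₁, _, h₃ =>
        exact Or.inl (Or.inr (Or.inr ⟨[c], [d], rfl,
          ⟨c, rfl, ⟨(h₁ c (by simp)).1, h₃ c (by simp)⟩, (h₁ c (by simp)).2⟩,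
          ⟨d, rfl, ⟨(h₁ d (by simp)).1, h₃ d (by simp)⟩, (h₁ d (by simp)).2⟩⟩))
      | a :: b :: c :: l, h₁, h₂, h₃ =>
        obtain ⟨e, he, h₂⟩ := h₂ (by simp)
        exact Or.inr ⟨e, he, fun c hc => ⟨⟨⟨(h₁ c hc).1, h₃ c hc⟩, (h₁ c hc).2⟩, h₂ c hc⟩⟩
    · rintro ((rfl | ⟨c, rfl, h₁, h₂⟩ | ⟨_, _, rfl, ⟨c, rfl, h₁, h₂⟩, ⟨d, rfl, h₃, h₄⟩⟩) |
        ⟨e, he, h⟩)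
      · simp
      · simp [h₁, h₂]
      · simp [h₁, h₂, h₃, h₄]
      · exact ⟨⟨fun c hc => ⟨(h c hc).1.1.1, (h c hc).1.2⟩, fun _ => ⟨e, he, fun c hc =>
          (h c hc).2⟩⟩, fun c hc => (h c hc).1.1.2⟩

theorem isFactorizationLE_zero {F : Forest A} : F.IsFactorizationLE μ 0 ↔
    (∃ a, F = .letter a ∧ True) ∨ ∃ l, F = node l ∧ l = [] := by
  cases F with
  | letter a => simp [IsFactorizationLE, IsFactorization, height]
  | node l =>
    simp only [IsFactorizationLE, height_node_le_iff, reduceCtorEq, false_and, exists_false,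
      node.injEq, exists_eq_left', false_or]
    constructor
    · rintro ⟨-, h⟩
      exact List.eq_nil_iff_forall_not_mem.2 fun c hc => by have := h c hc; omega
    · rintro rfl
      simp [isFactorization_node]

theorem Reg.enc_congr {P Q : Forest A → Prop} (hP : Reg (Enc P)) (h : ∀ F, Q F ↔ P F) :
    Reg (Enc Q) := by
  rwa [show Q = P from funext fun F => propext (h F)]

/-- Induction on the height, one layer of brackets at a time. Bracketed words of unbounded height
would not be regular. -/
theorem Reg.isFactorizationLE [Finite M] (μ : FreeMonoid A →* M) (h : ℕ) :
    Reg (Enc fun F : Forest A => F.IsFactorizationLE μ h) := by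
  classical
  induction h with
  | zero =>
    exact ((Reg.enc_letter _).enc_or Reg.lenc_nil).enc_congr fun F => isFactorizationLE_zero
  | succ h ih =>
    have := Fintype.ofFinite M
    have h₁ : Reg (Enc fun F : Forest A => F.IsFactorizationLE μ h ∧ F.word ≠ []) := by
      refine (ih.enc_word (Reg.forall_letter fun b => ∀ a, b ≠ Bracketed.letter a).not).enc_congr
        fun F => and_congr Iff.rfl ?_
      rw [word_ne_nil_iff]
      push Not
      exact ⟨fun ⟨a, ha⟩ => ⟨_, ha, a, rfl⟩, fun ⟨_, ha, a, h⟩ => ⟨a, h ▸ ha⟩⟩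
    have h₂ : ∀ e : M, Reg (Enc fun F : Forest A =>
        (F.IsFactorizationLE μ h ∧ F.word ≠ []) ∧ F.value μ = e) := fun e =>
      (h₁.enc_word (Reg.hat_eq (μ := μ) e)).enc_congr fun F => by rw [hat_encode]
    have h₃ := Reg.lenc_single h₁
    have h₄ := Reg.enc_exists (Finset.univ.filter fun e : M => e * e = e) fun e _ =>
      Reg.lenc_star (h₂ e)
    refine ((Reg.enc_letter fun _ => True).enc_or ((Reg.lenc_or Reg.lenc_nil
      (Reg.lenc_or h₃ (Reg.lenc_append h₃ h₃))).enc_or h₄)).enc_congr fun F => ?_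
    rw [isFactorizationLE_succ]
    refine or_congr Iff.rfl ?_
    simp only [Finset.mem_filter, Finset.mem_univ, true_and, Set.mem_ofPred_eq]
    constructor
    · rintro ⟨l, rfl, h | ⟨e, he, h⟩⟩
      · exact Or.inl ⟨l, rfl, h⟩
      · exact Or.inr ⟨e, he, l, rfl, h⟩
    · rintro (⟨l, rfl, h⟩ | ⟨e, he, l, rfl, h⟩)
      · exact ⟨l, rfl, Or.inl h⟩
      · exact ⟨l, rfl, Or.inr ⟨e, he, h⟩⟩

theorem Forest.IsFactorizationLE.of_mem {l : List (Forest A)} {h : ℕ}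
    (hl : (node l).IsFactorizationLE μ (h + 1)) {c : Forest A} (hc : c ∈ l) :
    c.IsFactorizationLE μ h :=
  ⟨(((isFactorization_node μ).1 hl.1).1 c hc).1, by
    have := height_lt_of_mem hc
    have := hl.2
    omega⟩

/-- Induction on the height: the frontier word is cut between the first and the last child at one of
finitely many places, and the children in between are arbitrary factorizations. -/
theorem Reg.frontier_eq [Finite M] (μ : FreeMonoid A →* M) (h : ℕ) (u : List A) :
    Reg (Enc fun F : Forest A => F.IsFactorizationLE μ h ∧ F.frontier = u) := by
  induction h generalizing u with
  | zero =>
    refine ((Reg.isFactorizationLE μ 0).enc_and ((Reg.enc_letter fun a => [a] = u).enc_or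
      (((Reg.lenc_nil (A := A)).enc_word (Reg.const ([] = u)))))).enc_congr fun F =>
        and_congr_right fun hF => ?_
    rcases isFactorizationLE_zero.1 hF with ⟨a, rfl, -⟩ | ⟨l, rfl, rfl⟩
    · simp [Forest.frontier]
    · simp [Forest.frontier, firstLast]
  | succ h ih =>
    have key := (Reg.enc_letter fun a => [a] = u).enc_or
      (((Reg.lenc_nil (A := A)).enc_word (Reg.const ([] = u))).enc_or
      ((Reg.lenc_single (ih u)).enc_or
      (Reg.enc_exists (Finset.range (u.length + 1)) fun i _ =>
        Reg.lenc_append (Reg.lenc_single (ih (u.take i)))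
          (Reg.lenc_append (Reg.lenc_star (Reg.isFactorizationLE μ h))
            (Reg.lenc_single (ih (u.drop i)))))))
    refine ((Reg.isFactorizationLE μ (h + 1)).enc_and key).enc_congr fun F =>
      and_congr_right fun hF => ?_
    cases F with
    | letter a => simp [Forest.frontier]
    | node l =>
      simp only [reduceCtorEq, false_and, exists_false, node.injEq, exists_eq_left', false_or,
        Finset.mem_range]
      constructor
      · intro hu
        rw [frontier_node] at hu
        rcases list_cases l with rfl | ⟨c, rfl⟩ | ⟨c, m, d, rfl⟩
        · exact Or.inl ⟨rfl, by simpa [firstLast] using hu⟩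
        · exact Or.inr (Or.inl ⟨c, rfl, hF.of_mem (by simp), by simpa [firstLast] using hu⟩)
        · rw [firstLast_map_append] at hu
          refine Or.inr (Or.inr ⟨c.frontier.length, ?_, [c], m ++ [d], by simp,
            ⟨c, rfl, hF.of_mem (by simp), ?_⟩, m, [d], rfl, fun b hb => hF.of_mem (by simp [hb]),
            d, rfl, hF.of_mem (by simp), ?_⟩)
          · simp [← hu]
          · simp [← hu]
          · simp [← hu]
      · rintro (⟨rfl, rfl⟩ | ⟨c, rfl, -, rfl⟩ |
          ⟨i, -, _, _, rfl, ⟨c, rfl, -, hc⟩, m, _, rfl, -, d, rfl, -, hd⟩)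
        · simp [Forest.frontier, firstLast]
        · simp [Forest.frontier, firstLast]
        · rw [frontier_node, ← List.append_assoc]
          have := firstLast_map_append (l := m) c d
          rw [hc, hd, List.take_append_drop] at this
          simpa using this

end Values

/-! ### Regular relations between nodes -/

section NodeRelations

open Forest Bracketed

variable {A : Type u} {M : Type v} [Monoid M]

/-- A path that leads to a node other than the root. -/
def IsNode (F : Forest A) (t : List ℕ) : Prop := ∃ pre G post, NodeAt F t pre G post

theorem isNode_iff {F : Forest A} {t : List ℕ} :
    IsNode F t ↔ t ≠ [] ∧ ∃ G, F.subforest t = some G := by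
  constructor
  · rintro ⟨pre, G, post, h⟩
    exact ⟨h.ne_nil, G, h.subforest_eq⟩
  · rintro ⟨h, G, hG⟩
    obtain ⟨pre, post, h⟩ := exists_nodeAt h hG
    exact ⟨pre, G, post, h⟩

open Classical in
/-- The position of the opening bracket of a node. -/
noncomputable def pos (F : Forest A) (t : List ℕ) : ℕ :=
  if h : IsNode F t then h.choose.length else 0

theorem NodeAt.pos_eq {F G : Forest A} {t : List ℕ} {pre post : List (Bracketed A)}
    (h : NodeAt F t pre G post) : pos F t = pre.length := by
  have h' : IsNode F t := ⟨pre, G, post, h⟩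
  rw [pos, dif_pos h']
  obtain ⟨H, post', hH⟩ := h'.choose_spec
  rw [(hH.unique h).1]

theorem NodeAt.isNode {F G : Forest A} {t : List ℕ} {pre post : List (Bracketed A)}
    (h : NodeAt F t pre G post) : IsNode F t := ⟨pre, G, post, h⟩

theorem pos_injOn {F : Forest A} {t s : List ℕ} (ht : IsNode F t) (hs : IsNode F s)
    (h : pos F t = pos F s) : t = s := by
  obtain ⟨pre, G, post, ht⟩ := ht
  obtain ⟨pre', H, post', hs⟩ := hs
  rw [ht.pos_eq, hs.pos_eq] at h
  exact ht.path_eq hs h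

theorem IsNode.getElem?_pos {F : Forest A} {t : List ℕ} (h : IsNode F t) :
    F.encode[pos F t]? = some opening := by
  obtain ⟨pre, G, post, h⟩ := h
  rw [h.pos_eq, h.encode_eq]
  simp

theorem IsNode.pos_lt {F : Forest A} {t : List ℕ} (h : IsNode F t) :
    pos F t < F.encode.length :=
  (List.getElem?_eq_some_iff.1 h.getElem?_pos).1

theorem exists_pos_eq {F : Forest A} {i : ℕ} (h : F.encode[i]? = some opening) :
    ∃ t, IsNode F t ∧ pos F t = i := by
  obtain ⟨hi, h⟩ := List.getElem?_eq_some_iff.1 h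
  have h' : F.encode = F.encode.take i ++ opening :: F.encode.drop (i + 1) := by
    rw [← h]
    simp
  obtain ⟨t, G, post, hn⟩ := exists_nodeAt_of_opening h'
  exact ⟨t, hn.isNode, by rw [hn.pos_eq]; simp [hi.le]⟩

theorem finite_isNode (F : Forest A) : {t | IsNode F t}.Finite := by
  refine Set.Finite.of_finite_image (f := pos F) ((Set.finite_lt_nat F.encode.length).subset ?_)
    fun t ht s hs h => pos_injOn ht hs h
  rintro _ ⟨t, ht, rfl⟩
  exact IsNode.pos_lt ht

variable (μ : FreeMonoid A →* M) (K : ℕ)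

/-- The relations between `n` nodes and a set of nodes of a factorization that are regular. -/
def NReg (n : ℕ) (P : Forest A → Finset (List ℕ) → (Fin n → List ℕ) → Prop) : Prop :=
  ∃ Q : List (Bracketed A ⊕ Bracketed A) → (Fin n → ℕ) → Prop, WReg n Q ∧
    ∀ F T x, F.IsFactorizationLE μ K → (∀ t ∈ T, IsNode F t) → (∀ j, IsNode F (x j)) →
      (P F T x ↔ Q (mark F.encode (T.image (pos F))) fun j => pos F (x j))

variable {μ K} {n : ℕ} {P Q : Forest A → Finset (List ℕ) → (Fin n → List ℕ) → Prop}

theorem NReg.congr (h : NReg μ K n P)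
    (hPQ : ∀ F T x, F.IsFactorizationLE μ K → (∀ t ∈ T, IsNode F t) → (∀ j, IsNode F (x j)) →
      (P F T x ↔ Q F T x)) : NReg μ K n Q := by
  obtain ⟨R, hR, h⟩ := h
  exact ⟨R, hR, fun F T x h₁ h₂ h₃ => (hPQ F T x h₁ h₂ h₃).symm.trans (h F T x h₁ h₂ h₃)⟩

theorem NReg.const (p : Prop) : NReg μ K n fun _ _ _ => p :=
  ⟨_, WReg.const p, fun _ _ _ _ _ _ => Iff.rfl⟩

theorem NReg.not (h : NReg μ K n P) : NReg μ K n fun F T x => ¬ P F T x := by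
  obtain ⟨R, hR, h⟩ := h
  exact ⟨_, hR.not, fun F T x h₁ h₂ h₃ => not_congr (h F T x h₁ h₂ h₃)⟩

theorem NReg.and (hP : NReg μ K n P) (hQ : NReg μ K n Q) :
    NReg μ K n fun F T x => P F T x ∧ Q F T x := by
  obtain ⟨R, hR, h⟩ := hP
  obtain ⟨R', hR', h'⟩ := hQ
  exact ⟨_, hR.and hR', fun F T x h₁ h₂ h₃ =>
    and_congr (h F T x h₁ h₂ h₃) (h' F T x h₁ h₂ h₃)⟩

theorem NReg.or (hP : NReg μ K n P) (hQ : NReg μ K n Q) :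
    NReg μ K n fun F T x => P F T x ∨ Q F T x :=
  (hP.not.and hQ.not).not.congr fun F T x _ _ _ => by tauto

theorem NReg.imp (hP : NReg μ K n P) (hQ : NReg μ K n Q) :
    NReg μ K n fun F T x => P F T x → Q F T x :=
  (hP.not.or hQ).congr fun F T x _ _ _ => by tauto

/-- Regular relations between nodes, one of which is singled out, as relations between positions. -/
theorem NReg.positions {P : Forest A → Finset (List ℕ) → (Fin n → List ℕ) → List ℕ → Prop}
    (h : NReg μ K (n + 1) fun F T y => P F T (fun j => y j.succ) (y 0)) :
    ∃ R : List (Bracketed A ⊕ Bracketed A) → (Fin n → ℕ) → ℕ → Prop,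
      WReg (n + 1) (fun w y => R w (fun j => y j.succ) (y 0)) ∧
      ∀ F T x, F.IsFactorizationLE μ K → (∀ t ∈ T, IsNode F t) → (∀ j, IsNode F (x j)) →
        (∀ t, IsNode F t → (P F T x t ↔
          R (mark F.encode (T.image (pos F))) (fun j => pos F (x j)) (pos F t))) ∧
        ∀ i, R (mark F.encode (T.image (pos F))) (fun j => pos F (x j)) i →
          i < F.encode.length → ∃ t, IsNode F t ∧ pos F t = i := by
  obtain ⟨Q, hQ, h⟩ := h
  refine ⟨fun w x i => (∃ c, w[i]? = some c ∧ Sum.elim id id c = opening) ∧ Q w (Fin.cons i x),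
    ((WReg.letter (fun c => Sum.elim id id c = opening) 0).and hQ).congr fun w x _ => ?_, fun F T x hF hT hx => ⟨fun t ht => ?_, ?_⟩⟩
  · refine and_congr Iff.rfl (iff_of_eq (congrArg (Q w) ?_))
    exact (Fin.cons_self_tail x).symm
  · have := h F T (Fin.cons t x) hF hT fun j => by refine Fin.cases ?_ (fun j => ?_) j <;> simp [ht, hx]
    simp only [Fin.cons_succ, Fin.cons_zero] at this
    rw [this]
    have hc : (fun j => pos F ((Fin.cons t x : Fin (n + 1) → List ℕ) j)) =
        Fin.cons (pos F t) fun j => pos F (x j) := by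
      funext j
      refine Fin.cases ?_ (fun j => ?_) j <;> simp
    rw [hc]
    refine ⟨fun h => ⟨⟨_, List.getElem?_eq_getElem (by simpa using ht.pos_lt), ?_⟩, h⟩,
      fun h => h.2⟩
    have := (List.getElem?_eq_some_iff.1 ht.getElem?_pos).2
    rw [getElem_mark]
    split_ifs <;> simpa using this
  · rintro i ⟨⟨c, hc, hc'⟩, -⟩ hi
    rw [List.getElem?_eq_some_iff] at hc
    obtain ⟨hi', rfl⟩ := hc
    refine exists_pos_eq (List.getElem?_eq_some_iff.2 ⟨hi, ?_⟩)
    rw [getElem_mark] at hc'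
    split_ifs at hc' <;> simpa using hc'

theorem NReg.ex {P : Forest A → Finset (List ℕ) → (Fin n → List ℕ) → List ℕ → Prop}
    (h : NReg μ K (n + 1) fun F T y => P F T (fun j => y j.succ) (y 0)) :
    NReg μ K n fun F T x => ∃ t, IsNode F t ∧ P F T x t := by
  obtain ⟨R, hR, h⟩ := h.positions
  refine ⟨_, hR.ex, fun F T x hF hT hx => ?_⟩
  obtain ⟨h₁, h₂⟩ := h F T x hF hT hx
  rw [length_mark]
  constructor
  · rintro ⟨t, ht, hP⟩
    exact ⟨_, ht.pos_lt, (h₁ t ht).1 hP⟩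
  · rintro ⟨i, hi, hi'⟩
    obtain ⟨t, ht, rfl⟩ := h₂ i hi' hi
    exact ⟨t, ht, (h₁ t ht).2 hi'⟩

theorem NReg.all {P : Forest A → Finset (List ℕ) → (Fin n → List ℕ) → List ℕ → Prop}
    (h : NReg μ K (n + 1) fun F T y => P F T (fun j => y j.succ) (y 0)) :
    NReg μ K n fun F T x => ∀ t, IsNode F t → P F T x t :=
  (NReg.ex (P := fun F T x t => ¬ P F T x t) h.not).not.congr fun F T x _ _ _ => by
    push Not
    rfl

theorem NReg.le_ncard {P : Forest A → Finset (List ℕ) → (Fin n → List ℕ) → List ℕ → Prop} (c : ℕ)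
    (h : NReg μ K (n + 1) fun F T y => P F T (fun j => y j.succ) (y 0)) :
    NReg μ K n fun F T x => c ≤ {t | IsNode F t ∧ P F T x t}.ncard := by
  obtain ⟨R, hR, h⟩ := h.positions
  refine ⟨_, hR.le_ncard c, fun F T x hF hT hx => ?_⟩
  obtain ⟨h₁, h₂⟩ := h F T x hF hT hx
  rw [length_mark]
  refine iff_of_eq (congrArg (c ≤ ·) ?_)
  rw [← Set.InjOn.ncard_image (f := pos F) fun t ht s hs hts => pos_injOn ht.1 hs.1 hts]
  congr 1
  ext i
  constructor
  · rintro ⟨t, ⟨ht, hP⟩, rfl⟩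
    exact ⟨ht.pos_lt, (h₁ t ht).1 hP⟩
  · rintro ⟨hi, hi'⟩
    obtain ⟨t, ht, rfl⟩ := h₂ i hi' hi
    exact ⟨t, ⟨ht, (h₁ t ht).2 hi'⟩, rfl⟩

theorem WReg.comap {B : Type*} {C : Type*} {n : ℕ} {P : List B → (Fin n → ℕ) → Prop}
    (h : WReg n P) (f : C → B) : WReg n fun w x => P (w.map f) x := by
  obtain ⟨L, hL, h⟩ := h
  refine ⟨_, hL.comap fun c : C × (Fin n → Bool) => (f c.1, c.2), fun w x hx => ?_⟩
  refine (h _ _ (by simpa using hx)).trans (iff_of_eq (congrArg L ?_))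
  exact List.ext_getElem (by simp) fun i h₁ h₂ => by simp

theorem NReg.of_wreg {R : List (Bracketed A) → (Fin n → ℕ) → Prop} (hR : WReg n R)
    (h : ∀ F T x, F.IsFactorizationLE μ K → (∀ j, IsNode F (x j)) →
      (P F T x ↔ R F.encode fun j => pos F (x j))) : NReg μ K n P :=
  ⟨_, hR.comap (Sum.elim id id), fun F T x hF _ hx => by rw [map_elim_mark]; exact h F T x hF hx⟩

theorem NReg.of_reg {R : List (Bracketed A) → Prop} (hR : Reg R) :
    NReg μ K n fun F _ _ => R F.encode :=
  NReg.of_wreg (WReg.of_reg hR) fun _ _ _ _ _ => Iff.rfl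

theorem NReg.mem (j : Fin n) : NReg μ K n fun _ T x => x j ∈ T := by
  refine ⟨_, WReg.letter (fun c => c.isRight = true) j, fun F T x _ hT hx => ?_⟩
  have hlt := (hx j).pos_lt
  have hmem : pos F (x j) ∈ T.image (pos F) ↔ x j ∈ T := by
    rw [Finset.mem_image]
    exact ⟨fun ⟨t, ht, h⟩ => pos_injOn (hT t ht) (hx j) h ▸ ht, fun h => ⟨_, h, rfl⟩⟩
  dsimp only
  rw [List.getElem?_eq_getElem (by simpa using hlt), getElem_mark]
  simp only [hmem]
  by_cases h : x j ∈ T <;> simp [h]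

theorem NReg.lt (j k : Fin n) : NReg μ K n fun F _ x => pos F (x j) < pos F (x k) :=
  NReg.of_wreg (WReg.lt j k) fun _ _ _ _ _ => Iff.rfl

theorem NReg.eq (j k : Fin n) : NReg μ K n fun _ _ x => x j = x k :=
  NReg.of_wreg (WReg.eq j k) fun _ _ _ _ hx =>
    ⟨fun h => congrArg (pos _) h, fun h => pos_injOn (hx j) (hx k) h⟩

/-- `k` is the position of the closing bracket that corresponds to the opening bracket at `j`, and
the forest in between has property `R`. -/
theorem WReg.close {R : Forest A → Prop} (hR : Reg (Enc R)) (j k : Fin n) :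
    WReg n fun (w : List (Bracketed A)) x =>
      (x j < x k ∧ Enc R ((w.take (x k)).drop (x j + 1))) ∧ ∃ c, w[x k]? = some c ∧ c = closing :=
  (WReg.factor hR j k).and (WReg.letter _ k)

/-- By `encode_closing_inj`, at most one forest followed by a closing bracket can start after a
given opening bracket. So the matching bracket is found without counting. -/
theorem NodeAt.close_iff {F G : Forest A} {t : List ℕ} {pre post : List (Bracketed A)}
    (h : NodeAt F t pre G post) (R : Forest A → Prop) (i : ℕ) :
    ((pos F t < i ∧ Enc R ((F.encode.take i).drop (pos F t + 1))) ∧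
      ∃ c, F.encode[i]? = some c ∧ c = closing) ↔ i = pre.length + 1 + G.encode.length ∧ R G := by
  rw [h.pos_eq]
  constructor
  · rintro ⟨⟨h₁, H, hH, h₂⟩, c, hc, rfl⟩
    obtain ⟨hi, hc⟩ := List.getElem?_eq_some_iff.1 hc
    have h₃ : F.encode = F.encode.take i ++ closing :: F.encode.drop (i + 1) := by
      rw [← hc]
      simp
    have h₄ : F.encode.take i = pre ++ opening :: H.encode := by
      have h₅ : F.encode.take i = (F.encode.take i).take (pre.length + 1) ++ H.encode := by
        rw [h₂, List.take_append_drop]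
      rw [List.take_take, min_eq_left h₁] at h₅
      rw [h₅]
      have h₆ : F.encode.take (pre.length + 1) = pre ++ [opening] := by
        rw [h.encode_eq, List.take_append]
        simp
      rw [h₆]
      simp
    have h₅ := h.encode_eq.symm.trans h₃
    rw [h₄] at h₅
    simp only [List.append_assoc, List.cons_append, List.append_cancel_left_eq,
      List.cons.injEq, true_and] at h₅
    obtain ⟨rfl, -⟩ := encode_closing_inj h₅
    refine ⟨?_, hH⟩
    have := congrArg List.length h₄
    rw [List.length_take, min_eq_left hi.le] at this
    rw [this]
    simp
    omega
  · rintro ⟨rfl, hG⟩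
    rw [h.encode_eq]
    refine ⟨⟨by omega, G, hG, ?_⟩, _, ?_, rfl⟩
    · rw [List.take_append, List.take_of_length_le (by omega), List.drop_append,
        List.drop_of_length_le (by omega)]
      have e₁ : pre.length + 1 + G.encode.length - pre.length = G.encode.length + 1 := by omega
      have e₂ : pre.length + 1 - pre.length = 1 := by omega
      simp [e₁, e₂]
    · rw [List.getElem?_append_right (by omega)]
      have e₁ : pre.length + 1 + G.encode.length - pre.length = G.encode.length + 1 := by omega
      simp [e₁]

theorem NodeAt.closing_lt {F G : Forest A} {t : List ℕ} {pre post : List (Bracketed A)}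
    (h : NodeAt F t pre G post) : pre.length + 1 + G.encode.length < F.encode.length := by
  rw [h.encode_eq]
  simp
  omega

/-- A node descends from another exactly when its opening bracket lies between the two brackets of
the latter. -/
theorem NReg.prefix [Finite M] (j k : Fin n) : NReg μ K n fun _ _ x => x j <+: x k := by
  refine NReg.of_wreg (WReg.ex (P := fun w x i => ((x j < i ∧
      Enc (fun F => F.IsFactorizationLE μ K) ((w.take i).drop (x j + 1))) ∧
      ∃ c, w[i]? = some c ∧ c = closing) ∧ x j ≤ x k ∧ x k < i)
    ((WReg.close (Reg.isFactorizationLE μ K) j.succ 0).and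
      ((WReg.le j.succ k.succ).and (WReg.lt k.succ 0)))) fun F T x hF hx => ?_
  obtain ⟨pre, G, post, h⟩ := hx j
  obtain ⟨pre', H, post', h'⟩ := hx k
  have hG := h.isFactorizationLE hF
  constructor
  · rintro ⟨q, hq⟩
    refine ⟨_, h.closing_lt, (h.close_iff _ _).2 ⟨rfl, hG⟩, ?_⟩
    dsimp only
    rw [h.pos_eq, h'.pos_eq]
    rcases eq_or_ne q [] with rfl | hne
    · rw [List.append_nil] at hq
      rw [← hq] at h'
      rw [(h.unique h').1]
      omega
    · have hn : IsNode G q := by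
        have := h'.subforest_eq
        rw [← hq] at this
        refine isNode_iff.2 ⟨hne, H, ?_⟩
        have key : ∀ (p : List ℕ) (F G : Forest A), F.subforest p = some G →
            F.subforest (p ++ q) = G.subforest q := by
          intro p
          induction p with
          | nil =>
            intro F G h
            simp only [subforest, Option.some.injEq] at h
            simp [h]
          | cons i p ih =>
            intro F G h
            cases F with
            | letter a => simp [subforest] at h
            | node l =>
              rw [subforest, Option.bind_eq_some_iff] at h
              obtain ⟨c, hc, h⟩ := h
              simp [subforest, hc, ih c G h]
        rw [← key _ _ _ h.subforest_eq, this]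
      obtain ⟨pre'', G'', post'', hn⟩ := hn
      have h'' := h.trans hn
      rw [hq] at h''
      rw [(h'.unique h'').1]
      have := congrArg List.length hn.encode_eq
      simp at this ⊢
      omega
  · rintro ⟨i, -, hi, h₁, h₂⟩
    dsimp only at hi h₁ h₂
    obtain ⟨rfl, -⟩ := (h.close_iff _ _).1 hi
    rw [h.pos_eq, h'.pos_eq] at h₁
    rw [h'.pos_eq] at h₂
    rcases Nat.eq_or_lt_of_le h₁ with h₁ | h₁
    · exact (h.path_eq h' h₁).symm ▸ List.prefix_rfl
    · have h₃ := h.encode_eq.symm.trans h'.encode_eq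
      have h₄ : G.encode[pre'.length - (pre.length + 1)]? = some opening := by
        have h₅ := congrArg (fun w => w[pre'.length]?) h₃
        rw [List.getElem?_append_right (by omega), List.getElem?_append_right le_rfl] at h₅
        obtain ⟨d, hd⟩ : ∃ d, pre'.length - pre.length = d + 1 :=
          ⟨pre'.length - pre.length - 1, by omega⟩
        rw [hd, List.getElem?_cons_succ, List.getElem?_append_left (by omega)] at h₅
        rw [show pre'.length - (pre.length + 1) = d by omega, h₅]
        simp
      obtain ⟨q, hq, hq'⟩ := exists_pos_eq h₄
      obtain ⟨pre'', G'', post'', hn⟩ := hq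
      rw [hn.pos_eq] at hq'
      have h₅ := (h.trans hn).path_eq h' (by simp; omega)
      exact ⟨q, h₅⟩

/-- `t` is the right sibling of `s`. -/
def Next (s t : List ℕ) : Prop := ∃ (q : List ℕ) (i : ℕ), s = q ++ [i] ∧ t = q ++ [i + 1]

/-- Right sibling means that the opening bracket directly follows the matching closing bracket. -/
theorem NReg.next [Finite M] (j k : Fin n) : NReg μ K n fun _ _ x => Next (x j) (x k) := by
  refine NReg.of_wreg (WReg.ex (P := fun w x i => ((x j < i ∧
      Enc (fun F => F.IsFactorizationLE μ K) ((w.take i).drop (x j + 1))) ∧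
      ∃ c, w[i]? = some c ∧ c = closing) ∧ i + 1 = x k)
    ((WReg.close (Reg.isFactorizationLE μ K) j.succ 0).and
      (WReg.succ 0 k.succ))) fun F T x hF hx => ?_
  obtain ⟨pre, G, post, h⟩ := hx j
  obtain ⟨pre', H, post', h'⟩ := hx k
  have hG := h.isFactorizationLE hF
  constructor
  · rintro ⟨q, i, h₁, h₂⟩
    dsimp only at h₁ h₂ ⊢
    rw [h₁] at h
    rw [h₂] at h'
    refine ⟨_, h.closing_lt, ?_, ?_⟩
    · rw [h₁]
      exact (h.close_iff _ _).2 ⟨rfl, hG⟩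
    · rw [h₂]
      obtain ⟨pre'', G', h₃, rfl⟩ := h'.prev
      obtain ⟨rfl, rfl, -⟩ := h.unique h₃
      rw [h'.pos_eq]
      simp
      omega
  · rintro ⟨i, -, hi, h₁⟩
    dsimp only at hi h₁
    obtain ⟨rfl, -⟩ := (h.close_iff _ _).1 hi
    rw [h'.pos_eq] at h₁
    have h₃ := h.encode_eq.symm.trans h'.encode_eq
    have h₄ : ∃ y, post = opening :: y := by
      have h₅ := congrArg (fun w => w[pre'.length]?) h₃
      rw [List.getElem?_append_right (by omega), List.getElem?_append_right le_rfl,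
        show pre'.length - pre.length = (G.encode.length + 1) + 1 by omega,
        List.getElem?_cons_succ, List.getElem?_append_right (by omega)] at h₅
      simp at h₅
      rcases post with _ | ⟨b, y⟩
      · simp at h₅
      · simp at h₅
        exact ⟨y, by rw [h₅]⟩
    obtain ⟨y, rfl⟩ := h₄
    obtain ⟨q, i, h₅, G', post'', h₆⟩ := h.next
    exact ⟨q, i, h₅, (h₆.path_eq h' (by simp; omega)).symm⟩

theorem Reg.depth_eq (m : ℕ) [NeZero m] (a : ZMod m) :
    Reg fun w : List (Bracketed A) => (depth w : ZMod m) = a := by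
  let φ : FreeMonoid (Bracketed A) →* Multiplicative (ZMod m) := FreeMonoid.lift fun b =>
    Multiplicative.ofAdd ((depth [b] : ℤ) : ZMod m)
  have hφ : ∀ w : List (Bracketed A),
      φ (FreeMonoid.ofList w) = Multiplicative.ofAdd ((depth w : ℤ) : ZMod m) := by
    intro w
    induction w with
    | nil => simp
    | cons b w ih =>
      rw [FreeMonoid.ofList_cons, map_mul, ih, ← List.singleton_append, depth_append]
      simp only [φ, FreeMonoid.lift_eval_of, Int.cast_add, ofAdd_add]
  refine (Reg.of_hom φ fun x => x = Multiplicative.ofAdd a).congr fun w => ?_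
  rw [hφ]
  exact Multiplicative.ofAdd.injective.eq_iff

/-- Depths of nodes are at most `K`, so the residue modulo `K + 1` of the bracket depth of the
prefix determines them; a larger `d` never occurs. -/
theorem NReg.length_eq (d : ℕ) (j : Fin n) : NReg μ K n fun _ _ x => (x j).length = d := by
  by_cases hd : d ≤ K
  · refine NReg.of_wreg (WReg.take (Reg.depth_eq (K + 1) ((d : ZMod (K + 1)) - 1)) j)
      fun F T x hF hx => ?_
    obtain ⟨pre, G, post, h⟩ := hx j
    have h₁ := h.depth_eq
    have h₂ := h.height_le
    have h₃ := hF.2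
    have h₄ : F.encode.take (pos F (x j)) = pre := by rw [h.pos_eq, h.encode_eq]; simp
    rw [h₄, eq_sub_iff_add_eq]
    have h₅ : (depth pre : ZMod (K + 1)) + 1 = ((x j).length : ZMod (K + 1)) := by
      exact_mod_cast congrArg (Int.cast : ℤ → ZMod (K + 1)) h₁
    rw [h₅, ZMod.natCast_eq_natCast_iff', Nat.mod_eq_of_lt (by omega), Nat.mod_eq_of_lt (by omega)]
  · refine (NReg.const False).congr fun F T x hF _ hx => ?_
    obtain ⟨pre, G, post, h⟩ := hx j
    have h₂ := h.height_le
    have h₃ := hF.2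
    simp only [false_iff]
    omega

theorem Context.ext_iff' {A : Type*} {M : Type*} {x y : Context A M} :
    x = y ↔ x.left = y.left ∧ x.word = y.word ∧ x.right = y.right := by
  cases x; cases y; simp

theorem NReg.nodeType_eq [Finite M] (τ : NodeType A M) (j : Fin n) :
    NReg μ K n fun F _ x => F.nodeType μ (x j) = τ := by
  have h₁ : NReg μ K n fun F _ x => (F.lin μ (x j)).left = τ.1.left := by
    refine NReg.of_wreg (WReg.take (Reg.hat_eq (μ := μ) τ.1.left) j) fun F T x hF hx => ?_
    obtain ⟨pre, G, post, h⟩ := hx j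
    have h₄ : F.encode.take (pos F (x j)) = pre := by rw [h.pos_eq, h.encode_eq]; simp
    rw [h₄, h.lin_eq]
  have h₂ : NReg μ K n fun F _ x =>
      (F.lin μ (x j)).word = τ.1.word ∧ (F.lin μ (x j)).right = τ.1.right := by
    refine NReg.of_wreg (WReg.ex (P := fun w x i => ((x j < i ∧
      Enc (fun F => F.IsFactorizationLE μ K ∧ F.frontier = τ.1.word)
        ((w.take i).drop (x j + 1))) ∧ ∃ c, w[i]? = some c ∧ c = closing) ∧
        hat μ (FreeMonoid.ofList (w.drop (i + 1))) = τ.1.right)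
      ((WReg.close (Reg.frontier_eq μ K τ.1.word) j.succ 0).and
        (WReg.drop (Reg.hat_eq (μ := μ) τ.1.right) 0))) fun F T x hF hx => ?_
    obtain ⟨pre, G, post, h⟩ := hx j
    have hG := h.isFactorizationLE hF
    have h₄ : F.encode.drop (pre.length + 1 + G.encode.length + 1) = post := by
      rw [h.encode_eq, List.drop_append, List.drop_of_length_le (by omega),
        show pre.length + 1 + G.encode.length + 1 - pre.length = (G.encode.length + 1) + 1 by omega]
      simp
    simp only [h.close_iff, h.lin_eq]
    constructor
    · rintro ⟨hw, hr⟩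
      exact ⟨_, h.closing_lt, ⟨rfl, hG, hw⟩, by rw [h₄]; exact hr⟩
    · rintro ⟨i, -, ⟨rfl, -, hw⟩, hr⟩
      rw [h₄] at hr
      exact ⟨hw, hr⟩
  refine ((h₁.and h₂).and (NReg.length_eq τ.2 j)).congr fun F T x _ _ _ => ?_
  rw [nodeType, Prod.ext_iff, Context.ext_iff']

theorem isIterable_iff {F : Forest A} {t : List ℕ} (ht : IsNode F t) : F.IsIterable t ↔
    (∃ s, IsNode F s ∧ Next s t) ∧ ∃ s, IsNode F s ∧ Next t s := by
  constructor
  · rintro ⟨q, i, G, rfl, hG, h₁, h₂⟩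
    obtain ⟨i, rfl⟩ : ∃ k, i = k + 1 := ⟨i - 1, by omega⟩
    obtain ⟨pre, H, post, h⟩ := ht
    obtain ⟨pre', H', h', -⟩ := h.prev
    refine ⟨⟨_, h'.isNode, q, i, rfl, rfl⟩, q ++ [i + 1 + 1], ?_, q, i + 1, rfl, rfl⟩
    refine isNode_iff.2 ⟨by simp, ?_⟩
    have key : ∀ (q : List ℕ) (F : Forest A), F.subforest q = some G →
        ∃ H, F.subforest (q ++ [i + 1 + 1]) = some H := by
      intro q
      induction q with
      | nil =>
        intro F h
        simp only [subforest, Option.some.injEq] at h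
        subst h
        cases F with
        | letter a => simp [arity] at h₂
        | node l =>
          simp only [arity] at h₂
          exact ⟨l[i + 1 + 1], by simp [subforest, List.getElem?_eq_getElem h₂]⟩
      | cons j q ih =>
        intro F h
        cases F with
        | letter a => simp [subforest] at h
        | node l =>
          rw [subforest, Option.bind_eq_some_iff] at h
          obtain ⟨c, hc, h⟩ := h
          obtain ⟨H, hH⟩ := ih c h
          exact ⟨H, by simp [subforest, hc, hH]⟩
    exact key q F hG
  · rintro ⟨⟨s, -, q, i, -, rfl⟩, s', hs', q', i', h₁, rfl⟩
    obtain ⟨rfl, h₂⟩ := List.append_inj' h₁ rfl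
    simp only [List.cons.injEq, and_true] at h₂
    subst h₂
    obtain ⟨-, H, hH⟩ := isNode_iff.1 hs'
    have key : ∀ (q : List ℕ) (F : Forest A), F.subforest (q ++ [i + 1 + 1]) = some H →
        ∃ G, F.subforest q = some G ∧ i + 1 + 1 < G.arity := by
      intro q
      induction q with
      | nil =>
        intro F h
        refine ⟨F, by cases F <;> rfl, ?_⟩
        cases F with
        | letter a => simp [subforest] at h
        | node l =>
          rw [List.nil_append, subforest, Option.bind_eq_some_iff] at h
          obtain ⟨c, hc, -⟩ := h
          exact (List.getElem?_eq_some_iff.1 hc).1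
      | cons j q ih =>
        intro F h
        cases F with
        | letter a => simp [subforest] at h
        | node l =>
          rw [List.cons_append, subforest, Option.bind_eq_some_iff] at h
          obtain ⟨c, hc, h⟩ := h
          obtain ⟨G, hG, hlt⟩ := ih c h
          exact ⟨G, by simp [subforest, hc, hG], hlt⟩
    obtain ⟨G, hG, hlt⟩ := key q F hH
    exact ⟨q, i + 1, G, rfl, hG, by omega, hlt⟩

theorem Forest.IsIterable.isNode {F : Forest A} {t : List ℕ} (h : F.IsIterable t) : IsNode F t := by
  obtain ⟨q, i, G, rfl, hG, h₁, h₂⟩ := h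
  refine isNode_iff.2 ⟨by simp, ?_⟩
  induction q generalizing F with
  | nil =>
    cases F with
    | letter a =>
      simp only [subforest, Option.some.injEq] at hG
      subst hG
      simp [arity] at h₂
    | node l =>
      simp only [subforest, Option.some.injEq] at hG
      subst hG
      simp only [arity] at h₂
      exact ⟨l[i], by simp [subforest, List.getElem?_eq_getElem (show i < l.length by omega)]⟩
  | cons j q ih =>
    cases F with
    | letter a => simp [subforest] at hG
    | node l =>
      rw [subforest, Option.bind_eq_some_iff] at hG
      obtain ⟨c, hc, hG⟩ := hG
      obtain ⟨H, hH⟩ := ih hG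
      exact ⟨H, by simp [subforest, hc, hH]⟩

theorem isIterable_singleton {F : Forest A} {i : ℕ} :
    F.IsIterable [i] ↔ 0 < i ∧ i + 1 < F.arity := by
  constructor
  · rintro ⟨q, j, G, h, hG, h₁, h₂⟩
    rcases q with _ | ⟨k, q⟩
    · simp only [List.nil_append, List.cons.injEq, and_true] at h
      have hG' : F = G := by cases F <;> simpa [subforest] using hG
      subst h hG'
      exact ⟨h₁, h₂⟩
    · simp at h
  · rintro ⟨h₁, h₂⟩
    exact ⟨[], i, F, rfl, by cases F <;> rfl, h₁, h₂⟩

theorem isInterior_iff {F : Forest A} {t : List ℕ} : IsInterior F t ↔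
    ∃ s, IsNode F s ∧ (s.length = 1 ∧ F.IsIterable s) ∧ s <+: t := by
  constructor
  · rintro ⟨i, p, rfl, h⟩
    have h := isIterable_singleton.2 h
    exact ⟨[i], h.isNode, ⟨rfl, h⟩, p, rfl⟩
  · rintro ⟨s, -, ⟨h₁, h₂⟩, p, rfl⟩
    obtain ⟨i, rfl⟩ := List.length_eq_one_iff.1 h₁
    exact ⟨i, p, rfl, isIterable_singleton.1 h₂⟩

theorem NReg.isIterable [Finite M] (j : Fin n) : NReg μ K n fun F _ x => F.IsIterable (x j) :=
  ((NReg.ex (P := fun _ _ x s => Next s (x j)) (NReg.next 0 j.succ)).and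
    (NReg.ex (P := fun _ _ x s => Next (x j) s) (NReg.next j.succ 0))).congr
    fun _ _ _ _ _ hx => (isIterable_iff (hx j)).symm

theorem NReg.isInterior [Finite M] (j : Fin n) : NReg μ K n fun F _ x => IsInterior F (x j) :=
  (NReg.ex (P := fun F _ x s => (s.length = 1 ∧ F.IsIterable s) ∧ s <+: x j)
    (((NReg.length_eq 1 0).and (NReg.isIterable 0)).and (NReg.prefix 0 j.succ))).congr
    fun _ _ _ _ _ _ => isInterior_iff.symm

theorem observes_iff {F : Forest A} {t s : List ℕ} (ht : IsNode F t) : Observes t s ↔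
    s <+: t ∨ ∃ s', IsNode F s' ∧ s' <+: t ∧ (Next s s' ∨ Next s' s) := by
  have hpre : ∀ {q : List ℕ}, q <+: t → q ≠ [] → IsNode F q := by
    rintro q ⟨p, rfl⟩ hq
    obtain ⟨-, G, hG⟩ := isNode_iff.1 ht
    refine isNode_iff.2 ⟨hq, ?_⟩
    clear ht hq
    induction q generalizing F with
    | nil => exact ⟨F, by cases F <;> rfl⟩
    | cons i q ih =>
      cases F with
      | letter a => simp [subforest] at hG
      | node l =>
        rw [List.cons_append, subforest, Option.bind_eq_some_iff] at hG
        obtain ⟨c, hc, hG⟩ := hG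
        obtain ⟨H, hH⟩ := ih hG
        exact ⟨H, by simp [subforest, hc, hH]⟩
  rw [Observes]
  refine or_congr Iff.rfl ⟨?_, ?_⟩
  · rintro ⟨q, i, ⟨h, rfl⟩ | ⟨h, rfl⟩⟩
    · exact ⟨_, hpre h (by simp), h, Or.inl ⟨q, i, rfl, rfl⟩⟩
    · exact ⟨_, hpre h (by simp), h, Or.inr ⟨q, i, rfl, rfl⟩⟩
  · rintro ⟨s', -, h, ⟨q, i, rfl, rfl⟩ | ⟨q, i, rfl, rfl⟩⟩
    · exact ⟨q, i, Or.inl ⟨h, rfl⟩⟩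
    · exact ⟨q, i, Or.inr ⟨h, rfl⟩⟩

theorem NReg.observes [Finite M] (j k : Fin n) :
    NReg μ K n fun _ _ x => Observes (x j) (x k) :=
  ((NReg.prefix k j).or (NReg.ex (P := fun _ _ x s' => s' <+: x j ∧ (Next (x k) s' ∨ Next s' (x k)))
    ((NReg.prefix 0 j.succ).and ((NReg.next k.succ 0).or (NReg.next 0 k.succ))))).congr
    fun _ _ _ _ _ hx => (observes_iff (hx j)).symm

open Classical in
/-- Counting the sets of nodes that have a regular property. -/
theorem NReg.exists_setCount [Finite M] {P : Forest A → Finset (List ℕ) → Prop}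
    (h : NReg μ K 0 fun F T _ => P F T) : ∃ L, Reg L ∧ ∀ k, setCount L k =
      onForests μ K fun F =>
        {T : Finset (List ℕ) | (T.card = k ∧ ∀ t ∈ T, IsNode F t) ∧ P F T}.ncard := by
  obtain ⟨Q, hQ, h⟩ := h
  have hQ' : Reg fun w => Q w Fin.elim0 :=
    (hQ.congr fun w x _ => iff_of_eq (congrArg (Q w) (Subsingleton.elim _ _))).reg
  -- Besides the property itself, the language requires that the underlying word be a factorization
  -- and that only opening brackets be marked; marked positions then are nodes.
  refine ⟨_, (hQ'.and ((Reg.isFactorizationLE μ K).comap (Sum.elim id id))).and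
    (Reg.forall_letter fun c => ∀ b, c = Sum.inr b → b = opening), fun k => funext fun w => ?_⟩
  by_cases hw : ∃ F : Forest A, F.IsFactorizationLE μ K ∧ F.encode = w
  · obtain ⟨F, hF, rfl⟩ := hw
    rw [onForests_encode μ K _ F hF, setCount, ← Set.ncard_coe_finset]
    have hinj : Set.InjOn (Finset.image (pos F)) {T : Finset (List ℕ) | ∀ t ∈ T, IsNode F t} := by
      have key : ∀ T T' : Finset (List ℕ), (∀ t ∈ T, IsNode F t) → (∀ t ∈ T', IsNode F t) →
          T.image (pos F) = T'.image (pos F) → T ⊆ T' := by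
        intro T T' hT hT' h t ht
        have h₁ := Finset.mem_image_of_mem (pos F) ht
        rw [h, Finset.mem_image] at h₁
        obtain ⟨t', ht', h₁⟩ := h₁
        exact pos_injOn (hT' t' ht') (hT t ht) h₁ ▸ ht'
      exact fun T hT T' hT' h => (key T T' hT hT' h).antisymm (key T' T hT' hT h.symm)
    rw [← Set.InjOn.ncard_image (hinj.mono fun T hT => hT.1.2)]
    congr 1
    ext U
    simp only [Finset.coe_filter, Finset.mem_powersetCard, map_elim_mark, enc_encode]
    constructor
    · rintro ⟨⟨hU, hk⟩, ⟨hQU, -⟩, hop⟩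
      have hsub : (U : Set ℕ) ⊆ pos F '' {t | IsNode F t} := by
        intro i hi
        have hi' : i < F.encode.length := Finset.mem_range.1 (hU hi)
        obtain ⟨t, ht, rfl⟩ := exists_pos_eq (F := F) (i := i)
          (List.getElem?_eq_some_iff.2 ⟨hi', hop _ (List.getElem_mem (n := i) (by simpa using hi')) _
            (by rw [getElem_mark, if_pos (by exact hi)])⟩)
        exact ⟨t, ht, rfl⟩
      obtain ⟨T, hT, rfl⟩ := Finset.subset_set_image_iff.1 hsub
      have hT' : ∀ t ∈ T, IsNode F t := fun t ht => hT ht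
      rw [Finset.card_image_of_injOn fun t ht s hs h => pos_injOn (hT' t ht) (hT' s hs) h] at hk
      refine ⟨T, ⟨⟨hk, hT'⟩, (h F T Fin.elim0 hF hT' fun j => j.elim0).2 ?_⟩, rfl⟩
      convert hQU using 2
    · rintro ⟨T, ⟨⟨hk, hT⟩, hP⟩, rfl⟩
      refine ⟨⟨?_, ?_⟩, ⟨?_, hF⟩, ?_⟩
      · intro i hi
        obtain ⟨t, ht, rfl⟩ := Finset.mem_image.1 hi
        exact Finset.mem_range.2 (hT t ht).pos_lt
      · rw [Finset.card_image_of_injOn fun t ht s hs h => pos_injOn (hT t ht) (hT s hs) h, hk]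
      · convert (h F T Fin.elim0 hF hT fun j => j.elim0).1 hP using 2
      · rintro c hc b rfl
        obtain ⟨i, hi, hc⟩ := List.getElem_of_mem hc
        rw [getElem_mark] at hc
        split_ifs at hc with hi'
        obtain ⟨t, ht, rfl⟩ := Finset.mem_image.1 hi'
        rw [← Sum.inr_injective hc]
        exact (List.getElem?_eq_some_iff.1 (hT t ht).getElem?_pos).2
  · rw [onForests, dif_neg hw, setCount]
    refine Finset.card_eq_zero.2 (Finset.eq_empty_of_forall_notMem fun T hT => ?_)
    simp only [Finset.mem_filter] at hT
    have h := hT.2.1.2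
    rw [map_elim_mark] at h
    exact hw h

end NodeRelations

/-! ### Filters of positions -/

section PositionFilter

open Forest Bracketed

theorem length_filt {A : Type u} {B : Type v} {N : Type} [Monoid N] (ν : FreeMonoid A →* N)
    (out : N → A → N → Option B) (p q : N) (w : List A) : (filt ν out p q w).length =
      splitSum (fun u a v => (out (p * ν (FreeMonoid.ofList u)) a
        (ν (FreeMonoid.ofList v) * q)).elim 0 fun _ => 1) w := by
  rw [← splitSum_filt ν out fun _ _ _ => 1]
  simp [splitSum]

open Classical in
/-- The positions with a regular property can be kept by a rational function. -/
theorem WReg.exists_rational {C : Type u} {P : List C → ℕ → Prop}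
    (h : WReg 1 fun w x => P w (x 0)) : ∃ σ : List C → List C, IsRational σ ∧
      ∀ w, (σ w).length = {i | i < w.length ∧ P w i}.ncard := by
  obtain ⟨L, hL, h⟩ := h
  obtain ⟨N, _, _, φ, S, hS⟩ := hL.exists_hom
  -- Prefix and suffix are evaluated as unmarked words; the output function inserts the mark at the
  -- current letter and tests the annotated word.
  refine ⟨_, ⟨N, inferInstance, inferInstance,
    φ.comp (FreeMonoid.map fun c => (c, fun _ => false)), fun p c q =>
      if S (p * (φ (FreeMonoid.of (c, fun _ => true)) * q)) then some c else none, fun _ => rfl⟩,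
    fun w => ?_⟩
  rw [length_filt, splitSum]
  have hann : ∀ i : Fin w.length, ann w (fun _ : Fin 1 => (i : ℕ)) =
      (w.take i).map (fun c => (c, fun _ => false)) ++ (w[i], fun _ => true) ::
        (w.drop (i + 1)).map fun c => (c, fun _ => false) := by
    intro i
    have hi := i.2
    refine List.ext_getElem (by simp; omega) fun j h₁ h₂ => ?_
    rw [getElem_ann]
    rcases lt_trichotomy j i with hj | hj | hj
    · rw [List.getElem_append_left (by simp; omega)]
      simp [hj.ne']
    · subst hj
      rw [List.getElem_append_right (by simp)]
      simp
    · rw [List.getElem_append_right (by simp; omega)]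
      obtain ⟨d, rfl⟩ : ∃ d, j = i + 1 + d := ⟨j - (i + 1), by omega⟩
      have e : (i : ℕ) + 1 + d - i = d + 1 := by omega
      have e' : (i : ℕ) ≠ i + 1 + d := by omega
      simp [e, e']
  have key : ∀ i : Fin w.length, (if S (1 * φ (FreeMonoid.map (fun c => (c, fun _ => false))
      (FreeMonoid.ofList (w.take i))) * (φ (FreeMonoid.of (w[i], fun _ => true)) *
        (φ (FreeMonoid.map (fun c => (c, fun _ => false)) (FreeMonoid.ofList (w.drop (i + 1)))) *
          1))) then some w[i] else none).elim 0 (fun _ => 1) = if P w i then 1 else 0 := by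
    intro i
    have h₁ := h w (fun _ => i) fun _ => i.2
    rw [hS, hann, FreeMonoid.ofList_append, FreeMonoid.ofList_cons, map_mul, map_mul] at h₁
    rw [one_mul, mul_one]
    by_cases hP : P w i
    · rw [if_pos hP, if_pos]
      · rfl
      · exact h₁.1 hP
    · rw [if_neg hP, if_neg]
      · rfl
      · exact fun h₂ => hP (h₁.2 h₂)
  refine (Finset.sum_congr rfl fun i _ => key i).trans ?_
  rw [← Finset.card_filter, ← Set.ncard_coe_finset,
    ← Set.InjOn.ncard_image (f := fun i : Fin w.length => (i : ℕ)) Fin.val_injective.injOn]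
  congr 1
  ext i
  constructor
  · rintro ⟨j, hj, rfl⟩
    simp only [Finset.coe_filter, Finset.mem_univ, true_and] at hj
    exact ⟨j.2, hj⟩
  · rintro ⟨hi, hP⟩
    exact ⟨⟨i, hi⟩, by simpa using hP, rfl⟩

variable {A : Type u} {M : Type v} [Monoid M] {μ : FreeMonoid A →* M} {K : ℕ}

/-- The number of nodes with a regular property is the length of the image under a rational
function. -/
theorem NReg.exists_rational [Finite M] {P : Forest A → List ℕ → Prop}
    (h : NReg μ K 1 fun F _ x => P F (x 0)) :
    ∃ σ : List (Bracketed A) → List (Bracketed A), IsRational σ ∧ ∀ w,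
      (σ w).length = onForests μ K (fun F => {t | IsNode F t ∧ P F t}.ncard) w := by
  obtain ⟨R, hR, h⟩ := NReg.positions (n := 0) (P := fun F _ _ t => P F t) h
  -- Restricting to encodings of factorizations makes the image empty on all other words.
  have hR' : WReg 1 fun w x => R (w.map Sum.inl) Fin.elim0 (x 0) ∧
      Enc (fun F => F.IsFactorizationLE μ K) w :=
    ((hR.comap Sum.inl).congr fun w x _ =>
      iff_of_eq (congrArg (fun y => R (w.map Sum.inl) y (x 0)) (Subsingleton.elim _ _))).and
      (WReg.of_reg (Reg.isFactorizationLE μ K))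
  obtain ⟨σ, hσ, hlen⟩ := WReg.exists_rational (P := fun w i => R (w.map Sum.inl) Fin.elim0 i ∧
      Enc (fun F => F.IsFactorizationLE μ K) w) hR'
  refine ⟨σ, hσ, fun w => (hlen w).trans ?_⟩
  by_cases hw : ∃ F : Forest A, F.IsFactorizationLE μ K ∧ F.encode = w
  · obtain ⟨F, hF, rfl⟩ := hw
    have hm : mark F.encode ((∅ : Finset (List ℕ)).image (pos F)) = F.encode.map Sum.inl :=
      List.ext_getElem (by simp) fun i h₁ h₂ => by simp
    obtain ⟨h₁, h₂⟩ := h F ∅ Fin.elim0 hF (by simp) fun j => j.elim0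
    rw [hm, Subsingleton.elim (fun j : Fin 0 => pos F (Fin.elim0 j)) Fin.elim0] at h₁ h₂
    rw [onForests_encode μ K _ F hF, ← Set.InjOn.ncard_image (f := pos F) fun t ht s hs hts =>
      pos_injOn ht.1 hs.1 hts]
    congr 1
    ext i
    constructor
    · rintro ⟨hi, hi', -⟩
      obtain ⟨t, ht, rfl⟩ := h₂ i hi' hi
      exact ⟨t, ⟨ht, (h₁ t ht).2 hi'⟩, rfl⟩
    · rintro ⟨t, ⟨ht, hP⟩, rfl⟩
      exact ⟨ht.pos_lt, (h₁ t ht).1 hP, F, hF, rfl⟩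
  · rw [onForests, dif_neg hw, Set.ncard_eq_zero ((Set.finite_lt_nat w.length).subset
      fun i hi => hi.1)]
    ext i
    simp only [Set.mem_empty_iff_false, iff_false]
    rintro ⟨-, -, h⟩
    exact hw h

theorem setOf_nodesOfType (μ : FreeMonoid A →* M) (τ : NodeType A M) (F : Forest A) :
    {t | IsNode F t ∧ t ∈ nodesOfType μ τ F} = nodesOfType μ τ F := by
  ext t
  exact ⟨fun h => h.2, fun h => ⟨h.1.isNode, h⟩⟩

theorem NReg.mem_nodesOfType [Finite M] (τ : NodeType A M) {n : ℕ} (j : Fin n) :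
    NReg μ K n fun F _ x => x j ∈ nodesOfType μ τ F :=
  (NReg.isIterable j).and ((NReg.isInterior j).and (NReg.nodeType_eq τ j))

end PositionFilter

/-! ### Polyblind functions of the length -/

section LengthFunctions

variable {B : Type u}

theorem Reg.length_mod (N : ℕ) [NeZero N] (r : ℕ) : Reg fun w : List B => w.length % N = r % N := by
  let φ : FreeMonoid B →* Multiplicative (ZMod N) := FreeMonoid.lift fun _ => Multiplicative.ofAdd 1
  have hφ : ∀ w : List B, φ (FreeMonoid.ofList w) = Multiplicative.ofAdd (w.length : ZMod N) := by
    intro w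
    induction w with
    | nil => simp
    | cons b w ih =>
      rw [FreeMonoid.ofList_cons, map_mul, ih, List.length_cons, add_comm]
      simp only [φ, FreeMonoid.lift_eval_of, Nat.cast_add, Nat.cast_one, ofAdd_add]
  refine (Reg.of_hom φ fun x => x = Multiplicative.ofAdd (r : ZMod N)).congr fun w => ?_
  rw [hφ, Multiplicative.ofAdd.injective.eq_iff, ZMod.natCast_eq_natCast_iff']

variable (B) in
/-- The value at the length of a word is polyblind. -/
def LenBlind (p : ℕ → ℕ) : Prop := IsPolyblind fun w : List B => p w.length

theorem LenBlind.congr {p q : ℕ → ℕ} (hp : LenBlind B p) (h : ∀ n, p n = q n) : LenBlind B q := by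
  rwa [← show p = q from funext h]

theorem LenBlind.const (c : ℕ) : LenBlind B fun _ => c := IsPolyblind.const c

theorem LenBlind.add {p q : ℕ → ℕ} (hp : LenBlind B p) (hq : LenBlind B q) :
    LenBlind B fun n => p n + q n := IsPolyblind.add hp hq

theorem LenBlind.mul {p q : ℕ → ℕ} (hp : LenBlind B p) (hq : LenBlind B q) :
    LenBlind B fun n => p n * q n := IsPolyblind.mul hp hq

theorem LenBlind.sum {ι : Type*} {s : Finset ι} {p : ι → ℕ → ℕ} (h : ∀ i ∈ s, LenBlind B (p i)) :
    LenBlind B fun n => ∑ i ∈ s, p i n := by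
  classical
  induction s using Finset.induction_on with
  | empty => exact (LenBlind.const 0).congr fun n => by simp
  | insert i s hi ih =>
    refine ((h i (by simp)).add (ih fun j hj => h j (by simp [hj]))).congr fun n => ?_
    rw [Finset.sum_insert hi]

theorem LenBlind.prod {ι : Type*} {s : Finset ι} {p : ι → ℕ → ℕ} (h : ∀ i ∈ s, LenBlind B (p i)) :
    LenBlind B fun n => ∏ i ∈ s, p i n := by
  classical
  induction s using Finset.induction_on with
  | empty => exact (LenBlind.const 1).congr fun n => by simp
  | insert i s hi ih =>
    refine ((h i (by simp)).mul (ih fun j hj => h j (by simp [hj]))).congr fun n => ?_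
    rw [Finset.prod_insert hi]

theorem LenBlind.id : LenBlind B fun n => n :=
  ⟨1, le_rfl, _, isBlind_succ_iff.2 ⟨Unit, inferInstance, inferInstance, 1, fun _ _ _ _ => 1,
    fun _ _ _ => ⟨1, fun _ => rfl⟩, fun w => rfl⟩, fun w _ => by simp [splitSum]⟩

theorem LenBlind.mod (N : ℕ) [NeZero N] (g : ℕ → ℕ) : LenBlind B fun n => g (n % N) := by
  classical
  refine (LenBlind.sum (s := Finset.range N) (p := fun r n => if n % N = r % N then g r else 0)
    fun r _ => (IsPolyblind.indicator (Reg.length_mod N r) (g r)).congr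
      fun w _ => by dsimp only; split_ifs <;> rfl).congr fun n => ?_
  have hN := Nat.mod_lt n (Nat.pos_of_neZero N)
  rw [Finset.sum_eq_single (n % N)]
  · simp
  · intro r hr hne
    rw [Nat.mod_eq_of_lt (Finset.mem_range.1 hr), if_neg hne.symm]
  · intro h
    exact absurd (Finset.mem_range.2 hN) h

/-- The first letter is erased. Truncation matters only for the empty word, whose output is free. -/
theorem LenBlind.pred {p : ℕ → ℕ} (hp : LenBlind B p) : LenBlind B fun n => p (n - 1) := by
  obtain ⟨σ, hσ, h⟩ := WReg.exists_rational (C := B) (P := fun w i => ¬ w.take i = [])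
    (WReg.take Reg.eq_nil.not 0)
  refine (IsPolyblind.comp hp hσ).congr fun w hw => congrArg p ?_
  rw [h]
  have : {i | i < w.length ∧ ¬ w.take i = []} = ↑(Finset.Ico 1 w.length) := by
    ext i
    simp [hw]
    omega
  rw [this, Set.ncard_coe_finset, Nat.card_Ico]

theorem LenBlind.sub {p : ℕ → ℕ} (hp : LenBlind B p) (c : ℕ) : LenBlind B fun n => p (n - c) := by
  induction c with
  | zero => exact hp
  | succ c ih => exact ih.pred.congr fun n => by rw [Nat.sub_sub, add_comm 1 c]

theorem LenBlind.le (c : ℕ) : LenBlind B fun n => if c ≤ n then 1 else 0 := by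
  classical
  have h₁ : LenBlind B fun n => if n = 0 then 0 else 1 :=
    (IsPolyblind.indicator (Reg.eq_nil (B := B)).not 1).congr fun w _ => by
      simp only [List.length_eq_zero_iff]
      split_ifs <;> first | rfl | contradiction
  cases c with
  | zero => exact (LenBlind.const 1).congr fun n => by simp
  | succ c =>
    refine (h₁.sub c).congr fun n => ?_
    split_ifs <;> omega

/-- Keeping the last letter of every complete block of `N` letters divides the length by `N`. -/
theorem LenBlind.div {p : ℕ → ℕ} (hp : LenBlind B p) (N : ℕ) [NeZero N] :
    LenBlind B fun n => p (n / N) := by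
  obtain ⟨σ, hσ, h⟩ := WReg.exists_rational (C := B)
    (P := fun w i => (w.take i).length % N = (N - 1) % N) (WReg.take (Reg.length_mod N (N - 1)) 0)
  refine (IsPolyblind.comp hp hσ).congr fun w hw => congrArg p ?_
  have hN := Nat.pos_of_neZero N
  rw [h, ← Nat.card_multiples, ← Set.ncard_coe_finset]
  congr 1
  ext i
  simp only [Finset.coe_filter, Finset.mem_range]
  refine and_congr_right fun hi => ?_
  rw [List.length_take, min_eq_left (by omega), Nat.dvd_iff_mod_eq_zero]
  change i ≡ N - 1 [MOD N] ↔ i + 1 ≡ 0 [MOD N]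
  have e : (N - 1 + 1) ≡ 0 [MOD N] := by
    rw [Nat.sub_add_cancel hN]
    simp [Nat.ModEq]
  exact ⟨fun h => (h.add_right 1).trans e, fun h => Nat.ModEq.add_right_cancel' 1 (h.trans e.symm)⟩

/-- Binomial coefficients are sums of products of linear functions of the quotient and of functions
of the remainder modulo a factorial. -/
theorem LenBlind.choose (r : ℕ) : LenBlind B fun n => n.choose r := by
  have hN : NeZero r.factorial := ⟨Nat.factorial_ne_zero r⟩
  -- Truncated subtraction is written without subtraction from the variable product: it is 0 for q =
  -- 0, and r! - i plus r! (q - 1) for q ≥ 1.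
  have hlin : ∀ i ≤ r.factorial, LenBlind B fun q => r.factorial * q - i := by
    intro i hi
    refine (((LenBlind.le 1).mul (LenBlind.const (r.factorial - i))).add
      ((LenBlind.const r.factorial).mul LenBlind.id.pred)).congr fun q => ?_
    rcases q with _ | q
    · simp
    · have := Nat.zero_le (r.factorial * q)
      simp [Nat.mul_succ]
      omega
  -- In the falling factorial of r! q, the factor r! q itself absorbs the division by (j + 1)!,
  -- since that divides r!. The other factors are of the form treated in `hlin`.
  have hchoose : ∀ j ≤ r, LenBlind B fun q => (r.factorial * q).choose j := by
    intro j hj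
    rcases j with _ | j
    · exact (LenBlind.const 1).congr fun q => by simp
    · obtain ⟨c, hc⟩ := Nat.factorial_dvd_factorial hj
      refine ((LenBlind.prod (s := Finset.range j) fun i hi => hlin (i + 1) ?_).mul
        ((LenBlind.const c).mul LenBlind.id)).congr fun q => ?_
      · have := Finset.mem_range.1 hi
        have := Nat.self_le_factorial r
        omega
      · refine Nat.eq_of_mul_eq_mul_left (Nat.factorial_pos (j + 1)) ?_
        rw [← Nat.descFactorial_eq_factorial_mul_choose, Nat.descFactorial_eq_prod_range,
          Finset.prod_range_succ', Nat.sub_zero]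
        generalize ∏ i ∈ Finset.range j, (r.factorial * q - (i + 1)) = x
        rw [hc]
        ring
  -- Vandermonde's identity for n = r! (n / r!) + n % r!.
  refine (LenBlind.sum (s := Finset.HasAntidiagonal.antidiagonal r)
    (p := fun ij n => (r.factorial * (n / r.factorial)).choose ij.1 *
      (n % r.factorial).choose ij.2) fun ij hij => ?_).congr fun n => ?_
  · exact ((hchoose ij.1 (by have := Finset.HasAntidiagonal.mem_antidiagonal.1 hij; omega)).div r.factorial).mul
      (LenBlind.mod r.factorial fun s => s.choose ij.2)
  · rw [← Nat.add_choose_eq, Nat.div_add_mod]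

end LengthFunctions

/-! ### Sparse words -/

/-- The sets of `r` numbers below `X`, no two of which are consecutive. -/
def sparseSets (r X : ℕ) : Finset (Finset ℕ) :=
  ((Finset.range X).powersetCard r).filter fun S => ∀ i ∈ S, i + 1 ∉ S

theorem mem_sparseSets {r X : ℕ} {S : Finset ℕ} :
    S ∈ sparseSets r X ↔ (S ⊆ Finset.range X ∧ S.card = r) ∧ ∀ i ∈ S, i + 1 ∉ S := by
  rw [sparseSets, Finset.mem_filter, Finset.mem_powersetCard]

theorem sparseWords_eq_card (r X : ℕ) : sparseWords r X = (sparseSets r X).card := by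
  rw [sparseWords, Fintype.card_subtype]
  refine Finset.card_nbij' (fun s => (Finset.univ.filter fun i : Fin X => s i = true).map
    Fin.valEmbedding) (fun S i => decide ((i : ℕ) ∈ S)) ?_ ?_ ?_ ?_
  · intro s hs
    simp only [Finset.coe_filter, Finset.mem_univ, true_and, Set.mem_ofPred_eq] at hs
    rw [Finset.mem_coe, mem_sparseSets, Finset.card_map]
    refine ⟨⟨fun i hi => ?_, hs.1⟩, fun i hi hi' => ?_⟩
    · obtain ⟨j, -, rfl⟩ := Finset.mem_map.1 hi
      exact Finset.mem_range.2 j.2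
    · obtain ⟨j, hj, rfl⟩ := Finset.mem_map.1 hi
      obtain ⟨j', hj', h⟩ := Finset.mem_map.1 hi'
      exact hs.2 j j' h.symm ⟨(Finset.mem_filter.1 hj).2, (Finset.mem_filter.1 hj').2⟩
  · intro S hS
    obtain ⟨⟨hS, hr⟩, hsp⟩ := mem_sparseSets.1 hS
    simp only [Finset.coe_filter, Finset.mem_univ, true_and, Set.mem_ofPred_eq, decide_eq_true_eq]
    refine ⟨?_, fun i j hij h => hsp _ h.1 (hij ▸ h.2)⟩
    rw [← hr, ← Finset.card_map Fin.valEmbedding]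
    congr 1
    ext i
    simp only [Finset.mem_map, Finset.mem_filter, Finset.mem_univ, true_and]
    exact ⟨fun ⟨j, hj, h⟩ => h ▸ hj, fun h => ⟨⟨i, Finset.mem_range.1 (hS h)⟩, h, rfl⟩⟩
  · intro s hs
    funext i
    rw [Bool.eq_iff_iff]
    simp only [decide_eq_true_eq, Finset.mem_map, Finset.mem_filter, Finset.mem_univ, true_and]
    exact ⟨fun ⟨j, hj, h⟩ => Fin.ext h ▸ hj, fun h => ⟨i, h, rfl⟩⟩
  · intro S hS
    obtain ⟨⟨hS, hr⟩, hsp⟩ := mem_sparseSets.1 hS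
    ext i
    simp only [decide_eq_true_eq, Finset.mem_map, Finset.mem_filter, Finset.mem_univ, true_and]
    exact ⟨fun ⟨j, hj, h⟩ => h ▸ hj, fun h => ⟨⟨i, Finset.mem_range.1 (hS h)⟩, h, rfl⟩⟩

/-- Split by whether the last position X + 1 is chosen. If it is, X is not, and the remaining r
elements lie below X. -/
theorem card_sparseSets_succ (r X : ℕ) : (sparseSets (r + 1) (X + 2)).card =
    (sparseSets (r + 1) (X + 1)).card + (sparseSets r X).card := by
  have h₁ : (sparseSets (r + 1) (X + 2)).filter (fun S => ¬ X + 1 ∈ S) = sparseSets (r + 1) (X + 1) := by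
    ext S
    rw [Finset.mem_filter, mem_sparseSets, mem_sparseSets]
    constructor
    · rintro ⟨⟨⟨h₁, h₂⟩, h₃⟩, h₄⟩
      refine ⟨⟨fun i hi => ?_, h₂⟩, h₃⟩
      have := Finset.mem_range.1 (h₁ hi)
      have : i ≠ X + 1 := fun h => h₄ (h ▸ hi)
      exact Finset.mem_range.2 (by omega)
    · rintro ⟨⟨h₁, h₂⟩, h₃⟩
      refine ⟨⟨⟨h₁.trans (Finset.range_mono (by omega)), h₂⟩, h₃⟩, fun h => ?_⟩
      have := Finset.mem_range.1 (h₁ h)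
      omega
  have h₂ : ((sparseSets (r + 1) (X + 2)).filter fun S => X + 1 ∈ S).card =
      (sparseSets r X).card := by
    refine Finset.card_nbij' (fun S => S.erase (X + 1)) (fun S => insert (X + 1) S) ?_ ?_ ?_ ?_
    · intro S hS
      rw [Finset.mem_coe, Finset.mem_filter, mem_sparseSets] at hS
      obtain ⟨⟨⟨h₁, h₂⟩, h₃⟩, h₄⟩ := hS
      rw [Finset.mem_coe, mem_sparseSets]
      refine ⟨⟨fun i hi => ?_, by rw [Finset.card_erase_of_mem h₄, h₂]; rfl⟩,
        fun i hi hi' => h₃ i (Finset.mem_of_mem_erase hi) (Finset.mem_of_mem_erase hi')⟩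
      obtain ⟨hne, hi⟩ := Finset.mem_erase.1 hi
      have := Finset.mem_range.1 (h₁ hi)
      have : i ≠ X := fun h => h₃ i hi (h ▸ h₄)
      exact Finset.mem_range.2 (by omega)
    · intro S hS
      rw [Finset.mem_coe, mem_sparseSets] at hS
      obtain ⟨⟨h₁, h₂⟩, h₃⟩ := hS
      rw [Finset.mem_coe, Finset.mem_filter, mem_sparseSets]
      have hn : X + 1 ∉ S := fun h => by have := Finset.mem_range.1 (h₁ h); omega
      refine ⟨⟨⟨fun i hi => ?_, by rw [Finset.card_insert_of_notMem hn, h₂]⟩, fun i hi hi' => ?_⟩,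
        Finset.mem_insert_self _ _⟩
      · rcases Finset.mem_insert.1 hi with rfl | hi
        · exact Finset.mem_range.2 (by omega)
        · have := Finset.mem_range.1 (h₁ hi)
          exact Finset.mem_range.2 (by omega)
      · rcases Finset.mem_insert.1 hi with rfl | hi <;> rcases Finset.mem_insert.1 hi' with h | hi'
        · omega
        · have := Finset.mem_range.1 (h₁ hi')
          omega
        · have := Finset.mem_range.1 (h₁ hi)
          omega
        · exact h₃ i hi hi'
    · intro S hS
      exact Finset.insert_erase (Finset.mem_filter.1 hS).2
    · intro S hS
      refine Finset.erase_insert fun h => ?_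
      have := Finset.mem_range.1 ((mem_sparseSets.1 hS).1.1 h)
      omega
  rw [← Finset.card_filter_add_card_filter_not (s := sparseSets (r + 1) (X + 2))
    (fun S => X + 1 ∈ S), h₁, h₂, add_comm]

/-- The recursion of `card_sparseSets_succ` is Pascal's rule. The formula survives truncation: for r
> X + 1 it reads 0 over r with r > 0. -/
theorem card_sparseSets : ∀ X r : ℕ, (sparseSets r X).card = (X + 1 - r).choose r
  | X, 0 => by
    have : sparseSets 0 X = {∅} := by
      ext S
      simp only [mem_sparseSets, Finset.card_eq_zero, Finset.mem_singleton]
      exact ⟨fun h => h.1.2, fun h => by simp [h]⟩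
    simp [this]
  | 0, r + 1 => by
    have : sparseSets (r + 1) 0 = ∅ := by
      simp [sparseSets, Finset.filter_eq_empty_iff]
    simp [this]
  | 1, r + 1 => by
    rcases r with _ | r
    · decide
    · have : sparseSets (r + 1 + 1) 1 = ∅ := by
        rw [sparseSets, Finset.powersetCard_eq_empty.2 (by simp), Finset.filter_empty]
      simp [this]
  | X + 2, r + 1 => by
    rw [card_sparseSets_succ, card_sparseSets (X + 1), card_sparseSets X r]
    by_cases h : r ≤ X + 1
    · rw [show X + 2 + 1 - (r + 1) = (X + 1 - r) + 1 by omega,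
        show X + 1 + 1 - (r + 1) = X + 1 - r by omega, Nat.choose_succ_succ, add_comm]
    · rw [show X + 2 + 1 - (r + 1) = 0 by omega, show X + 1 + 1 - (r + 1) = 0 by omega,
        show X + 1 - r = 0 by omega, Nat.choose_eq_zero_of_lt (by omega : 0 < r)]
      simp

theorem sparseWords_eq (r X : ℕ) : sparseWords r X = (X + 1 - r).choose r := by
  rw [sparseWords_eq_card, card_sparseSets]

/-! ### The sparse factor as a polyblind function -/

section SparseFactor

open Forest Bracketed

variable {A : Type u} {M : Type v} [Monoid M] [Finite M]

/-- |A(F)| is the length of a rational image. Words that encode no factorization have an empty image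
and fail the threshold since r > 0. With X = |A(F)| - 3k₁, the number X + 1 - r becomes one
truncated subtraction. -/
theorem exists_sparseFactor_eq (μ : FreeMonoid A →* M) (K : ℕ) (τ : NodeType A M) {r : ℕ}
    (hr : 0 < r) (k₁ : ℕ) : ∃ σ : List (Bracketed A) → List (Bracketed A), IsRational σ ∧
      ∀ w, sparseFactor μ K τ r k₁ w = if 3 * k₁ + 2 * r ≤ (σ w).length then
        ((σ w).length - (3 * k₁ + (r - 1))).choose r else 0 := by
  obtain ⟨σ, hσ, h⟩ := NReg.exists_rational (NReg.mem_nodesOfType (μ := μ) (K := K) τ (0 : Fin 1))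
  refine ⟨σ, hσ, fun w => ?_⟩
  simp only [h, setOf_nodesOfType]
  unfold sparseFactor onForests
  by_cases hw : ∃ F : Forest A, F.IsFactorizationLE μ K ∧ F.encode = w
  · simp only [dif_pos hw]
    split_ifs with h₂
    · rw [sparseWords_eq]
      congr 1
      omega
    · rfl
  · simp only [dif_neg hw]
    rw [if_neg (by omega)]

theorem isPolyblind_sparseFactor (μ : FreeMonoid A →* M) (K : ℕ) (τ : NodeType A M) {r : ℕ}
    (hr : 0 < r) (k₁ : ℕ) : IsPolyblind (sparseFactor μ K τ r k₁) := by
  obtain ⟨σ, hσ, h⟩ := exists_sparseFactor_eq μ K τ hr k₁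
  have hp : LenBlind (Bracketed A) fun n => if 3 * k₁ + 2 * r ≤ n then
      (n - (3 * k₁ + (r - 1))).choose r else 0 :=
    ((LenBlind.le (3 * k₁ + 2 * r)).mul ((LenBlind.choose r).sub (3 * k₁ + (r - 1)))).congr
      fun n => by split_ifs <;> simp
  exact (IsPolyblind.comp hp hσ).congr fun w _ => (h w).symm

theorem hasGrowth_sparseFactor (μ : FreeMonoid A →* M) (K : ℕ) (τ : NodeType A M) {r : ℕ}
    (hr : 0 < r) (k₁ : ℕ) : HasGrowth (sparseFactor μ K τ r k₁) r := by
  obtain ⟨σ, hσ, h⟩ := exists_sparseFactor_eq μ K τ hr k₁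
  refine ⟨1, fun w _ => ?_⟩
  rw [h, one_mul]
  split_ifs
  · exact (Nat.choose_le_pow _ _).trans (Nat.pow_le_pow_left
      ((Nat.sub_le _ _).trans (hσ.length_le w)) r)
  · exact Nat.zero_le _

end SparseFactor

/-- The elements of `S` are among the first `X` elements of `D`, and no two of them are consecutive
in `D`. -/
def IsSparseIn (D : Finset ℕ) (X : ℕ) (S : Finset ℕ) : Prop :=
  (∀ s ∈ S, (D.filter (· < s)).card < X) ∧
    ∀ s ∈ S, ∀ s' ∈ S, s < s' → ∃ x ∈ D, s < x ∧ x < s'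

open Classical in
/-- In a finite set `D` of numbers, the sets of `r` elements among the first `X` ones, no two of
which are consecutive in `D`, are counted by sparse words. -/
theorem card_sparse_subsets (D : Finset ℕ) {X : ℕ} (hX : X ≤ D.card) (r : ℕ) :
    ((D.powersetCard r).filter (IsSparseIn D X)).card = sparseWords r X := by
  rw [sparseWords_eq_card]
  -- The rank of an element in `D` translates sparse subsets of `D` into sparse sets of ranks.
  set idx : ℕ → ℕ := fun s => (D.filter (· < s)).card with hidx
  have hmono : ∀ s ∈ D, ∀ s', s < s' → idx s < idx s' := by
    intro s hs s' h
    refine Finset.card_lt_card ⟨fun x hx => ?_, fun h' => ?_⟩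
    · rw [Finset.mem_filter] at hx ⊢
      exact ⟨hx.1, hx.2.trans h⟩
    · have := Finset.mem_filter.1 (h' (Finset.mem_filter.2 ⟨hs, h⟩))
      omega
  have hmono' : ∀ s, ∀ s' ∈ D, idx s < idx s' → s < s' := by
    intro s s' hs' h
    by_contra hn
    rcases (not_lt.1 hn).eq_or_lt with rfl | h'
    · omega
    · have := hmono s' hs' s h'
      omega
  have hinj : Set.InjOn idx D := by
    intro s hs s' hs' h
    rcases lt_trichotomy s s' with h' | h' | h'
    · have := hmono s hs s' h'; omega
    · exact h'
    · have := hmono s' hs' s h'; omega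
  have himage : D.image idx = Finset.range D.card := by
    refine Finset.eq_of_subset_of_card_le (fun i hi => ?_) ?_
    · obtain ⟨s, hs, rfl⟩ := Finset.mem_image.1 hi
      refine Finset.mem_range.2 (Finset.card_lt_card ⟨Finset.filter_subset _ _, fun h => ?_⟩)
      have := (Finset.mem_filter.1 (h hs)).2
      omega
    · rw [Finset.card_range, Finset.card_image_of_injOn hinj]
  refine Finset.card_nbij (fun S => S.image idx) ?_ ?_ ?_
  · intro S hS
    simp only [Finset.coe_filter, Finset.mem_powersetCard] at hS
    obtain ⟨⟨hS, hr⟩, h₁, h₂⟩ := hS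
    rw [Finset.mem_coe, mem_sparseSets, Finset.card_image_of_injOn (hinj.mono hS)]
    refine ⟨⟨fun i hi => ?_, hr⟩, fun i hi hi' => ?_⟩
    · obtain ⟨s, hs, rfl⟩ := Finset.mem_image.1 hi
      exact Finset.mem_range.2 (h₁ s hs)
    · obtain ⟨s, hs, rfl⟩ := Finset.mem_image.1 hi
      obtain ⟨s', hs', h⟩ := Finset.mem_image.1 hi'
      obtain ⟨x, hx, hlt, hlt'⟩ := h₂ s hs s' hs' (hmono' _ _ (hS hs') (by omega))
      have := hmono s (hS hs) x hlt
      have := hmono x hx s' hlt'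
      omega
  · intro S hS S' hS' h
    simp only [Finset.coe_filter, Finset.mem_powersetCard] at hS hS'
    exact (Finset.image_injOn_powerset_of_injOn hinj) (Finset.mem_coe.2 (Finset.mem_powerset.2 hS.1.1))
      (Finset.mem_coe.2 (Finset.mem_powerset.2 hS'.1.1)) h
  · intro S' hS'
    obtain ⟨⟨hS', hr⟩, hsp⟩ := mem_sparseSets.1 hS'
    have hsub : S' ⊆ D.image idx := by
      rw [himage]
      exact hS'.trans (Finset.range_mono hX)
    obtain ⟨S, hS, rfl⟩ := Finset.subset_image_iff.1 hsub
    rw [Finset.card_image_of_injOn (hinj.mono hS)] at hr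
    refine ⟨S, ?_, rfl⟩
    simp only [Finset.coe_filter, Finset.mem_powersetCard]
    refine ⟨⟨hS, hr⟩, fun s hs => Finset.mem_range.1 (hS' (Finset.mem_image_of_mem _ hs)),
      fun s hs s' hs' hlt => ?_⟩
    have h₁ := hmono s (hS hs) s' hlt
    have h₂ : idx s + 1 ≠ idx s' := fun h =>
      hsp _ (Finset.mem_image_of_mem _ hs) (h ▸ Finset.mem_image_of_mem _ hs')
    have h₃ := Finset.mem_range.1 (hS' (Finset.mem_image_of_mem idx hs'))
    -- The ranks fill an initial segment, so the element ranked just after `s` exists; as the rank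
    -- of `s'` is larger still, it lies strictly in between.
    have h₄ : idx s + 1 ∈ D.image idx := by
      rw [himage, Finset.mem_range]
      omega
    obtain ⟨x, hx, h⟩ := Finset.mem_image.1 h₄
    exact ⟨x, hx, hmono' _ _ hx (by omega), hmono' _ _ (hS hs') (by omega)⟩

/-- Sets of `k + 1` elements one of which is determined by the others up to `c` possibilities. -/
theorem card_le_of_exists_erase {α : Type*} [DecidableEq α] {N : Finset α} {k c : ℕ} (C : Finset α → Finset α)
    (hC : ∀ U, U.card = k → (C U).card ≤ c) {X : Finset (Finset α)}
    (h : ∀ T ∈ X, T ⊆ N ∧ T.card = k + 1 ∧ ∃ x ∈ T, x ∈ C (T.erase x)) :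
    X.card ≤ c * N.card ^ k := by
  have hsub : X ⊆ (N.powersetCard k).biUnion fun U => (C U).image (insert · U) := by
    intro T hT
    obtain ⟨h₁, h₂, x, hx, h₃⟩ := h T hT
    refine Finset.mem_biUnion.2 ⟨T.erase x, Finset.mem_powersetCard.2
      ⟨(Finset.erase_subset _ _).trans h₁, by rw [Finset.card_erase_of_mem hx, h₂]; rfl⟩, ?_⟩
    exact Finset.mem_image.2 ⟨x, h₃, Finset.insert_erase hx⟩
  refine (Finset.card_le_card hsub).trans ((Finset.card_biUnion_le_card_mul _ _ c fun U hU =>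
    Finset.card_image_le.trans (hC U (Finset.mem_powersetCard.1 hU).2)).trans ?_)
  rw [Finset.card_powersetCard, mul_comm]
  exact Nat.mul_le_mul_left _ (Nat.choose_le_pow _ _)

/-! ### Free nodes and spread sets -/

section Spread

open Forest Bracketed

variable {A : Type u} {M : Type v} [Monoid M]

/-- The matching closing bracket lies in the allowed range but is not an opening bracket, so the
position falls inside the encoding of `G`. -/
theorem NodeAt.exists_append {F G : Forest A} {t s : List ℕ} {pre post : List (Bracketed A)}
    (h : NodeAt F t pre G post) (hs : IsNode F s) (h₁ : pos F t < pos F s)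
    (h₂ : pos F s < pre.length + 1 + G.encode.length + 1) : ∃ q, q ≠ [] ∧ s = t ++ q := by
  have h₃ := hs.getElem?_pos
  obtain ⟨pre', H, post', h'⟩ := hs
  rw [h.pos_eq, h'.pos_eq] at h₁
  rw [h'.pos_eq] at h₂ h₃
  rw [h.encode_eq, List.getElem?_append_right (by omega)] at h₃
  obtain ⟨d, hd⟩ : ∃ d, pre'.length - pre.length = d + 1 :=
    ⟨pre'.length - pre.length - 1, by omega⟩
  rw [hd, List.getElem?_cons_succ] at h₃
  have hlt : d < G.encode.length := by
    by_contra hn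
    rw [show d = G.encode.length by omega] at h₃
    simp at h₃
  rw [List.getElem?_append_left hlt] at h₃
  obtain ⟨q, ⟨pre'', G'', post'', hn⟩, hq⟩ := exists_pos_eq h₃
  rw [hn.pos_eq] at hq
  exact ⟨q, hn.ne_nil, ((h.trans hn).path_eq h' (by simp; omega)).symm⟩

/-- Between adjacent siblings there is no node of the same depth. -/
theorem Next.pos_lt {F : Forest A} {s t : List ℕ} (hst : Next s t) (ht : IsNode F t) :
    pos F s < pos F t ∧
      ∀ x, IsNode F x → x.length = s.length → ¬ (pos F s < pos F x ∧ pos F x < pos F t) := by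
  obtain ⟨q, i, rfl, rfl⟩ := hst
  obtain ⟨pre, G, post, ht⟩ := ht
  obtain ⟨pre', G', hs, rfl⟩ := ht.prev
  rw [ht.pos_eq]
  refine ⟨by rw [hs.pos_eq]; simp, fun x hx hlen ⟨h₁, h₂⟩ => ?_⟩
  obtain ⟨p, hp, rfl⟩ := hs.exists_append hx h₁ (by simp at h₂; omega)
  simp at hlen
  exact hp hlen

open Classical in
/-- The non-root nodes of a forest. -/
noncomputable def nodeFinset (F : Forest A) : Finset (List ℕ) := (finite_isNode F).toFinset

@[simp] theorem mem_nodeFinset {F : Forest A} {t : List ℕ} : t ∈ nodeFinset F ↔ IsNode F t := by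
  simp [nodeFinset]

theorem card_nodeFinset_le (F : Forest A) : (nodeFinset F).card ≤ F.encode.length := by
  rw [← Finset.card_range F.encode.length]
  refine Finset.card_le_card_of_injOn (pos F) (fun t ht => ?_) fun t ht s hs h => ?_
  · simpa using (mem_nodeFinset.1 ht).pos_lt
  · exact pos_injOn (mem_nodeFinset.1 ht) (mem_nodeFinset.1 hs) h

variable (μ : FreeMonoid A →* M) (τ : NodeType A M)

open Classical in
/-- The interior iterable nodes of type `τ`, as a finite set. -/
noncomputable def typedNodes (F : Forest A) : Finset (List ℕ) :=
  (nodeFinset F).filter fun t => t ∈ nodesOfType μ τ F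

variable {μ τ}

open Classical in
theorem mem_typedNodes {F : Forest A} {t : List ℕ} :
    t ∈ typedNodes μ τ F ↔ t ∈ nodesOfType μ τ F := by
  rw [typedNodes, Finset.mem_filter, mem_nodeFinset]
  exact ⟨fun h => h.2, fun h => ⟨h.1.isNode, h⟩⟩

theorem isNode_of_mem_typedNodes {F : Forest A} {t : List ℕ} (h : t ∈ typedNodes μ τ F) :
    IsNode F t := (mem_typedNodes.1 h).1.isNode

theorem length_of_mem_typedNodes {F : Forest A} {t : List ℕ} (h : t ∈ typedNodes μ τ F) :
    t.length = τ.2 := congrArg Prod.snd (mem_typedNodes.1 h).2.2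

theorem card_typedNodes (F : Forest A) :
    (typedNodes μ τ F).card = (nodesOfType μ τ F).ncard := by
  rw [← Set.ncard_coe_finset]
  congr 1
  ext t
  exact mem_typedNodes

variable (μ τ)

open Classical in
/-- The interior iterable nodes of type `τ` that may be added to `T`. -/
noncomputable def freeNodes (F : Forest A) (T : Finset (List ℕ)) : Finset (List ℕ) :=
  (typedNodes μ τ F).filter fun a => ∀ t ∈ T, ¬ Observes t a ∧ ¬ Observes a t

open Classical in
/-- The nodes of type `τ` in `T` can be chosen like the ones in a sparse word, once the other
nodes in `T` are known. -/
def IsSpread (r k₁ : ℕ) (F : Forest A) (T : Finset (List ℕ)) : Prop :=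
  3 * k₁ + 2 * r ≤ (typedNodes μ τ F).card ∧
  (∀ s ∈ T, s ∈ typedNodes μ τ F → 3 * k₁ < ((typedNodes μ τ F).filter fun x =>
    x ∉ freeNodes μ τ F (T.filter fun t => t ∉ typedNodes μ τ F) ∨ pos F s ≤ pos F x).card) ∧
  ∀ s ∈ T, ∀ s' ∈ T, s ∈ typedNodes μ τ F → s' ∈ typedNodes μ τ F → pos F s < pos F s' →
    ∃ x ∈ freeNodes μ τ F (T.filter fun t => t ∉ typedNodes μ τ F),
      pos F s < pos F x ∧ pos F x < pos F s'

/-- The independent sets of interior nodes that have given types. -/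
def typedSets (F : Forest A) (𝕋 : Multiset (NodeType A M)) : Set (Finset (List ℕ)) :=
  {T | F.IsIndependent 𝕋.card T ∧ (∀ t ∈ T, IsInterior F t) ∧ F.types μ T = 𝕋}

variable {μ τ}

open Classical in
theorem freeNodes_subset (F : Forest A) (T : Finset (List ℕ)) :
    freeNodes μ τ F T ⊆ typedNodes μ τ F := Finset.filter_subset _ _

theorem finite_typedSets (F : Forest A) (𝕋 : Multiset (NodeType A M)) :
    (typedSets μ F 𝕋).Finite :=
  (nodeFinset F).powerset.finite_toSet.subset fun _ hT => Finset.mem_coe.2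
    (Finset.mem_powerset.2 fun t ht => mem_nodeFinset.2 (hT.1.2.1 t ht).isNode)

/-- A node and its two neighbours. For `i = 0` the truncated `i - 1` only repeats an element. -/
theorem exists_near (p : List ℕ) : ∃ S : Finset (List ℕ), S.card ≤ 3 ∧
    ∀ a, a = p ∨ Next p a ∨ Next a p → a ∈ S := by
  rcases List.eq_nil_or_concat p with rfl | ⟨q, i, rfl⟩
  · refine ⟨{[]}, by simp, ?_⟩
    rintro a (rfl | ⟨q, i, h, -⟩ | ⟨q, i, -, h⟩)
    · simp
    · simp at h
    · simp at h
  · refine ⟨{q ++ [i], q ++ [i + 1], q ++ [i - 1]}, Finset.card_le_three, ?_⟩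
    rintro a (rfl | ⟨q', j, h, rfl⟩ | ⟨q', j, rfl, h⟩)
    · simp
    · rw [List.concat_eq_append] at h
      obtain ⟨rfl, h'⟩ := List.append_inj' h rfl
      simp [List.singleton_inj.1 h']
    · rw [List.concat_eq_append] at h
      obtain ⟨rfl, h'⟩ := List.append_inj' h rfl
      simp [List.singleton_inj.1 h']

/-- A node is near few nodes that are not deeper. -/
theorem near_of_observes {a t : List ℕ} (hlen : a.length ≤ t.length)
    (h : Observes t a ∨ Observes a t) :
    a = t.take a.length ∨ Next (t.take a.length) a ∨ Next a (t.take a.length) := by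
  rcases h with (h | ⟨q, i, ⟨h, rfl⟩ | ⟨h, rfl⟩⟩) | (h | ⟨q, i, ⟨h, rfl⟩ | ⟨h, rfl⟩⟩)
  · exact Or.inl (List.prefix_iff_eq_take.1 h)
  · refine Or.inr (Or.inr ⟨q, i, rfl, ?_⟩)
    rw [List.prefix_iff_eq_take] at h
    rw [h]
    simp
  · refine Or.inr (Or.inl ⟨q, i, ?_, rfl⟩)
    rw [List.prefix_iff_eq_take] at h
    rw [h]
    simp
  · have := h.eq_of_length (le_antisymm h.length_le hlen)
    subst this
    simp
  · have := h.eq_of_length (le_antisymm h.length_le (by simpa using hlen))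
    subst this
    exact Or.inr (Or.inl ⟨q, i, by simp, rfl⟩)
  · have := h.eq_of_length (le_antisymm h.length_le (by simpa using hlen))
    subst this
    exact Or.inr (Or.inr ⟨q, i, rfl, by simp⟩)

open Classical in
-- A node that is no shallower than τ blocks at most three nodes of type τ: its ancestor at the
-- depth of τ and the two neighbours of that ancestor. This is the origin of the constant 3k₁.
theorem card_typedNodes_le (F : Forest A) (T : Finset (List ℕ)) (hT : ∀ t ∈ T, τ.2 ≤ t.length) :
    (typedNodes μ τ F).card ≤ (freeNodes μ τ F T).card + 3 * T.card := by
  choose S hS hS' using exists_near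
  have hsub : typedNodes μ τ F ⊆ freeNodes μ τ F T ∪ T.biUnion fun t => S (t.take τ.2) := by
    intro a ha
    by_cases hf : a ∈ freeNodes μ τ F T
    · exact Finset.mem_union_left _ hf
    · rw [freeNodes, Finset.mem_filter] at hf
      push Not at hf
      obtain ⟨t, ht, h⟩ := hf ha
      refine Finset.mem_union_right _ (Finset.mem_biUnion.2 ⟨t, ht, hS' _ _ ?_⟩)
      have hlen := length_of_mem_typedNodes ha
      rw [← hlen]
      refine near_of_observes (hlen.le.trans (hT t ht)) ?_
      by_contra hn
      push Not at hn
      exact hn.2 (h hn.1)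
  refine (Finset.card_le_card hsub).trans ((Finset.card_union_le _ _).trans
    (Nat.add_le_add_left ?_ _))
  rw [mul_comm]
  exact Finset.card_biUnion_le_card_mul _ _ _ fun t _ => hS _

/-- Among nodes of equal depth, observing means being equal or adjacent siblings. No node of that
depth lies between adjacent siblings, so a separating element of `D` excludes the conflict. -/
theorem not_observes_of_sparse {F : Forest A} {D : Finset (List ℕ)} {s t : List ℕ}
    (hs : s ∈ typedNodes μ τ F) (ht : t ∈ typedNodes μ τ F)
    (hD : ∀ x ∈ D, x ∈ typedNodes μ τ F)
    (h₁ : pos F s < pos F t → ∃ x ∈ D, pos F s < pos F x ∧ pos F x < pos F t)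
    (h₂ : pos F t < pos F s → ∃ x ∈ D, pos F t < pos F x ∧ pos F x < pos F s) (hne : t ≠ s) :
    ¬ Observes t s := by
  intro h
  have hs' := length_of_mem_typedNodes hs
  have ht' := length_of_mem_typedNodes ht
  have key := near_of_observes (hs'.trans ht'.symm).le (Or.inl h)
  rw [hs', ← ht', List.take_length] at key
  rcases key with rfl | h | h
  · exact hne rfl
  · obtain ⟨hlt, hn⟩ := h.pos_lt (isNode_of_mem_typedNodes hs)
    obtain ⟨x, hx, h⟩ := h₂ hlt
    exact hn x (isNode_of_mem_typedNodes (hD x hx))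
      ((length_of_mem_typedNodes (hD x hx)).trans ht'.symm) h
  · obtain ⟨hlt, hn⟩ := h.pos_lt (isNode_of_mem_typedNodes ht)
    obtain ⟨x, hx, h⟩ := h₁ hlt
    exact hn x (isNode_of_mem_typedNodes (hD x hx))
      ((length_of_mem_typedNodes (hD x hx)).trans hs'.symm) h

variable {𝕋₁ : Multiset (NodeType A M)} {r : ℕ} {F : Forest A}

theorem mem_typedNodes_iff {𝕋 : Multiset (NodeType A M)} {T : Finset (List ℕ)}
    (hT : T ∈ typedSets μ F 𝕋) {t : List ℕ} (ht : t ∈ T) :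
    t ∈ typedNodes μ τ F ↔ F.nodeType μ t = τ := by
  rw [mem_typedNodes]
  exact ⟨fun h => h.2.2, fun h => ⟨hT.1.2.1 t ht, hT.2.1 t ht, h⟩⟩

open Classical in
-- As τ does not occur in 𝕋₁, the nodes of other types carry exactly 𝕋₁, which leaves r nodes of
-- type τ.
theorem filter_mem_typedSets (hτ : τ ∉ 𝕋₁) {T : Finset (List ℕ)}
    (hT : T ∈ typedSets μ F (𝕋₁ + Multiset.replicate r τ)) :
    (T.filter fun t => t ∉ typedNodes μ τ F) ∈ typedSets μ F 𝕋₁ ∧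
      (T.filter fun t => t ∈ typedNodes μ τ F).card = r := by
  have htypes : F.types μ (T.filter fun t => t ∉ typedNodes μ τ F) = 𝕋₁ := by
    have h₁ : (T.filter fun t => t ∉ typedNodes μ τ F) = T.filter fun t => F.nodeType μ t ≠ τ :=
      Finset.filter_congr fun t ht => not_congr (mem_typedNodes_iff hT ht)
    have h₂ : F.types μ (T.filter fun t => F.nodeType μ t ≠ τ) =
        (F.types μ T).filter fun σ => σ ≠ τ := by
      rw [types, types, Finset.filter_val, Multiset.filter_map]
      rfl
    rw [h₁, h₂, hT.2.2, Multiset.filter_add, Multiset.filter_eq_self.2, Multiset.filter_eq_nil.2,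
      add_zero]
    · intro σ hσ
      simp [Multiset.eq_of_mem_replicate hσ]
    · intro σ hσ h
      exact hτ (h ▸ hσ)
  have hcard : (T.filter fun t => t ∉ typedNodes μ τ F).card = 𝕋₁.card := by
    rw [← htypes, types, Multiset.card_map]
    rfl
  refine ⟨⟨⟨hcard, fun t ht => hT.1.2.1 t (Finset.mem_of_mem_filter t ht), fun t ht s hs =>
    hT.1.2.2 t (Finset.mem_of_mem_filter t ht) s (Finset.mem_of_mem_filter s hs)⟩,
    fun t ht => hT.2.1 t (Finset.mem_of_mem_filter t ht), htypes⟩, ?_⟩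
  have h₁ := Finset.card_filter_add_card_filter_not (s := T) fun t => t ∈ typedNodes μ τ F
  have h₂ := hT.1.1
  rw [Multiset.card_add, Multiset.card_replicate] at h₂
  omega

end Spread

/-! ### Counting spread sets and bounding the number of the others -/

section SpreadCount

open Forest Bracketed

variable {A : Type u} {M : Type v} [Monoid M] {μ : FreeMonoid A →* M} {τ : NodeType A M}
  {𝕋₁ : Multiset (NodeType A M)} {r : ℕ} {F : Forest A}

theorem depth_le_of_mem_typedSets (hd : ∀ σ ∈ 𝕋₁, τ.2 ≤ σ.2) {T : Finset (List ℕ)}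
    (hT : T ∈ typedSets μ F 𝕋₁) {t : List ℕ} (ht : t ∈ T) : τ.2 ≤ t.length := by
  have : F.nodeType μ t ∈ 𝕋₁ := by
    rw [← hT.2.2]
    exact Multiset.mem_map_of_mem _ ht
  exact hd _ this

theorem notMem_typedNodes (hτ : τ ∉ 𝕋₁) {T : Finset (List ℕ)} (hT : T ∈ typedSets μ F 𝕋₁)
    {t : List ℕ} (ht : t ∈ T) : t ∉ typedNodes μ τ F := by
  rw [mem_typedNodes_iff hT ht]
  rintro h
  refine hτ ?_
  rw [← hT.2.2, ← h]
  exact Multiset.mem_map_of_mem _ ht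

open Classical in
-- Conflicts between `T₁` and `S` are excluded by freeness, conflicts inside `S` by the separating
-- free nodes.
theorem union_mem_typedSets (hτ : τ ∉ 𝕋₁) {T₁ S : Finset (List ℕ)} (hT₁ : T₁ ∈ typedSets μ F 𝕋₁)
    (hS : S ⊆ freeNodes μ τ F T₁) (hr : S.card = r)
    (hsp : ∀ s ∈ S, ∀ s' ∈ S, pos F s < pos F s' →
      ∃ x ∈ freeNodes μ τ F T₁, pos F s < pos F x ∧ pos F x < pos F s') :
    T₁ ∪ S ∈ typedSets μ F (𝕋₁ + Multiset.replicate r τ) := by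
  have hS' := hS.trans (freeNodes_subset F T₁)
  have hdisj : Disjoint T₁ S :=
    Finset.disjoint_left.2 fun t ht hs => notMem_typedNodes hτ hT₁ ht (hS' hs)
  have hn : ∀ s ∈ S, s ∈ nodesOfType μ τ F := fun s hs => mem_typedNodes.1 (hS' hs)
  refine ⟨⟨?_, ?_, ?_⟩, ?_, ?_⟩
  · rw [Finset.card_union_of_disjoint hdisj, hT₁.1.1, hr, Multiset.card_add,
      Multiset.card_replicate]
  · intro t ht
    rcases Finset.mem_union.1 ht with ht | ht
    · exact hT₁.1.2.1 t ht
    · exact (hn t ht).1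
  · intro t ht s hs hne
    rcases Finset.mem_union.1 ht with ht | ht <;> rcases Finset.mem_union.1 hs with hs | hs
    · exact hT₁.1.2.2 t ht s hs hne
    · exact ((Finset.mem_filter.1 (hS hs)).2 t ht).1
    · exact ((Finset.mem_filter.1 (hS ht)).2 s hs).2
    · exact not_observes_of_sparse (hS' hs) (hS' ht) (fun x hx => freeNodes_subset F T₁ hx)
        (hsp s hs t ht) (hsp t ht s hs) hne
  · intro t ht
    rcases Finset.mem_union.1 ht with ht | ht
    · exact hT₁.2.1 t ht
    · exact (hn t ht).2.1
  · rw [← Finset.disjUnion_eq_union _ _ hdisj, types, Finset.disjUnion_val, Multiset.map_add]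
    refine congrArg₂ _ hT₁.2.2 ?_
    rw [← hr]
    exact Multiset.eq_replicate.2 ⟨Multiset.card_map _ _, fun σ hσ => by
      obtain ⟨t, ht, rfl⟩ := Multiset.mem_map.1 hσ
      exact (hn t ht).2.2⟩

open Classical in
/-- The spread sets that extend a given set correspond to sparse sets. -/
theorem card_fiber (hτ : τ ∉ 𝕋₁) (hd : ∀ σ ∈ 𝕋₁, τ.2 ≤ σ.2)
    (hA : 3 * 𝕋₁.card + 2 * r ≤ (typedNodes μ τ F).card) {T₁ : Finset (List ℕ)}
    (hT₁ : T₁ ∈ typedSets μ F 𝕋₁) {G : Finset (Finset (List ℕ))}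
    (hG : ∀ T, T ∈ G ↔ T ∈ typedSets μ F (𝕋₁ + Multiset.replicate r τ) ∧
      IsSpread μ τ r 𝕋₁.card F T) :
    (G.filter fun T => (T.filter fun t => t ∉ typedNodes μ τ F) = T₁).card =
      sparseWords r ((typedNodes μ τ F).card - 3 * 𝕋₁.card) := by
  set An := typedNodes μ τ F with hAn
  set D := freeNodes μ τ F T₁ with hD
  have hDA : D ⊆ An := freeNodes_subset F T₁
  have hinj : Set.InjOn (pos F) An := fun t ht s hs h =>
    pos_injOn (isNode_of_mem_typedNodes ht) (isNode_of_mem_typedNodes hs) h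
  -- This gives |A| - 3k₁ ≤ |D|, so that there are enough free nodes for `card_sparse_subsets`.
  have hcardD := card_typedNodes_le (μ := μ) F T₁ fun t ht => depth_le_of_mem_typedSets hd hT₁ ht
  rw [hT₁.1.1, ← hAn, ← hD] at hcardD
  have hcardD' : (D.image (pos F)).card = D.card := Finset.card_image_of_injOn (hinj.mono hDA)
  rw [← card_sparse_subsets (D.image (pos F)) (X := An.card - 3 * 𝕋₁.card) (by omega) r]
  -- Lying among the first |A| - 3k₁ free nodes is the same as having more than 3k₁ nodes of A that
  -- are not free or not before `s`, because the two sets are complementary in A.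
  have hfirst : ∀ s, 3 * 𝕋₁.card < (An.filter fun x => x ∉ D ∨ pos F s ≤ pos F x).card ↔
      ((D.image (pos F)).filter (· < pos F s)).card < An.card - 3 * 𝕋₁.card := by
    intro s
    have h₁ := Finset.card_filter_add_card_filter_not (s := An)
      fun x => x ∉ D ∨ pos F s ≤ pos F x
    have h₂ : ((D.image (pos F)).filter (· < pos F s)).card =
        (An.filter fun x => ¬ (x ∉ D ∨ pos F s ≤ pos F x)).card := by
      rw [← Finset.card_image_of_injOn (hinj.mono (Finset.filter_subset _ An))]
      congr 1
      ext i
      simp only [Finset.mem_filter, Finset.mem_image, not_or, not_not, not_le]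
      constructor
      · rintro ⟨⟨x, hx, rfl⟩, h⟩
        exact ⟨x, ⟨hDA hx, hx, h⟩, rfl⟩
      · rintro ⟨x, ⟨-, hx, h⟩, rfl⟩
        exact ⟨⟨x, hx, rfl⟩, h⟩
    omega
  -- Within the fibre the part of other types is `T₁`, so a set is determined by its nodes of type
  -- τ, here given by their positions in `D`.
  refine Finset.card_nbij (fun T => (T.filter fun t => t ∈ An).image (pos F)) ?_ ?_ ?_
  · intro T hT
    obtain ⟨hTG, hfib⟩ := Finset.mem_filter.1 hT
    obtain ⟨hTX, -, h₁, h₂⟩ := (hG T).1 hTG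
    rw [hfib, ← hD] at h₁ h₂
    have hcard : ((T.filter fun t => t ∈ An).image (pos F)).card =
        (T.filter fun t => t ∈ An).card :=
      Finset.card_image_of_injOn (hinj.mono fun t ht => (Finset.mem_filter.1 ht).2)
    rw [Finset.mem_coe, Finset.mem_filter, Finset.mem_powersetCard, hcard]
    refine ⟨⟨?_, (filter_mem_typedSets hτ hTX).2⟩, ?_, ?_⟩
    · refine Finset.image_subset_image fun s hs => ?_
      obtain ⟨hs, hs'⟩ := Finset.mem_filter.1 hs
      refine Finset.mem_filter.2 ⟨hs', fun t ht => ?_⟩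
      rw [← hfib] at ht
      obtain ⟨ht, ht'⟩ := Finset.mem_filter.1 ht
      have hne : t ≠ s := fun h => ht' (h ▸ hs')
      exact ⟨hTX.1.2.2 t ht s hs hne, hTX.1.2.2 s hs t ht hne.symm⟩
    · intro i hi
      obtain ⟨s, hs, rfl⟩ := Finset.mem_image.1 hi
      obtain ⟨hs, hs'⟩ := Finset.mem_filter.1 hs
      exact (hfirst s).1 (h₁ s hs hs')
    · intro i hi j hj hij
      obtain ⟨s, hs, rfl⟩ := Finset.mem_image.1 hi
      obtain ⟨s', hs', rfl⟩ := Finset.mem_image.1 hj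
      obtain ⟨hs, hs₁⟩ := Finset.mem_filter.1 hs
      obtain ⟨hs', hs₁'⟩ := Finset.mem_filter.1 hs'
      obtain ⟨x, hx, h⟩ := h₂ s hs s' hs' hs₁ hs₁' hij
      exact ⟨_, Finset.mem_image_of_mem _ hx, h⟩
  · intro T hT T' hT' h
    have hfib := (Finset.mem_filter.1 hT).2
    have hfib' := (Finset.mem_filter.1 hT').2
    have h' : (T.filter fun t => t ∈ An) = T'.filter fun t => t ∈ An :=
      Finset.image_injOn_powerset_of_injOn hinj
        (Finset.mem_coe.2 (Finset.mem_powerset.2 fun t ht => (Finset.mem_filter.1 ht).2))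
        (Finset.mem_coe.2 (Finset.mem_powerset.2 fun t ht => (Finset.mem_filter.1 ht).2)) h
    rw [← Finset.filter_union_filter_not_eq (fun t => t ∈ An) T,
      ← Finset.filter_union_filter_not_eq (fun t => t ∈ An) T', h', hfib, hfib']
  · intro U hU
    rw [Finset.mem_coe, Finset.mem_filter, Finset.mem_powersetCard] at hU
    obtain ⟨⟨hUD, hr⟩, h₁, h₂⟩ := hU
    obtain ⟨S, hS, rfl⟩ := Finset.subset_image_iff.1 hUD
    rw [Finset.card_image_of_injOn (hinj.mono (hS.trans hDA))] at hr
    have hsp : ∀ s ∈ S, ∀ s' ∈ S, pos F s < pos F s' →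
        ∃ x ∈ D, pos F s < pos F x ∧ pos F x < pos F s' := by
      intro s hs s' hs' hlt
      obtain ⟨i, hi, h⟩ := h₂ _ (Finset.mem_image_of_mem _ hs) _ (Finset.mem_image_of_mem _ hs') hlt
      obtain ⟨x, hx, rfl⟩ := Finset.mem_image.1 hi
      exact ⟨x, hx, h⟩
    have hnot : ∀ t ∈ T₁, t ∉ An := fun t ht => notMem_typedNodes hτ hT₁ ht
    have hf₁ : ((T₁ ∪ S).filter fun t => t ∉ An) = T₁ := by
      ext t
      simp only [Finset.mem_filter, Finset.mem_union]
      exact ⟨fun h => h.1.resolve_right fun hs => h.2 (hDA (hS hs)), fun h => ⟨Or.inl h, hnot t h⟩⟩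
    have hf₂ : ((T₁ ∪ S).filter fun t => t ∈ An) = S := by
      ext t
      simp only [Finset.mem_filter, Finset.mem_union]
      exact ⟨fun h => h.1.resolve_left fun ht => hnot t ht h.2, fun h => ⟨Or.inr h, hDA (hS h)⟩⟩
    have hmem : ∀ t ∈ T₁ ∪ S, t ∈ An → t ∈ S := fun t ht ht' =>
      (Finset.mem_union.1 ht).resolve_left fun h => hnot t h ht'
    refine ⟨T₁ ∪ S, ?_, by dsimp only; rw [hf₂]⟩
    refine Finset.mem_coe.2 (Finset.mem_filter.2 ⟨(hG _).2
      ⟨union_mem_typedSets hτ hT₁ hS hr hsp, hA, ?_, ?_⟩, hf₁⟩)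
    · intro s hs hs'
      rw [← hAn, hf₁, ← hD]
      exact (hfirst s).2 (h₁ _ (Finset.mem_image_of_mem _ (hmem s hs hs')))
    · intro s hs s' hs' hs₁ hs₁' hlt
      rw [← hAn, hf₁, ← hD]
      exact hsp s (hmem s hs hs₁) s' (hmem s' hs' hs₁') hlt

open Classical in
/-- The number of spread sets. -/
theorem ncard_spread (hτ : τ ∉ 𝕋₁) (hd : ∀ σ ∈ 𝕋₁, τ.2 ≤ σ.2) (F : Forest A) :
    {T | T ∈ typedSets μ F (𝕋₁ + Multiset.replicate r τ) ∧ IsSpread μ τ r 𝕋₁.card F T}.ncard =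
      (if 3 * 𝕋₁.card + 2 * r ≤ (nodesOfType μ τ F).ncard then
        sparseWords r ((nodesOfType μ τ F).ncard - 3 * 𝕋₁.card) else 0) *
          (typedSets μ F 𝕋₁).ncard := by
  rw [← card_typedNodes]
  split_ifs with hA
  · have hfin : {T | T ∈ typedSets μ F (𝕋₁ + Multiset.replicate r τ) ∧
        IsSpread μ τ r 𝕋₁.card F T}.Finite := (finite_typedSets F _).subset fun T hT => hT.1
    -- The spread sets are grouped by their nodes of types other than τ; all fibres have the same
    -- size by `card_fiber`.
    rw [Set.ncard_eq_toFinset_card _ hfin, Set.ncard_eq_toFinset_card _ (finite_typedSets F 𝕋₁),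
      Finset.card_eq_sum_card_fiberwise (f := fun T => T.filter fun t => t ∉ typedNodes μ τ F)
        (t := (finite_typedSets (μ := μ) F 𝕋₁).toFinset)]
    · rw [Finset.sum_congr rfl fun T₁ hT₁ => card_fiber hτ hd hA
        ((Set.Finite.mem_toFinset _).1 hT₁) fun T => by simp, Finset.sum_const, smul_eq_mul,
        mul_comm]
    · intro T hT
      simp only [Set.Finite.coe_toFinset] at hT ⊢
      exact (filter_mem_typedSets hτ hT.1).1
  · rw [zero_mul, Set.ncard_eq_zero ((finite_typedSets F _).subset fun T hT => hT.1)]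
    ext T
    simp only [Set.mem_empty_iff_false, iff_false]
    rintro ⟨-, h, -⟩
    exact hA h

open Classical in
/-- There are few sets that are not spread. -/
theorem ncard_not_spread_le (hτ : τ ∉ 𝕋₁) (hr : 0 < r) (F : Forest A) :
    {T | T ∈ typedSets μ F (𝕋₁ + Multiset.replicate r τ) ∧ ¬ IsSpread μ τ r 𝕋₁.card F T}.ncard ≤
      (7 * 𝕋₁.card + 3 * r) * F.encode.length ^ (𝕋₁.card + r - 1) := by
  have hfin : {T | T ∈ typedSets μ F (𝕋₁ + Multiset.replicate r τ) ∧
      ¬ IsSpread μ τ r 𝕋₁.card F T}.Finite := (finite_typedSets F _).subset fun T hT => hT.1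
  rw [Set.ncard_eq_toFinset_card _ hfin]
  set An := typedNodes μ τ F with hAn
  have hinj : Set.InjOn (pos F) An := fun t ht s hs h =>
    pos_injOn (isNode_of_mem_typedNodes ht) (isNode_of_mem_typedNodes hs) h
  let D : Finset (List ℕ) → Finset (List ℕ) := fun U =>
    freeNodes μ τ F (U.filter fun t => t ∉ An)
  -- For each reason not to be spread, a bounded set of candidates for one node is given in terms of
  -- the others. `C₁`: if A is small, any node of A. `C₂`: one of the last 3k₁ nodes of A. `C₃`: a
  -- free node that directly follows some other element of the set. The sizes add up to 7k₁ + 3r.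
  let C₁ : Finset (List ℕ) := if An.card < 3 * 𝕋₁.card + 2 * r then An else ∅
  let C₂ : Finset (List ℕ) :=
    An.filter fun x => (An.filter fun y => pos F x ≤ pos F y).card ≤ 3 * 𝕋₁.card
  let C₃ : Finset (List ℕ) → Finset (List ℕ) := fun U => U.biUnion fun s =>
    (D U).filter fun x => pos F s < pos F x ∧ ∀ y ∈ D U, pos F s < pos F y → pos F x ≤ pos F y
  have hC₁ : C₁.card ≤ 3 * 𝕋₁.card + 2 * r := by
    dsimp only [C₁]
    split_ifs with h
    · exact h.le
    · simp
  have hC₂ : C₂.card ≤ 3 * 𝕋₁.card := by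
    rcases C₂.eq_empty_or_nonempty with h | h
    · simp [h]
    -- All of `C₂` lies at or after its earliest element, and there are at most 3k₁ such nodes in A.
    · obtain ⟨x, hx, hmin⟩ := Finset.exists_min_image C₂ (pos F) h
      refine (Finset.card_le_card fun y hy => ?_).trans (Finset.mem_filter.1 hx).2
      exact Finset.mem_filter.2 ⟨(Finset.mem_filter.1 hy).1, hmin y hy⟩
  have hC₃ : ∀ U : Finset (List ℕ), U.card = 𝕋₁.card + r - 1 → (C₃ U).card ≤ 𝕋₁.card + r := by
    intro U hU
    have := Finset.card_biUnion_le_card_mul U (fun s => (D U).filter fun x => pos F s < pos F x ∧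
      ∀ y ∈ D U, pos F s < pos F y → pos F x ≤ pos F y) 1 fun s _ => by
        refine Finset.card_le_one.2 fun x hx y hy => ?_
        obtain ⟨hx, hx₁, hx₂⟩ := Finset.mem_filter.1 hx
        obtain ⟨hy, hy₁, hy₂⟩ := Finset.mem_filter.1 hy
        exact hinj (freeNodes_subset F _ hx) (freeNodes_subset F _ hy)
          (le_antisymm (hx₂ y hy hy₁) (hy₂ x hx hx₁))
    dsimp only [C₃]
    omega
  refine (card_le_of_exists_erase (N := nodeFinset F) (k := 𝕋₁.card + r - 1)
    (c := 7 * 𝕋₁.card + 3 * r) (fun U => C₁ ∪ C₂ ∪ C₃ U) (fun U hU => ?_) fun T hT => ?_).trans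
    (Nat.mul_le_mul_left _ (Nat.pow_le_pow_left (card_nodeFinset_le F) _))
  · have h₁ := Finset.card_union_le (C₁ ∪ C₂) (C₃ U)
    have h₂ := Finset.card_union_le C₁ C₂
    have h₃ := hC₃ U hU
    omega
  · obtain ⟨hT, hbad⟩ := (Set.Finite.mem_toFinset hfin).1 hT
    obtain ⟨hT₁, hS⟩ := filter_mem_typedSets hτ hT
    refine ⟨fun t ht => mem_nodeFinset.2 (hT.1.2.1 t ht).isNode, ?_, ?_⟩
    · rw [hT.1.1, Multiset.card_add, Multiset.card_replicate]
      omega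
    · by_cases h₁ : An.card < 3 * 𝕋₁.card + 2 * r
      · obtain ⟨s, hs⟩ := Finset.card_pos.1 (hr.trans_eq hS.symm)
        obtain ⟨hs, hs'⟩ := Finset.mem_filter.1 hs
        refine ⟨s, hs, Finset.mem_union_left _ (Finset.mem_union_left _ ?_)⟩
        dsimp only [C₁]
        rwa [if_pos h₁]
      · by_cases h₂ : ∃ s ∈ T, s ∈ An ∧
            (An.filter fun y => pos F s ≤ pos F y).card ≤ 3 * 𝕋₁.card
        · obtain ⟨s, hs, hs', h⟩ := h₂
          exact ⟨s, hs, Finset.mem_union_left _ (Finset.mem_union_right _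
            (Finset.mem_filter.2 ⟨hs', h⟩))⟩
        · by_contra hn
          refine hbad ⟨not_lt.1 h₁, fun s hs hs' => ?_, fun s hs s' hs' h h' hlt => ?_⟩
          · push Not at h₂
            -- More than 3k₁ nodes of A from `s` on already suffice; the nodes that are not free
            -- only enlarge the set.
            exact (h₂ s hs hs').trans_le (Finset.card_le_card
              (Finset.monotone_filter_right _ fun y _ hy => Or.inr hy))
          · by_contra hno
            refine hn ⟨s', hs', Finset.mem_union_right _ (Finset.mem_biUnion.2 ⟨s, ?_, ?_⟩)⟩
            · exact Finset.mem_erase.2 ⟨fun h => by rw [h] at hlt; exact lt_irrefl _ hlt, hs⟩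
            -- The free nodes depend only on the elements that are not of type τ, so removing `s'`
            -- does not change them.
            · have hDe : D (T.erase s') = D T := by
                refine congrArg (freeNodes μ τ F) ?_
                ext t
                simp only [Finset.mem_filter, Finset.mem_erase]
                exact ⟨fun h => ⟨h.1.2, h.2⟩, fun h₁ => ⟨⟨fun h₂ => h₁.2 (h₂ ▸ h'), h₁.1⟩, h₁.2⟩⟩
              rw [hDe]
              refine Finset.mem_filter.2 ⟨Finset.mem_filter.2 ⟨h', fun t ht => ?_⟩, hlt, ?_⟩
              · obtain ⟨ht, ht'⟩ := Finset.mem_filter.1 ht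
                have hne : t ≠ s' := fun h => ht' (h ▸ h')
                exact ⟨hT.1.2.2 t ht s' hs' hne, hT.1.2.2 s' hs' t ht hne.symm⟩
              · intro y hy hsy
                by_contra hys
                exact hno ⟨y, hy, hsy, not_le.1 hys⟩

end SpreadCount

/-! ### Decomposition of the counts for multisets of types -/

section TypesDecomposition

open Forest Bracketed

variable {A : Type u} {M : Type v} [Monoid M] {μ : FreeMonoid A →* M} {K n : ℕ}

theorem onForests_add (μ : FreeMonoid A →* M) (K : ℕ) (φ ψ : Forest A → ℕ)
    (w : List (Bracketed A)) :
    onForests μ K (fun F => φ F + ψ F) w = onForests μ K φ w + onForests μ K ψ w := by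
  unfold onForests
  split_ifs <;> rfl

theorem onForests_mul (μ : FreeMonoid A →* M) (K : ℕ) (φ ψ : Forest A → ℕ)
    (w : List (Bracketed A)) :
    onForests μ K (fun F => φ F * ψ F) w = onForests μ K φ w * onForests μ K ψ w := by
  unfold onForests
  split_ifs <;> simp

theorem onForests_congr {φ ψ : Forest A → ℕ}
    (h : ∀ F : Forest A, F.IsFactorizationLE μ K → φ F = ψ F) (w : List (Bracketed A)) :
    onForests μ K φ w = onForests μ K ψ w := by
  unfold onForests
  split_ifs with hw
  · exact h _ hw.choose_spec.1
  · rfl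

theorem NReg.all_mem {P : Forest A → Finset (List ℕ) → (Fin n → List ℕ) → List ℕ → Prop}
    (h : NReg μ K (n + 1) fun F T y => P F T (fun j => y j.succ) (y 0)) :
    NReg μ K n fun F T x => ∀ t ∈ T, P F T x t :=
  (NReg.all (P := fun F T x t => t ∈ T → P F T x t) ((NReg.mem 0).imp h)).congr
    fun _ _ _ _ hT _ => ⟨fun h t ht => h t (hT t ht) ht, fun h t _ ht => h t ht⟩

theorem NReg.forall_finset {ι : Type*} (s : Finset ι)
    {P : ι → Forest A → Finset (List ℕ) → (Fin n → List ℕ) → Prop}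
    (h : ∀ i ∈ s, NReg μ K n (P i)) : NReg μ K n fun F T x => ∀ i ∈ s, P i F T x := by
  classical
  induction s using Finset.induction_on with
  | empty => exact (NReg.const True).congr fun F T x _ _ _ => by simp
  | insert i s hi ih =>
    refine ((h i (by simp)).and (ih fun j hj => h j (by simp [hj]))).congr fun F T x _ _ _ => ?_
    simp

open Classical in
-- Multisets of equal size are equal once all multiplicities are bounded in one direction, and such
-- lower thresholds are definable by `NReg.le_ncard`.
theorem mem_typedSets_iff {F : Forest A} {𝕋 : Multiset (NodeType A M)} {T : Finset (List ℕ)}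
    (hcard : T.card = 𝕋.card) (hT : ∀ t ∈ T, IsNode F t) : T ∈ typedSets μ F 𝕋 ↔
      ((∀ t ∈ T, F.IsIterable t) ∧ ∀ t ∈ T, ∀ s ∈ T, ¬ t = s → ¬ Observes t s) ∧
        (∀ t ∈ T, IsInterior F t) ∧
          ∀ σ ∈ 𝕋.toFinset, 𝕋.count σ ≤ {t | IsNode F t ∧ t ∈ T ∧ F.nodeType μ t = σ}.ncard := by
  have hcount : ∀ σ, {t | IsNode F t ∧ t ∈ T ∧ F.nodeType μ t = σ}.ncard =
      (F.types μ T).count σ := by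
    intro σ
    rw [types, Multiset.count_map, ← Finset.filter_val, ← Finset.card_def, ← Set.ncard_coe_finset]
    congr 1
    ext t
    simp only [Finset.coe_filter]
    exact ⟨fun h => ⟨h.2.1, h.2.2.symm⟩, fun h => ⟨hT t h.1, h.1, h.2.symm⟩⟩
  have htypes : F.types μ T = 𝕋 ↔ ∀ σ ∈ 𝕋.toFinset, 𝕋.count σ ≤ (F.types μ T).count σ := by
    refine ⟨fun h σ _ => by rw [h], fun h => ?_⟩
    refine (Multiset.eq_of_le_of_card_le (Multiset.le_iff_count.2 fun σ => ?_) ?_).symm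
    · by_cases hσ : σ ∈ 𝕋
      · exact h σ (Multiset.mem_toFinset.2 hσ)
      · rw [Multiset.count_eq_zero_of_notMem hσ]
        exact Nat.zero_le _
    · rw [types, Multiset.card_map, ← hcard]
      rfl
  simp only [hcount]
  rw [← htypes]
  exact ⟨fun h => ⟨⟨h.1.2.1, h.1.2.2⟩, h.2⟩, fun h => ⟨⟨hcard, h.1.1, h.1.2⟩, h.2⟩⟩

variable [Finite M]

/-- The size of the set is not part of the relation, since it is fixed by `setCount`. -/
theorem exists_nreg_typedSets (𝕋 : Multiset (NodeType A M)) :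
    ∃ Q : Forest A → Finset (List ℕ) → Prop, NReg μ K 0 (fun F T _ => Q F T) ∧
      ∀ F T, T.card = 𝕋.card → (∀ t ∈ T, IsNode F t) → (T ∈ typedSets μ F 𝕋 ↔ Q F T) := by
  classical
  refine ⟨_, ?_, fun F T hcard hT => mem_typedSets_iff hcard hT⟩
  refine NReg.and (NReg.and ?_ ?_) (NReg.and ?_ ?_)
  · exact NReg.all_mem (P := fun F _ _ t => F.IsIterable t) (NReg.isIterable 0)
  · exact NReg.all_mem (P := fun F T _ t => ∀ s ∈ T, ¬ t = s → ¬ Observes t s)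
      (NReg.all_mem (P := fun F T x s => ¬ x 0 = s → ¬ Observes (x 0) s)
        ((NReg.eq (Fin.succ 0) 0).not.imp (NReg.observes (Fin.succ 0) 0).not))
  · exact NReg.all_mem (P := fun F _ _ t => IsInterior F t) (NReg.isInterior 0)
  · exact NReg.forall_finset _ fun σ _ => NReg.le_ncard (P := fun F T _ t =>
      t ∈ T ∧ F.nodeType μ t = σ) _ ((NReg.mem 0).and (NReg.nodeType_eq σ 0))

variable (τ : NodeType A M)

theorem NReg.mem_typedNodes (j : Fin n) : NReg μ K n fun F _ x => x j ∈ typedNodes μ τ F :=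
  (NReg.mem_nodesOfType τ j).congr fun _ _ _ _ _ _ => PolyCount.mem_typedNodes.symm

open Classical in
theorem NReg.mem_freeNodes (j : Fin n) : NReg μ K n fun F T x =>
    x j ∈ freeNodes μ τ F (T.filter fun t => t ∉ typedNodes μ τ F) := by
  refine ((NReg.mem_typedNodes τ j).and (NReg.all_mem (P := fun F _ x t =>
    ¬ t ∈ typedNodes μ τ F → ¬ Observes t (x j) ∧ ¬ Observes (x j) t)
      ((NReg.mem_typedNodes τ 0).not.imp
        ((NReg.observes 0 j.succ).not.and (NReg.observes j.succ 0).not)))).congr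
    fun F T x _ _ _ => ?_
  rw [freeNodes, Finset.mem_filter]
  refine and_congr_right fun _ => ?_
  simp only [Finset.mem_filter, and_imp]

open Classical in
-- The position of a node among the free ones is bounded by a quantity that depends on |A|. The
-- definition bounds the complement by the constant 3k₁ instead, which is a regular threshold.
theorem NReg.isSpread (r k₁ : ℕ) : NReg μ K 0 fun F T _ => IsSpread μ τ r k₁ F T := by
  refine NReg.and ?_ (NReg.and ?_ ?_)
  · refine (NReg.le_ncard (P := fun F _ _ t => t ∈ typedNodes μ τ F) (3 * k₁ + 2 * r)
      (NReg.mem_typedNodes τ 0)).congr fun F T x _ _ _ => ?_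
    rw [← Set.ncard_coe_finset]
    refine iff_of_eq (congrArg (3 * k₁ + 2 * r ≤ Set.ncard ·) ?_)
    ext t
    exact ⟨fun h => h.2, fun h => ⟨isNode_of_mem_typedNodes h, h⟩⟩
  · refine NReg.all_mem (P := fun F T _ s => s ∈ typedNodes μ τ F → 3 * k₁ <
      ((typedNodes μ τ F).filter fun x =>
        x ∉ freeNodes μ τ F (T.filter fun t => t ∉ typedNodes μ τ F) ∨ pos F s ≤ pos F x).card)
      ((NReg.mem_typedNodes τ 0).imp ?_)
    refine (NReg.le_ncard (P := fun F T y x => x ∈ typedNodes μ τ F ∧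
      (¬ x ∈ freeNodes μ τ F (T.filter fun t => t ∉ typedNodes μ τ F) ∨ ¬ pos F x < pos F (y 0)))
      (3 * k₁ + 1) ((NReg.mem_typedNodes τ 0).and ((NReg.mem_freeNodes τ 0).not.or
        (NReg.lt 0 (Fin.succ 0)).not))).congr fun F T x _ _ _ => ?_
    rw [← Set.ncard_coe_finset, Nat.lt_iff_add_one_le]
    refine iff_of_eq (congrArg (3 * k₁ + 1 ≤ Set.ncard ·) ?_)
    ext t
    simp only [Finset.coe_filter, not_lt]
    exact ⟨fun h => h.2, fun h => ⟨isNode_of_mem_typedNodes h.1, h⟩⟩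
  · refine NReg.all_mem (P := fun F T _ s => ∀ s' ∈ T, s ∈ typedNodes μ τ F →
      s' ∈ typedNodes μ τ F → pos F s < pos F s' →
        ∃ x ∈ freeNodes μ τ F (T.filter fun t => t ∉ typedNodes μ τ F),
          pos F s < pos F x ∧ pos F x < pos F s') ?_
    refine NReg.all_mem (P := fun F T y s' => y 0 ∈ typedNodes μ τ F →
      s' ∈ typedNodes μ τ F → pos F (y 0) < pos F s' →
        ∃ x ∈ freeNodes μ τ F (T.filter fun t => t ∉ typedNodes μ τ F),
          pos F (y 0) < pos F x ∧ pos F x < pos F s') ?_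
    refine (NReg.mem_typedNodes τ (Fin.succ 0)).imp ((NReg.mem_typedNodes τ 0).imp
      ((NReg.lt (Fin.succ 0) 0).imp ?_))
    refine (NReg.ex (P := fun F T y x =>
      x ∈ freeNodes μ τ F (T.filter fun t => t ∉ typedNodes μ τ F) ∧
        pos F (y (Fin.succ 0)) < pos F x ∧ pos F x < pos F (y 0))
      ((NReg.mem_freeNodes τ 0).and ((NReg.lt (Fin.succ (Fin.succ 0)) 0).and
        (NReg.lt 0 (Fin.succ 0))))).congr fun F T x _ _ _ => ?_
    exact ⟨fun ⟨t, _, h⟩ => ⟨t, h⟩, fun ⟨t, h⟩ => ⟨t, isNode_of_mem_typedNodes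
      (freeNodes_subset F _ h.1), h⟩⟩

/-- A root has three or more children exactly when some node of depth 1 is iterable. -/
theorem NReg.arity (e : M) : NReg μ K n fun F _ _ => 3 ≤ F.arity ∧ F.value μ = e := by
  refine ((NReg.ex (P := fun F _ _ t => t.length = 1 ∧ F.IsIterable t)
    ((NReg.length_eq 1 0).and (NReg.isIterable 0))).and
      (NReg.of_reg (Reg.hat_eq (μ := μ) e))).congr fun F T x _ _ _ => ?_
  rw [hat_encode]
  refine and_congr ⟨?_, fun h => ?_⟩ Iff.rfl
  · rintro ⟨t, -, h₁, h₂⟩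
    obtain ⟨i, rfl⟩ := List.length_eq_one_iff.1 h₁
    have := isIterable_singleton.1 h₂
    omega
  · have := isIterable_singleton.2 (show 0 < 1 ∧ 1 + 1 < F.arity by omega)
    exact ⟨_, this.isNode, rfl, this⟩

variable {τ}

open Classical in
/-- The decomposition along a type of least depth. -/
theorem exists_countTypes_eq (μ : FreeMonoid A →* M) (K : ℕ) (e : M)
    {𝕋₁ : Multiset (NodeType A M)} {r : ℕ} (hr : 0 < r) (hτ : τ ∉ 𝕋₁)
    (hd : ∀ σ ∈ 𝕋₁, τ.2 ≤ σ.2) : ∃ g'' : List (Bracketed A) → ℕ, IsPolyregular g'' ∧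
      HasGrowth g'' (𝕋₁.card + r - 1) ∧
      ∀ w, countTypes μ K e (𝕋₁ + Multiset.replicate r τ) w =
        sparseFactor μ K τ r 𝕋₁.card w * countTypes μ K e 𝕋₁ w + g'' w := by
  set 𝕋 := 𝕋₁ + Multiset.replicate r τ with h𝕋
  have hcard : 𝕋.card = 𝕋₁.card + r := by
    rw [h𝕋, Multiset.card_add, Multiset.card_replicate]
  obtain ⟨Q, hQ, hQ'⟩ := exists_nreg_typedSets (μ := μ) (K := K) 𝕋
  obtain ⟨L, hL, hLcount⟩ := NReg.exists_setCount
    (P := fun F T => (3 ≤ F.arity ∧ F.value μ = e) ∧ Q F T ∧ ¬ IsSpread μ τ r 𝕋₁.card F T)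
    ((NReg.arity e).and (hQ.and (NReg.isSpread τ r 𝕋₁.card).not))
  have hset : ∀ F : Forest A, {T : Finset (List ℕ) | (T.card = 𝕋.card ∧ ∀ t ∈ T, IsNode F t) ∧
      (3 ≤ F.arity ∧ F.value μ = e) ∧ Q F T ∧ ¬ IsSpread μ τ r 𝕋₁.card F T}.ncard =
      if 3 ≤ F.arity ∧ F.value μ = e then
        {T | T ∈ typedSets μ F 𝕋 ∧ ¬ IsSpread μ τ r 𝕋₁.card F T}.ncard else 0 := by
    intro F
    split_ifs with h
    · congr 1
      ext T
      constructor
      · rintro ⟨⟨h₁, h₂⟩, -, h₃, h₄⟩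
        exact ⟨(hQ' F T h₁ h₂).2 h₃, h₄⟩
      · rintro ⟨h₁, h₂⟩
        have h₃ : ∀ t ∈ T, IsNode F t := fun t ht => (h₁.1.2.1 t ht).isNode
        exact ⟨⟨h₁.1.1, h₃⟩, h, (hQ' F T h₁.1.1 h₃).1 h₁, h₂⟩
    · rw [show {T : Finset (List ℕ) | (T.card = 𝕋.card ∧ ∀ t ∈ T, IsNode F t) ∧
        (3 ≤ F.arity ∧ F.value μ = e) ∧ Q F T ∧ ¬ IsSpread μ τ r 𝕋₁.card F T} = ∅ from
        Set.eq_empty_of_forall_notMem fun T hT => h hT.2.1, Set.ncard_empty]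
  -- The remainder counts the sets that are not spread.
  refine ⟨setCount L 𝕋.card, IsPolyregular.setCount hL _,
    ⟨7 * 𝕋₁.card + 3 * r, fun w _ => ?_⟩, fun w => ?_⟩
  · rw [hLcount]
    by_cases hw : ∃ F : Forest A, F.IsFactorizationLE μ K ∧ F.encode = w
    · obtain ⟨F, hF, rfl⟩ := hw
      rw [onForests_encode μ K _ F hF]
      rw [hset]
      split_ifs
      · exact ncard_not_spread_le hτ hr F
      · exact Nat.zero_le _
    · rw [onForests, dif_neg hw]
      exact Nat.zero_le _
  · rw [hLcount, countTypes, sparseFactor, countTypes, ← onForests_mul, ← onForests_add]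
    refine onForests_congr (fun F hF => ?_) w
    rw [hset]
    split_ifs with h₁ h₂ h₂
    · have h₃ := ncard_spread (μ := μ) (r := r) hτ hd F
      rw [if_pos h₂] at h₃
      have h₄ := Set.ncard_inter_add_ncard_sdiff_eq_ncard (typedSets μ F 𝕋)
        {T | IsSpread μ τ r 𝕋₁.card F T} (finite_typedSets F 𝕋)
      change (typedSets μ F 𝕋).ncard = _ * (typedSets μ F 𝕋₁).ncard + _
      rw [← h₃]
      exact h₄.symm
    · have h₃ := ncard_spread (μ := μ) (r := r) hτ hd F
      rw [if_neg h₂] at h₃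
      have h₄ := Set.ncard_inter_add_ncard_sdiff_eq_ncard (typedSets μ F 𝕋)
        {T | IsSpread μ τ r 𝕋₁.card F T} (finite_typedSets F 𝕋)
      change (typedSets μ F 𝕋).ncard = _ * (typedSets μ F 𝕋₁).ncard + _
      rw [← h₃]
      exact h₄.symm
    · simp
    · simp

open Classical in
-- Induction on the size: all copies of a type of least depth are removed at once. The sparse factor
-- is polyblind of growth equal to their number, and it multiplies the decomposition for the other
-- types. The empty multiset gives a regular test.
theorem decomp_countTypes (μ : FreeMonoid A →* M) (K : ℕ) (e : M) (𝕋 : Multiset (NodeType A M)) :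
    Decomp (countTypes μ K e 𝕋) 𝕋.card := by
  induction h : 𝕋.card using Nat.strong_induction_on generalizing 𝕋 with
  | _ k ih =>
  subst h
  rcases 𝕋.empty_or_exists_mem with rfl | ⟨σ, hσ⟩
  · obtain ⟨L, hL, hLcount⟩ := NReg.exists_setCount (μ := μ) (K := K)
      (P := fun F _ => 3 ≤ F.arity ∧ F.value μ = e) (NReg.arity e)
    refine (Decomp.indicator (hL.comap (Sum.inl : Bracketed A → _))).congr fun w => ?_
    have h₁ : setCount L 0 w = if L (w.map Sum.inl) then 1 else 0 := by
      have : mark w ∅ = w.map Sum.inl := List.ext_getElem (by simp) fun i h₁ h₂ => by simp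
      simp [setCount, Finset.filter_singleton, this, apply_ite Finset.card]
    rw [← h₁, hLcount, countTypes]
    refine onForests_congr (fun F _ => ?_) w
    split_ifs with h
    · congr 1
      ext T
      constructor
      · intro hT
        exact ⟨⟨hT.1.1, fun t ht => (hT.1.2.1 t ht).isNode⟩, h⟩
      · rintro ⟨⟨hT, -⟩, -⟩
        rw [Finset.card_eq_zero] at hT
        subst hT
        exact ⟨⟨by simp, by simp, by simp⟩, by simp, rfl⟩
    · symm
      rw [show {T : Finset (List ℕ) | (T.card = 0 ∧ ∀ t ∈ T, IsNode F t) ∧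
        3 ≤ F.arity ∧ F.value μ = e} = ∅ from
        Set.eq_empty_of_forall_notMem fun T hT => h hT.2, Set.ncard_empty]
  · obtain ⟨τ, hτ, hmin⟩ := Finset.exists_min_image 𝕋.toFinset (fun σ => σ.2)
      ⟨σ, Multiset.mem_toFinset.2 hσ⟩
    rw [Multiset.mem_toFinset] at hτ
    have hsplit : 𝕋 = 𝕋.filter (fun σ => ¬ σ = τ) + Multiset.replicate (𝕋.count τ) τ := by
      rw [← Multiset.filter_eq', add_comm, Multiset.filter_add_not]
    have hr : 0 < 𝕋.count τ := Multiset.count_pos.2 hτ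
    have hcard := congrArg Multiset.card hsplit
    rw [Multiset.card_add, Multiset.card_replicate] at hcard
    obtain ⟨g'', h₁, h₂, h₃⟩ := exists_countTypes_eq (τ := τ) μ K e
      (𝕋₁ := 𝕋.filter fun σ => ¬ σ = τ) hr (by simp)
      fun σ hσ => hmin σ (Multiset.mem_toFinset.2 (Multiset.mem_of_mem_filter hσ))
    rw [← hsplit] at h₃
    have h₄ := (Decomp.of_isPolyblind (isPolyblind_sparseFactor μ K τ hr
      (𝕋.filter fun σ => ¬ σ = τ).card) (hasGrowth_sparseFactor μ K τ hr _)).mul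
        (ih (𝕋.filter fun σ => ¬ σ = τ).card (by omega) _ rfl)
    rw [add_comm, ← hcard] at h₄
    rw [← hcard] at h₂
    refine (h₄.add ⟨fun _ => 0, g'', fun w => (Nat.zero_add _).symm, IsPolyblind.const 0,
      HasGrowth.const 0 _, h₁, fun _ => h₂, fun h => ?_⟩).congr h₃
    omega

end TypesDecomposition

/-! ### Independent sets in an outer child and in the rest of the forest -/

section Splitting

open Forest Bracketed

variable {A : Type u} {M : Type v} [Monoid M]

theorem observes_cons_iff {i : ℕ} {p p' : List ℕ} :
    Observes (i :: p) (i :: p') ↔ Observes p p' := by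
  constructor
  · rintro (h | ⟨q, j, ⟨h, h'⟩ | ⟨h, h'⟩⟩)
    · exact Or.inl (List.cons_prefix_cons.1 h).2
    · rcases q with _ | ⟨m, q⟩
      · simp at h h'
        omega
      · simp only [List.cons_append, List.cons_prefix_cons, List.cons.injEq] at h h'
        exact Or.inr ⟨q, j, Or.inl ⟨h.2, h'.2⟩⟩
    · rcases q with _ | ⟨m, q⟩
      · simp at h h'
        omega
      · simp only [List.cons_append, List.cons_prefix_cons, List.cons.injEq] at h h'
        exact Or.inr ⟨q, j, Or.inr ⟨h.2, h'.2⟩⟩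
  · rintro (h | ⟨q, j, ⟨h, rfl⟩ | ⟨h, rfl⟩⟩)
    · exact Or.inl (List.cons_prefix_cons.2 ⟨rfl, h⟩)
    · exact Or.inr ⟨i :: q, j, Or.inl ⟨List.cons_prefix_cons.2 ⟨rfl, h⟩, rfl⟩⟩
    · exact Or.inr ⟨i :: q, j, Or.inr ⟨List.cons_prefix_cons.2 ⟨rfl, h⟩, rfl⟩⟩

/-- Across different children, the only node that can be observed is an adjacent child itself. -/
theorem observes_cons_of_ne {i j : ℕ} {p p' : List ℕ} (hij : i ≠ j) :
    Observes (i :: p) (j :: p') ↔ p' = [] ∧ (i = j + 1 ∨ j = i + 1) := by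
  constructor
  · rintro (h | ⟨q, m, ⟨h, h'⟩ | ⟨h, h'⟩⟩)
    · exact absurd (List.cons_prefix_cons.1 h).1.symm hij
    · rcases q with _ | ⟨m', q⟩
      · simp at h h'
        exact ⟨h'.2, by omega⟩
      · simp only [List.cons_append, List.cons_prefix_cons, List.cons.injEq] at h h'
        omega
    · rcases q with _ | ⟨m', q⟩
      · simp at h h'
        exact ⟨h'.2, by omega⟩
      · simp only [List.cons_append, List.cons_prefix_cons, List.cons.injEq] at h h'
        omega
  · rintro ⟨rfl, rfl | rfl⟩
    · exact Or.inr ⟨[], j, Or.inl ⟨by simp, rfl⟩⟩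
    · exact Or.inr ⟨[], i, Or.inr ⟨by simp, rfl⟩⟩

theorem observes_succ_iff {i j : ℕ} {p p' : List ℕ} :
    Observes ((i + 1) :: p) ((j + 1) :: p') ↔ Observes (i :: p) (j :: p') := by
  by_cases h : i = j
  · subst h
    rw [observes_cons_iff, observes_cons_iff]
  · rw [observes_cons_of_ne h, observes_cons_of_ne (by omega)]
    exact and_congr Iff.rfl (by omega)

theorem Forest.IsIterable.ne_nil {F : Forest A} {t : List ℕ} (h : F.IsIterable t) : t ≠ [] := by
  obtain ⟨q, i, G, rfl, -⟩ := h
  simp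

theorem isIterable_cons {l : List (Forest A)} {i : ℕ} {p : List ℕ} (hp : p ≠ []) :
    (node l).IsIterable (i :: p) ↔ ∃ c, l[i]? = some c ∧ c.IsIterable p := by
  constructor
  · rintro ⟨q, j, G, h, hG, h₁, h₂⟩
    rcases q with _ | ⟨m, q⟩
    · simp only [List.nil_append, List.cons.injEq] at h
      exact absurd h.2 hp
    · simp only [List.cons_append, List.cons.injEq] at h
      obtain ⟨rfl, rfl⟩ := h
      rw [subforest, Option.bind_eq_some_iff] at hG
      obtain ⟨c, hc, hG⟩ := hG
      exact ⟨c, hc, q, j, G, rfl, hG, h₁, h₂⟩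
  · rintro ⟨c, hc, q, j, G, rfl, hG, h₁, h₂⟩
    exact ⟨i :: q, j, G, rfl, by simp [subforest, hc, hG], h₁, h₂⟩

theorem not_isIterable_letter (a : A) (t : List ℕ) : ¬ (Forest.letter a).IsIterable t := by
  rintro ⟨q, i, G, -, hG, -, h⟩
  cases q with
  | nil =>
    simp only [subforest, Option.some.injEq] at hG
    subst hG
    simp [Forest.arity] at h
  | cons j q => simp [subforest] at hG

theorem not_isIterable_nil (t : List ℕ) : ¬ (node ([] : List (Forest A))).IsIterable t := by
  intro h
  rcases t with _ | ⟨i, p⟩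
  · exact h.ne_nil rfl
  · rcases eq_or_ne p [] with rfl | hp
    · have := (isIterable_singleton.1 h).2
      simp [Forest.arity] at this
    · obtain ⟨c, hc, -⟩ := (isIterable_cons hp).1 h
      simp at hc

theorem Forest.IsIterable.lt {l : List (Forest A)} {i : ℕ} {p : List ℕ}
    (h : (node l).IsIterable (i :: p)) : i < l.length := by
  rcases eq_or_ne p [] with rfl | hp
  · have := (isIterable_singleton.1 h).2
    simp only [Forest.arity] at this
    omega
  · obtain ⟨c, hc, -⟩ := (isIterable_cons hp).1 h
    exact (List.getElem?_eq_some_iff.1 hc).1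

theorem finite_isIndependent (F : Forest A) (k : ℕ) :
    {T : Finset (List ℕ) | F.IsIndependent k T}.Finite :=
  (nodeFinset F).powerset.finite_toSet.subset fun _ hT => Finset.mem_coe.2
    (Finset.mem_powerset.2 fun t ht => mem_nodeFinset.2 (hT.2.1 t ht).isNode)

theorem mem_below {T : Finset (List ℕ)} {i : ℕ} {p : List ℕ} : p ∈ below T i ↔ i :: p ∈ T := by
  rw [below, Finset.mem_image]
  constructor
  · rintro ⟨t, ht, rfl⟩
    obtain ⟨ht, h⟩ := Finset.mem_filter.1 ht
    cases t with
    | nil => simp at h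
    | cons j t =>
      simp only [List.head?_cons, Option.some.injEq] at h
      exact h ▸ ht
  · intro h
    exact ⟨_, Finset.mem_filter.2 ⟨h, rfl⟩, rfl⟩

variable {F c G : Forest A} {i : ℕ} {β : List ℕ → List ℕ}

/-- The iterable nodes of `F` that do not interfere with a child number `i` that is equal to `c` are
the ones of `c` and, up to the renaming `β`, the ones of `G`. -/
structure IsSplitting (F c G : Forest A) (i : ℕ) (β : List ℕ → List ℕ) : Prop where
  iterable_child : ∀ p, F.IsIterable (i :: p) ↔ c.IsIterable p
  iterable_rest : ∀ q, G.IsIterable q → F.IsIterable (β q)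
  exists_rest : ∀ t, F.IsIterable t → t.head? ≠ some i →
    (∃ q, G.IsIterable q ∧ t = β q) ∨ ∀ p, Observes (i :: p) t
  head_ne : ∀ q, G.IsIterable q → (β q).head? ≠ some i
  inj : ∀ q q', G.IsIterable q → G.IsIterable q' → β q = β q' → q = q'
  observes : ∀ q q', G.IsIterable q → G.IsIterable q' → (Observes (β q) (β q') ↔ Observes q q')
  not_observes : ∀ p q, c.IsIterable p → G.IsIterable q →
    ¬ Observes (i :: p) (β q) ∧ ¬ Observes (β q) (i :: p)

open Classical in
theorem IsSplitting.isIndependent (h : IsSplitting F c G i β) {k₁ k₂ : ℕ}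
    {T₁ T₂ : Finset (List ℕ)} (h₁ : c.IsIndependent k₁ T₁) (h₂ : G.IsIndependent k₂ T₂) :
    F.IsIndependent (k₁ + k₂) (T₁.image (i :: ·) ∪ T₂.image β) := by
  refine ⟨?_, ?_, ?_⟩
  · rw [Finset.card_union_of_disjoint, Finset.card_image_of_injective _ List.cons_injective,
      Finset.card_image_of_injOn fun q hq q' hq' => h.inj q q' (h₂.2.1 q hq) (h₂.2.1 q' hq'),
      h₁.1, h₂.1]
    refine Finset.disjoint_left.2 fun t ht ht' => ?_
    obtain ⟨p, -, rfl⟩ := Finset.mem_image.1 ht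
    obtain ⟨q, hq, h'⟩ := Finset.mem_image.1 ht'
    exact h.head_ne q (h₂.2.1 q hq) (by rw [h']; rfl)
  · intro t ht
    rcases Finset.mem_union.1 ht with ht | ht
    · obtain ⟨p, hp, rfl⟩ := Finset.mem_image.1 ht
      exact (h.iterable_child p).2 (h₁.2.1 p hp)
    · obtain ⟨q, hq, rfl⟩ := Finset.mem_image.1 ht
      exact h.iterable_rest q (h₂.2.1 q hq)
  · intro t ht s hs hne
    rcases Finset.mem_union.1 ht with ht | ht <;> rcases Finset.mem_union.1 hs with hs | hs <;>
      obtain ⟨p, hp, rfl⟩ := Finset.mem_image.1 ht <;>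
      obtain ⟨q, hq, rfl⟩ := Finset.mem_image.1 hs
    · rw [observes_cons_iff]
      exact h₁.2.2 p hp q hq fun h => hne (by rw [h])
    · exact (h.not_observes p q (h₁.2.1 p hp) (h₂.2.1 q hq)).1
    · exact (h.not_observes q p (h₁.2.1 q hq) (h₂.2.1 p hp)).2
    · rw [h.observes p q (h₂.2.1 p hp) (h₂.2.1 q hq)]
      exact h₂.2.2 p hp q hq fun h => hne (by rw [h])

open Classical in
theorem IsSplitting.below_eq (h : IsSplitting F c G i β) {k₂ : ℕ} {T₁ T₂ : Finset (List ℕ)}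
    (h₂ : G.IsIndependent k₂ T₂) : below (T₁.image (i :: ·) ∪ T₂.image β) i = T₁ := by
  ext p
  rw [mem_below, Finset.mem_union, Finset.mem_image, Finset.mem_image]
  constructor
  · rintro (⟨p', hp', h'⟩ | ⟨q, hq, h'⟩)
    · rw [List.cons.injEq] at h'
      exact h'.2 ▸ hp'
    · exact absurd (by rw [h']; rfl) (h.head_ne q (h₂.2.1 q hq))
  · intro hp
    exact Or.inl ⟨p, hp, rfl⟩

open Classical in
-- A selected node below the child rules out the second alternative of `exists_rest`, so every other
-- selected node comes from the rest.
theorem IsSplitting.exists_eq (h : IsSplitting F c G i β) {k : ℕ} {T : Finset (List ℕ)}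
    (hT : F.IsIndependent k T) (hne : (below T i).Nonempty) : ∃ k₂ T₂,
      k = (below T i).card + k₂ ∧ c.IsIndependent (below T i).card (below T i) ∧
        G.IsIndependent k₂ T₂ ∧ T = (below T i).image (i :: ·) ∪ T₂.image β := by
  have h₁ : c.IsIndependent (below T i).card (below T i) := by
    refine ⟨rfl, fun p hp => (h.iterable_child p).1 (hT.2.1 _ (mem_below.1 hp)),
      fun p hp q hq hpq => ?_⟩
    rw [← observes_cons_iff (i := i)]
    exact hT.2.2 _ (mem_below.1 hp) _ (mem_below.1 hq) (by simpa using hpq)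
  obtain ⟨p₀, hp₀⟩ := hne
  have hsub : ((T.filter fun t => t.head? ≠ some i : Finset (List ℕ)) : Set (List ℕ)) ⊆
      β '' {q | G.IsIterable q} := by
    intro t ht
    obtain ⟨ht, ht'⟩ := Finset.mem_filter.1 ht
    rcases h.exists_rest t (hT.2.1 t ht) ht' with ⟨q, hq, rfl⟩ | h'
    · exact ⟨q, hq, rfl⟩
    · exact absurd (h' p₀) (hT.2.2 _ (mem_below.1 hp₀) t ht fun h => ht' (by rw [← h]; rfl))
  obtain ⟨T₂, hT₂, hβ⟩ := Finset.subset_set_image_iff.1 hsub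
  have heq : T = (below T i).image (i :: ·) ∪ T₂.image β := by
    ext t
    rw [hβ, Finset.mem_union, Finset.mem_image, Finset.mem_filter]
    constructor
    · intro ht
      by_cases h' : t.head? = some i
      · cases t with
        | nil => simp at h'
        | cons j p =>
          simp only [List.head?_cons, Option.some.injEq] at h'
          subst h'
          exact Or.inl ⟨p, mem_below.2 ht, rfl⟩
      · exact Or.inr ⟨ht, h'⟩
    · rintro (⟨p, hp, rfl⟩ | h')
      · exact mem_below.1 hp
      · exact h'.1
  have hmem : ∀ q ∈ T₂, β q ∈ T := fun q hq => by
    rw [heq]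
    exact Finset.mem_union_right _ (Finset.mem_image_of_mem _ hq)
  have h₂ : G.IsIndependent T₂.card T₂ := by
    refine ⟨rfl, fun q hq => hT₂ hq, fun q hq q' hq' hne => ?_⟩
    rw [← h.observes q q' (hT₂ hq) (hT₂ hq')]
    exact hT.2.2 _ (hmem q hq) _ (hmem q' hq') fun h' => hne (h.inj q q' (hT₂ hq) (hT₂ hq') h')
  refine ⟨T₂.card, T₂, ?_, h₁, h₂, heq⟩
  rw [← hT.1, ← (h.isIndependent h₁ h₂).1, ← heq]

open Classical in
/-- Independent sets of nodes can be counted separately in a child that contains some of them, and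
in the rest of the forest. -/
theorem IsSplitting.ncard_eq (h : IsSplitting F c G i β) (rest : Finset (List ℕ) → Finset (List ℕ))
    (hrest : ∀ (k₂ : ℕ) (T₁ T₂ : Finset (List ℕ)), G.IsIndependent k₂ T₂ →
      rest (T₁.image (i :: ·) ∪ T₂.image β) = T₂) (P Q : Finset (List ℕ) → Prop) (k : ℕ) :
    {T | F.IsIndependent k T ∧ (below T i).Nonempty ∧ P (below T i) ∧ Q (rest T)}.ncard =
      ∑ k₁ ∈ Finset.Icc 1 k, {T | c.IsIndependent k₁ T ∧ P T}.ncard *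
        {T | G.IsIndependent (k - k₁) T ∧ Q T}.ncard := by
  have hfin : {T | F.IsIndependent k T ∧ (below T i).Nonempty ∧ P (below T i) ∧
      Q (rest T)}.Finite := (finite_isIndependent F k).subset fun T hT => hT.1
  rw [Set.ncard_eq_toFinset_card _ hfin, Finset.card_eq_sum_card_fiberwise
    (f := fun T => (below T i).card) (t := Finset.Icc 1 k)]
  · refine Finset.sum_congr rfl fun k₁ hk₁ => ?_
    obtain ⟨h₁, h₂⟩ := Finset.mem_Icc.1 hk₁
    -- Both components are recovered from the union, by `below` and by `rest`.
    have hinj : Set.InjOn (fun x : Finset (List ℕ) × Finset (List ℕ) =>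
        x.1.image (i :: ·) ∪ x.2.image β)
        ({T | c.IsIndependent k₁ T ∧ P T} ×ˢ {T | G.IsIndependent (k - k₁) T ∧ Q T}) := by
      rintro ⟨T₁, T₂⟩ hx ⟨T₁', T₂'⟩ hx' h'
      dsimp only at h'
      have e₁ := h.below_eq (T₁ := T₁) hx.2.1
      have e₂ := hrest _ T₁ T₂ hx.2.1
      rw [h'] at e₁ e₂
      rw [h.below_eq hx'.2.1] at e₁
      rw [hrest _ T₁' T₂' hx'.2.1] at e₂
      rw [e₁, e₂]
    rw [← Set.ncard_prod, ← hinj.ncard_image, ← Set.ncard_coe_finset]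
    congr 1
    ext T
    simp only [Finset.coe_filter, Set.Finite.mem_toFinset]
    constructor
    · rintro ⟨⟨hT, hne, hP, hQ⟩, hcard⟩
      obtain ⟨k₂, T₂, hk, hT₁, hT₂, heq⟩ := h.exists_eq hT hne
      refine ⟨(below T i, T₂), ⟨⟨hcard ▸ hT₁, hP⟩, ?_, ?_⟩, heq.symm⟩
      · have : k - k₁ = k₂ := by omega
        dsimp only
        rwa [this]
      · rw [heq, hrest k₂ _ T₂ hT₂] at hQ
        exact hQ
    · rintro ⟨⟨T₁, T₂⟩, ⟨⟨hT₁, hP⟩, hT₂, hQ⟩, rfl⟩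
      dsimp only at hT₁ hP hT₂ hQ ⊢
      have hI := h.isIndependent hT₁ hT₂
      rw [Nat.add_sub_cancel' h₂] at hI
      refine ⟨⟨hI, ?_, ?_, ?_⟩, ?_⟩
      · rw [h.below_eq hT₂, ← Finset.card_pos, hT₁.1]
        exact h₁
      · rwa [h.below_eq hT₂]
      · rwa [hrest _ _ _ hT₂]
      · rw [h.below_eq hT₂, hT₁.1]
  · intro T hT
    simp only [Set.Finite.coe_toFinset] at hT
    obtain ⟨k₂, T₂, hk, -⟩ := h.exists_eq hT.1 hT.2.1
    exact Finset.mem_coe.2 (Finset.mem_Icc.2 ⟨Finset.card_pos.2 hT.2.1, by dsimp only; omega⟩)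

/-- Only the second child can lose its iterability when the first one is removed. It is an adjacent
sibling of the first child, hence observed from every node below it. -/
theorem isSplitting_first (c : Forest A) (l : List (Forest A)) :
    IsSplitting (node (c :: l)) c (node l) 0 (List.modifyHead (· + 1)) where
  iterable_child p := by
    rcases eq_or_ne p [] with rfl | hp
    · rw [isIterable_singleton]
      exact ⟨fun h => absurd h.1 (lt_irrefl 0), fun h => absurd rfl h.ne_nil⟩
    · rw [isIterable_cons hp]
      simp
  iterable_rest q hq := by
    rcases q with _ | ⟨j, p⟩
    · exact absurd rfl hq.ne_nil
    · rw [List.modifyHead_cons]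
      rcases eq_or_ne p [] with rfl | hp
      · have := isIterable_singleton.1 hq
        simp only [Forest.arity] at this
        exact isIterable_singleton.2 ⟨by omega, by simp only [Forest.arity, List.length_cons]; omega⟩
      · rw [isIterable_cons hp] at hq ⊢
        simpa using hq
  exists_rest t ht h := by
    rcases t with _ | ⟨j, p⟩
    · exact absurd rfl ht.ne_nil
    · rcases j with _ | j
      · simp at h
      · rcases eq_or_ne p [] with rfl | hp
        · rcases j with _ | j
          · exact Or.inr fun p => (observes_cons_of_ne (by omega)).2 ⟨rfl, by omega⟩
          · have := isIterable_singleton.1 ht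
            simp only [Forest.arity, List.length_cons] at this
            exact Or.inl ⟨[j + 1], isIterable_singleton.2 ⟨by omega, by
              simp only [Forest.arity]; omega⟩, rfl⟩
        · rw [isIterable_cons hp] at ht
          exact Or.inl ⟨j :: p, (isIterable_cons hp).2 (by simpa using ht), rfl⟩
  head_ne q hq := by
    rcases q with _ | ⟨j, p⟩
    · exact absurd rfl hq.ne_nil
    · simp
  inj q q' hq hq' h := by
    rcases q with _ | ⟨j, p⟩
    · exact absurd rfl hq.ne_nil
    rcases q' with _ | ⟨j', p'⟩
    · exact absurd rfl hq'.ne_nil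
    simpa using h
  observes q q' hq hq' := by
    rcases q with _ | ⟨j, p⟩
    · exact absurd rfl hq.ne_nil
    rcases q' with _ | ⟨j', p'⟩
    · exact absurd rfl hq'.ne_nil
    exact observes_succ_iff
  not_observes p q hp hq := by
    rcases q with _ | ⟨j, q⟩
    · exact absurd rfl hq.ne_nil
    rw [List.modifyHead_cons, observes_cons_of_ne (by omega), observes_cons_of_ne (by omega)]
    refine ⟨?_, fun h => hp.ne_nil h.1⟩
    rintro ⟨rfl, h⟩
    have := isIterable_singleton.1 hq
    omega

/-- Here it is the last child but one that ceases to be iterable; no renaming of paths is needed. -/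
theorem isSplitting_last (l : List (Forest A)) (d : Forest A) :
    IsSplitting (node (l ++ [d])) d (node l) l.length id where
  iterable_child p := by
    rcases eq_or_ne p [] with rfl | hp
    · rw [isIterable_singleton]
      refine ⟨fun h => ?_, fun h => absurd rfl h.ne_nil⟩
      simp [Forest.arity] at h
    · rw [isIterable_cons hp]
      simp
  iterable_rest q hq := by
    rcases q with _ | ⟨j, p⟩
    · exact absurd rfl hq.ne_nil
    · rcases eq_or_ne p [] with rfl | hp
      · have := isIterable_singleton.1 hq
        simp only [Forest.arity] at this
        exact isIterable_singleton.2 ⟨by omega, by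
          simp only [Forest.arity, List.length_append, List.length_singleton]; omega⟩
      · have hlt := hq.lt
        rw [isIterable_cons hp] at hq
        rw [id, isIterable_cons hp, List.getElem?_append_left hlt]
        exact hq
  exists_rest t ht h := by
    rcases t with _ | ⟨j, p⟩
    · exact absurd rfl ht.ne_nil
    · have hlt := ht.lt
      simp only [List.head?_cons, ne_eq, Option.some.injEq, List.length_append,
        List.length_singleton] at h hlt
      rcases eq_or_ne p [] with rfl | hp
      · have := isIterable_singleton.1 ht
        simp only [Forest.arity, List.length_append, List.length_singleton] at this
        by_cases hj : l.length = j + 1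
        · exact Or.inr fun p => (observes_cons_of_ne (by omega)).2 ⟨rfl, by omega⟩
        · exact Or.inl ⟨[j], isIterable_singleton.2 ⟨by omega, by simp only [Forest.arity]; omega⟩,
            rfl⟩
      · rw [isIterable_cons hp, List.getElem?_append_left (by omega)] at ht
        exact Or.inl ⟨j :: p, (isIterable_cons hp).2 ht, rfl⟩
  head_ne q hq := by
    rcases q with _ | ⟨j, p⟩
    · exact absurd rfl hq.ne_nil
    · have := hq.lt
      simp only [id, List.head?_cons, ne_eq, Option.some.injEq]
      omega
  inj q q' _ _ h := h
  observes q q' _ _ := Iff.rfl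
  not_observes p q hp hq := by
    rcases q with _ | ⟨j, q⟩
    · exact absurd rfl hq.ne_nil
    have hlt := hq.lt
    rw [id, observes_cons_of_ne (by omega), observes_cons_of_ne (by omega)]
    refine ⟨?_, fun h => hp.ne_nil h.1⟩
    rintro ⟨rfl, h⟩
    have := isIterable_singleton.1 hq
    simp only [Forest.arity] at this
    omega

theorem dropFirst_union {k₂ : ℕ} {T₁ T₂ : Finset (List ℕ)} (h : G.IsIndependent k₂ T₂) :
    dropFirst (T₁.image (0 :: ·) ∪ T₂.image (List.modifyHead (· + 1))) = T₂ := by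
  ext t
  rw [dropFirst, Finset.mem_image]
  constructor
  · rintro ⟨s, hs, rfl⟩
    obtain ⟨hs, h'⟩ := Finset.mem_filter.1 hs
    rcases Finset.mem_union.1 hs with hs | hs
    · obtain ⟨p, -, rfl⟩ := Finset.mem_image.1 hs
      simp at h'
    · obtain ⟨q, hq, rfl⟩ := Finset.mem_image.1 hs
      rcases q with _ | ⟨j, q⟩
      · exact absurd rfl (h.2.1 _ hq).ne_nil
      · simpa using hq
  · intro ht
    refine ⟨t.modifyHead (· + 1), Finset.mem_filter.2 ⟨Finset.mem_union_right _
      (Finset.mem_image_of_mem _ ht), ?_⟩, ?_⟩ <;>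
    · rcases t with _ | ⟨j, t⟩
      · exact absurd rfl (h.2.1 _ ht).ne_nil
      · simp

theorem dropAt_union {l : List (Forest A)} {k₂ : ℕ} {T₁ T₂ : Finset (List ℕ)}
    (h : (node l).IsIndependent k₂ T₂) :
    dropAt (T₁.image (l.length :: ·) ∪ T₂.image id) l.length = T₂ := by
  ext t
  rw [dropAt, Finset.mem_filter, Finset.image_id, Finset.mem_union, Finset.mem_image]
  constructor
  · rintro ⟨⟨p, -, rfl⟩ | h, h'⟩
    · simp at h'
    · exact h
  · intro ht
    refine ⟨Or.inr ht, ?_⟩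
    rcases t with _ | ⟨j, t⟩
    · simp
    · have := (h.2.1 _ ht).lt
      simp only [List.head?_cons, ne_eq, Option.some.injEq]
      omega

end Splitting

/-! ### Rational functions that extract the first and last trees of a forest -/

section Extraction

open Forest Bracketed

theorem filt_eq_nil {A B : Type*} {N : Type} [Monoid N] {ν : FreeMonoid A →* N}
    {out : N → A → N → Option B} {p q : N} {w : List A} (h : ∀ u a v, w = u ++ a :: v →
      out (p * ν (FreeMonoid.ofList u)) a (ν (FreeMonoid.ofList v) * q) = none) :
    filt ν out p q w = [] := by
  induction w generalizing p with
  | nil => rfl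
  | cons a w ih =>
    rw [filt, ih fun u b v huv => ?_]
    · have := h [] a w rfl
      simp only [FreeMonoid.ofList_nil, map_one, mul_one] at this
      simp [this]
    · have := h (a :: u) b v (by simp [huv])
      rwa [FreeMonoid.ofList_cons, map_mul, ← mul_assoc] at this

theorem filt_eq_self {A : Type*} {N : Type} [Monoid N] {ν : FreeMonoid A →* N}
    {out : N → A → N → Option A} {p q : N} {w : List A} (h : ∀ u a v, w = u ++ a :: v →
      out (p * ν (FreeMonoid.ofList u)) a (ν (FreeMonoid.ofList v) * q) = some a) :
    filt ν out p q w = w := by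
  induction w generalizing p with
  | nil => rfl
  | cons a w ih =>
    rw [filt, ih fun u b v huv => ?_]
    · have := h [] a w rfl
      simp only [FreeMonoid.ofList_nil, map_one, mul_one] at this
      simp [this]
    · have := h (a :: u) b v (by simp [huv])
      rwa [FreeMonoid.ofList_cons, map_mul, ← mul_assoc] at this

open Classical in
/-- A bimachine can keep a factor that is characterized by the values at its positions. -/
theorem exists_rational_factor {B : Type*} {N : Type} [Monoid N] [Finite N]
    (ν : FreeMonoid B →* N) (S : N → B → N → Prop) (P : List B → B → List B → Prop)
    (hP : ∀ u b v, P u b v ↔ S (ν (FreeMonoid.ofList u)) b (ν (FreeMonoid.ofList v))) :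
    ∃ σ : List B → List B, IsRational σ ∧ ∀ x y z : List B,
      (∀ u b v, x = u ++ b :: v → ¬ P u b (v ++ (y ++ z))) →
      (∀ u b v, y = u ++ b :: v → P (x ++ u) b (v ++ z)) →
      (∀ u b v, z = u ++ b :: v → ¬ P (x ++ (y ++ u)) b v) → σ (x ++ (y ++ z)) = y := by
  refine ⟨_, ⟨N, inferInstance, inferInstance, ν, fun p b q => if S p b q then some b else none,
    fun _ => rfl⟩, fun x y z hx hy hz => ?_⟩
  simp only [hP, FreeMonoid.ofList_append, map_mul] at hx hy hz
  rw [filt_append, filt_append, filt_eq_nil, filt_eq_self, filt_eq_nil, List.nil_append,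
    List.append_nil]
  · intro u b v h
    rw [if_neg]
    simpa [FreeMonoid.ofList_append, mul_assoc] using hz u b v h
  · intro u b v h
    rw [if_pos]
    simpa [FreeMonoid.ofList_append, mul_assoc] using hy u b v h
  · intro u b v h
    rw [if_neg]
    simpa [FreeMonoid.ofList_append, mul_assoc] using hx u b v h

theorem exists_rational_of_prefix {B : Type*} {P Q : List B → Prop} (hP : Reg P) (hQ : Reg Q) :
    ∃ σ : List B → List B, IsRational σ ∧ ∀ x y z : List B,
      (∀ u b v, x = u ++ b :: v → ¬ (P u ∧ Q (u ++ [b]))) →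
      (∀ u b v, y = u ++ b :: v → P (x ++ u) ∧ Q (x ++ (u ++ [b]))) →
      (∀ u b v, z = u ++ b :: v → ¬ (P (x ++ (y ++ u)) ∧ Q (x ++ (y ++ (u ++ [b]))))) →
      σ (x ++ (y ++ z)) = y := by
  obtain ⟨N, _, _, φ, S, hS⟩ := hP.exists_hom
  obtain ⟨N', _, _, ψ, S', hS'⟩ := hQ.exists_hom
  obtain ⟨σ, hσ, h⟩ := exists_rational_factor (φ.prod ψ)
    (fun p b _ => S p.1 ∧ S' (p.2 * ψ (FreeMonoid.of b))) (fun u b _ => P u ∧ Q (u ++ [b]))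
    fun u b v => by rw [hS, hS', FreeMonoid.ofList_append, map_mul]; rfl
  exact ⟨σ, hσ, fun x y z hx hy hz => h x y z hx (by simpa using hy) (by simpa using hz)⟩

theorem exists_rational_of_suffix {B : Type*} {P Q : List B → Prop} (hP : Reg P) (hQ : Reg Q) :
    ∃ σ : List B → List B, IsRational σ ∧ ∀ x y z : List B,
      (∀ u b v, x = u ++ b :: v → ¬ (P (v ++ (y ++ z)) ∧ Q (b :: (v ++ (y ++ z))))) →
      (∀ u b v, y = u ++ b :: v → P (v ++ z) ∧ Q (b :: (v ++ z))) →
      (∀ u b v, z = u ++ b :: v → ¬ (P v ∧ Q (b :: v))) → σ (x ++ (y ++ z)) = y := by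
  obtain ⟨N, _, _, φ, S, hS⟩ := hP.exists_hom
  obtain ⟨N', _, _, ψ, S', hS'⟩ := hQ.exists_hom
  exact exists_rational_factor (φ.prod ψ)
    (fun _ b q => S q.1 ∧ S' (ψ (FreeMonoid.of b) * q.2)) (fun _ b v => P v ∧ Q (b :: v))
    fun u b v => by rw [hS, hS', FreeMonoid.ofList_cons, map_mul]; rfl

variable {A : Type u}

/-- A non-empty prefix is balanced, up to a modulus. -/
def BalancedPrefix (K : ℕ) : List (Bracketed A) → Prop :=
  Cat (fun s => ¬ s = [] ∧ (depth s : ZMod (K + 1)) = 0) fun _ => True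

/-- A non-empty suffix is balanced, up to a modulus. -/
def BalancedSuffix (K : ℕ) : List (Bracketed A) → Prop :=
  Cat (fun _ => True) fun s => ¬ s = [] ∧ (depth s : ZMod (K + 1)) = 0

theorem reg_balancedPrefix (K : ℕ) : Reg (BalancedPrefix (A := A) K) :=
  (Reg.eq_nil.not.and (Reg.depth_eq (K + 1) 0)).cat (Reg.const True)

theorem reg_balancedSuffix (K : ℕ) : Reg (BalancedSuffix (A := A) K) :=
  (Reg.const True).cat (Reg.eq_nil.not.and (Reg.depth_eq (K + 1) 0))

/-- Bracket depths of absolute value at most `K` may be compared with 0 modulo `K + 1`. -/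
theorem intCast_ne_zero {K : ℕ} {a : ℤ} (h₁ : a ≠ 0) (h₂ : |a| ≤ K) : (a : ZMod (K + 1)) ≠ 0 := by
  intro h
  rw [ZMod.intCast_zmod_eq_zero_iff_dvd] at h
  have h₃ := Int.le_of_dvd (abs_pos.2 h₁) ((dvd_abs _ _).2 h)
  push_cast at h₃
  omega

/-- Until the first tree is closed, the depth stays between 1 and `K`. -/
theorem not_balancedPrefix {K : ℕ} {c : Forest A} (hK : c.height + 1 ≤ K)
    {u v : List (Bracketed A)} (h : c.encode = u ++ v) : ¬ BalancedPrefix K (opening :: u) := by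
  rintro ⟨s, t, hst, ⟨hs, hd⟩, -⟩
  rcases s with _ | ⟨b, s⟩
  · exact hs rfl
  · simp only [List.cons_append, List.cons.injEq] at hst
    obtain ⟨rfl, rfl⟩ := hst
    rw [List.append_assoc] at h
    have := depth_prefix c h
    rw [depth_opening] at hd
    refine intCast_ne_zero ?_ ?_ hd
    · omega
    · rw [abs_of_nonneg] <;> omega

theorem not_balancedSuffix {K : ℕ} {c : Forest A} (hK : c.height + 1 ≤ K)
    {u v : List (Bracketed A)} (h : c.encode = u ++ v) : ¬ BalancedSuffix K (v ++ [closing]) := by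
  rintro ⟨t, s, hst, -, hs, hd⟩
  rcases List.eq_nil_or_concat s with rfl | ⟨s, b, rfl⟩
  · exact hs rfl
  · rw [List.concat_eq_append, ← List.append_assoc] at hst
    obtain ⟨rfl, hb⟩ := List.append_inj' hst rfl
    obtain rfl := List.singleton_inj.1 hb
    rw [← List.append_assoc] at h
    have h₁ := depth_prefix c h
    have h₂ := congrArg depth h
    rw [depth_encode, depth_append] at h₂
    rw [List.concat_eq_append, depth_append, depth_closing, depth_nil] at hd
    refine intCast_ne_zero ?_ ?_ hd
    · omega
    · rw [abs_of_nonpos] <;> omega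

theorem balancedPrefix_append (K : ℕ) (c : Forest A) (u : List (Bracketed A)) :
    BalancedPrefix K (opening :: (c.encode ++ [closing]) ++ u) :=
  ⟨_, u, rfl, ⟨by simp, by simp⟩, trivial⟩

theorem balancedSuffix_append (K : ℕ) (c : Forest A) (u : List (Bracketed A)) :
    BalancedSuffix K (u ++ opening :: (c.encode ++ [closing])) :=
  ⟨u, _, rfl, trivial, by simp, by simp⟩

theorem cons_eq_append_cons {B : Type*} {b c : B} {x u v : List B} (h : b :: x = u ++ c :: v) :
    u = [] ∨ ∃ u', u = b :: u' ∧ x = u' ++ c :: v := by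
  rcases u with _ | ⟨d, u⟩
  · exact Or.inl rfl
  · simp only [List.cons_append, List.cons.injEq] at h
    exact Or.inr ⟨u, by rw [h.1], h.2⟩

theorem append_eq_append_cons {B : Type*} {b c : B} {x u v : List B}
    (h : x ++ [b] = u ++ c :: v) : v = [] ∨ ∃ v', v = v' ++ [b] ∧ x = u ++ c :: v' := by
  rcases List.eq_nil_or_concat v with rfl | ⟨v, d, rfl⟩
  · exact Or.inl rfl
  · rw [List.concat_eq_append, ← List.cons_append, ← List.append_assoc] at h
    obtain ⟨h₁, h₂⟩ := List.append_inj' h rfl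
    exact Or.inr ⟨v, by rw [List.concat_eq_append, h₂], h₁⟩

/-- The positions kept are those after the first one that are reached before the depth returns to 0.
-/
theorem exists_rational_first (A : Type u) (K : ℕ) :
    ∃ σ : List (Bracketed A) → List (Bracketed A), IsRational σ ∧
      ∀ (c : Forest A) l, c.height + 1 ≤ K → σ (node (c :: l)).encode = c.encode := by
  obtain ⟨σ, hσ, h⟩ := exists_rational_of_prefix (Reg.eq_nil (B := Bracketed A)).not
    (reg_balancedPrefix K).not
  refine ⟨σ, hσ, fun c l hK => ?_⟩
  have e : (node (c :: l)).encode = [opening] ++ (c.encode ++ (closing :: (node l).encode)) :=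
    encode_cons c l
  rw [e]
  refine h _ _ _ (fun u b v huv => ?_) (fun u b v huv => ⟨by simp, ?_⟩) fun u b v huv => ?_
  · rcases cons_eq_append_cons huv with rfl | ⟨u, rfl, hu⟩
    · simp
    · simp at hu
  · exact not_balancedPrefix hK (u := u ++ [b]) (v := v) (by simp [huv])
  · rintro ⟨-, h⟩
    refine h ?_
    rcases cons_eq_append_cons huv with rfl | ⟨u, rfl, hu⟩
    · simp only [List.nil_append, List.cons.injEq] at huv
      rw [← huv.1]
      simpa using balancedPrefix_append K c []
    · simpa using balancedPrefix_append K c (u ++ [b])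

/-- The positions kept are those before which the depth has already returned to 0. -/
theorem exists_rational_tail (A : Type u) (K : ℕ) :
    ∃ σ : List (Bracketed A) → List (Bracketed A), IsRational σ ∧
      ∀ (c : Forest A) l, c.height + 1 ≤ K → σ (node (c :: l)).encode = (node l).encode := by
  obtain ⟨σ, hσ, h⟩ := exists_rational_of_prefix (reg_balancedPrefix (A := A) K) (Reg.const True)
  refine ⟨σ, hσ, fun c l hK => ?_⟩
  have e : (node (c :: l)).encode =
      opening :: (c.encode ++ [closing]) ++ ((node l).encode ++ []) := by simp [encode_cons]
  rw [e]
  refine h _ _ _ (fun u b v huv => ?_) (fun u b v huv => ⟨balancedPrefix_append K c u, trivial⟩)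
    fun u b v huv => by simp at huv
  rintro ⟨hu, -⟩
  rcases cons_eq_append_cons huv with rfl | ⟨u, rfl, hu'⟩
  · obtain ⟨s, t, hst, ⟨hs, -⟩, -⟩ := hu
    exact hs (List.append_eq_nil_iff.1 hst.symm).1
  · rcases append_eq_append_cons hu' with rfl | ⟨v, rfl, hv⟩
    · obtain ⟨h₁, -⟩ := List.append_inj' hu' rfl
      exact not_balancedPrefix hK (u := u) (v := []) (by simp [h₁]) hu
    · exact not_balancedPrefix hK hv hu

/-- Mirror image of the first tree, with suffixes in place of prefixes. -/
theorem exists_rational_last (A : Type u) (K : ℕ) :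
    ∃ σ : List (Bracketed A) → List (Bracketed A), IsRational σ ∧
      ∀ l (d : Forest A), d.height + 1 ≤ K → σ (node (l ++ [d])).encode = d.encode := by
  obtain ⟨σ, hσ, h⟩ := exists_rational_of_suffix (Reg.eq_nil (B := Bracketed A)).not
    (reg_balancedSuffix K).not
  refine ⟨σ, hσ, fun l d hK => ?_⟩
  have e : (node (l ++ [d])).encode = ((node l).encode ++ [opening]) ++ (d.encode ++ [closing]) := by
    rw [encode_append, encode_singleton]
    simp
  rw [e]
  refine h _ _ _ (fun u b v huv => ?_) (fun u b v huv => ⟨by simp, ?_⟩) fun u b v huv => ?_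
  · rintro ⟨-, h⟩
    refine h ?_
    rcases append_eq_append_cons huv with rfl | ⟨v, rfl, hv⟩
    · obtain ⟨-, h₁⟩ := List.append_inj' huv rfl
      rw [← List.singleton_inj.1 h₁]
      simpa using balancedSuffix_append K d []
    · simpa using balancedSuffix_append K d (b :: v)
  · exact not_balancedSuffix hK (u := u) (v := b :: v) huv
  · rcases cons_eq_append_cons huv with rfl | ⟨u, rfl, hu⟩
    · simp only [List.nil_append, List.cons.injEq] at huv
      rw [← huv.2]
      simp
    · simp at hu

theorem exists_rational_init (A : Type u) (K : ℕ) :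
    ∃ σ : List (Bracketed A) → List (Bracketed A), IsRational σ ∧
      ∀ l (d : Forest A), d.height + 1 ≤ K → σ (node (l ++ [d])).encode = (node l).encode := by
  obtain ⟨σ, hσ, h⟩ := exists_rational_of_suffix (reg_balancedSuffix (A := A) K) (Reg.const True)
  refine ⟨σ, hσ, fun l d hK => ?_⟩
  have e : (node (l ++ [d])).encode =
      [] ++ ((node l).encode ++ (opening :: (d.encode ++ [closing]))) := by
    rw [encode_append, encode_singleton]
    simp
  rw [e]
  refine h _ _ _ (fun u b v huv => by simp at huv)
    (fun u b v huv => ⟨balancedSuffix_append K d v, trivial⟩) fun u b v huv => ?_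
  rintro ⟨hv, -⟩
  have key : ¬ BalancedSuffix K ([] : List (Bracketed A)) := by
    rintro ⟨s, t, hst, -, ht, -⟩
    exact ht (List.append_eq_nil_iff.1 hst.symm).2
  rcases cons_eq_append_cons huv with rfl | ⟨u, rfl, hu'⟩
  · simp only [List.nil_append, List.cons.injEq] at huv
    rw [← huv.2] at hv
    exact not_balancedSuffix hK (u := []) rfl hv
  · rcases append_eq_append_cons hu' with rfl | ⟨v, rfl, hv'⟩
    · exact key hv
    · exact not_balancedSuffix hK (u := u ++ [b]) (v := v) (by simp [hv']) hv

end Extraction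

/-! ### Architectures -/

section Architectures

open Forest Bracketed

variable {A : Type u} {M : Type v} [Monoid M] {μ : FreeMonoid A →* M} {K : ℕ}

theorem Forest.IsFactorizationLE.of_append {l₁ l₂ : List (Forest A)}
    (h : (node (l₁ ++ l₂)).IsFactorizationLE μ K) :
    (node l₁).IsFactorizationLE μ K ∧ (node l₂).IsFactorizationLE μ K := by
  have key : ∀ l : List (Forest A), (∀ c ∈ l, c ∈ l₁ ++ l₂) → l.length ≤ (l₁ ++ l₂).length →
      (node l).IsFactorizationLE μ K := by
    intro l hl hlen
    obtain ⟨h₁, h₂⟩ := h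
    rw [isFactorization_node] at h₁
    refine ⟨(isFactorization_node μ).2 ⟨fun c hc => h₁.1 c (hl c hc), fun h₃ => ?_⟩,
      height_node_le_iff.2 fun c hc => height_node_le_iff.1 h₂ c (hl c hc)⟩
    obtain ⟨e, he, h₄⟩ := h₁.2 (h₃.trans hlen)
    exact ⟨e, he, fun c hc => h₄ c (hl c hc)⟩
  exact ⟨key l₁ (fun c hc => by simp [hc]) (by simp), key l₂ (fun c hc => by simp [hc]) (by simp)⟩

theorem Forest.IsFactorizationLE.of_mem' {l : List (Forest A)}
    (h : (node l).IsFactorizationLE μ K) {c : Forest A} (hc : c ∈ l) :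
    c.height + 1 ≤ K ∧ c.IsFactorizationLE μ K := by
  have h₁ := height_node_le_iff.1 h.2 c hc
  exact ⟨h₁, (((isFactorization_node μ).1 h.1).1 c hc).1, by omega⟩

theorem arch_letter (a : A) (T : Finset (List ℕ)) :
    (Forest.letter a).arch μ T = [Block.letter a] := by rw [arch]

theorem arch_nil (T : Finset (List ℕ)) : (node ([] : List (Forest A))).arch μ T = [] := by rw [arch]

theorem arch_first {c : Forest A} {l : List (Forest A)} {T : Finset (List ℕ)}
    (h : (below T 0).Nonempty) : (node (c :: l)).arch μ T =
      Block.node (c.arch μ (below T 0)) :: (node l).arch μ (dropFirst T) := by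
  rw [arch, if_neg, if_pos h]
  rintro rfl
  simp [below] at h

theorem arch_last {c : Forest A} {l : List (Forest A)} {d : Forest A} {T : Finset (List ℕ)}
    (h : ¬ (below T 0).Nonempty) (h' : (below T (l.length + 1)).Nonempty) :
    (node (c :: (l ++ [d]))).arch μ T = (node (c :: l)).arch μ (dropAt T (l.length + 1)) ++
      [Block.node (d.arch μ (below T (l.length + 1)))] := by
  have e₁ : (c :: (l ++ [d])).dropLast = c :: l := by
    rw [← List.cons_append, List.dropLast_concat]
  have e₂ : (c :: (l ++ [d])).getLast (List.cons_ne_nil _ _) = d := by simp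
  have e₃ : (l ++ [d]).length = l.length + 1 := by simp
  rw [arch, if_neg, if_neg h, e₃, if_pos h', e₁, e₂]
  rintro rfl
  simp [below] at h'

theorem arch_types {c : Forest A} {l : List (Forest A)} {T : Finset (List ℕ)} (hT : T ≠ ∅)
    (h : ¬ (below T 0).Nonempty) (h' : ¬ (below T l.length).Nonempty) :
    (node (c :: l)).arch μ T = [Block.types ((node (c :: l)).types μ T)] := by
  rw [arch, if_neg hT, if_neg h, if_neg h']

theorem arch_empty (c : Forest A) (l : List (Forest A)) :
    (node (c :: l)).arch μ ∅ = [Block.value ((node (c :: l)).value μ)] := by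
  rw [arch, if_pos rfl]

theorem below_dropAt {T : Finset (List ℕ)} {i j : ℕ} (hij : i ≠ j) :
    below (dropAt T j) i = below T i := by
  ext p
  rw [mem_below, mem_below, dropAt, Finset.mem_filter]
  simp [hij]

/-- If no selected node lies in the first tree, then the architecture does not start with an
architecture between brackets. -/
theorem exists_arch_eq_cons (c : Forest A) (l : List (Forest A)) (T : Finset (List ℕ))
    (h : ¬ (below T 0).Nonempty) :
    ∃ b 𝔸, (node (c :: l)).arch μ T = b :: 𝔸 ∧ ∀ 𝔹, b ≠ Block.node 𝔹 := by
  induction l using List.reverseRecOn generalizing T with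
  | nil =>
    by_cases hT : T = ∅
    · subst hT
      exact ⟨_, _, arch_empty c [], by simp⟩
    · exact ⟨_, _, arch_types hT h (by simpa using h), by simp⟩
  | append_singleton l d ih =>
    by_cases hT : T = ∅
    · subst hT
      exact ⟨_, _, arch_empty c _, by simp⟩
    · by_cases h' : (below T (l.length + 1)).Nonempty
      · obtain ⟨b, 𝔸, hb, hb'⟩ := ih (dropAt T (l.length + 1))
          (by rwa [below_dropAt (Nat.succ_ne_zero _).symm])
        exact ⟨b, _, by rw [arch_last h h', hb, List.cons_append], hb'⟩
      · exact ⟨_, _, arch_types hT h (by simpa using h'), by simp⟩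

/-- The shape of an architecture reveals which case of its definition produced it; the three shapes
exclude each other. -/
theorem arch_cases (c : Forest A) (l : List (Forest A)) {T : Finset (List ℕ)} (hT : T ≠ ∅) :
    (∃ 𝔸 𝔸', (node (c :: l)).arch μ T = Block.node 𝔸 :: 𝔸') ∨
      (∃ b 𝔸 𝔸', (∀ 𝔹, b ≠ Block.node 𝔹) ∧
        (node (c :: l)).arch μ T = b :: 𝔸 ++ [Block.node 𝔸']) ∨
      ((node (c :: l)).arch μ T = [Block.types ((node (c :: l)).types μ T)] ∧
        ¬ (below T 0).Nonempty ∧ ¬ (below T l.length).Nonempty) := by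
  by_cases h : (below T 0).Nonempty
  · exact Or.inl ⟨_, _, arch_first h⟩
  · by_cases h' : (below T l.length).Nonempty
    · rcases List.eq_nil_or_concat l with rfl | ⟨l, d, rfl⟩
      · exact absurd h' h
      · rw [List.concat_eq_append] at h' ⊢
        rw [List.length_append, List.length_singleton] at h'
        obtain ⟨b, 𝔸, hb, hb'⟩ := exists_arch_eq_cons (μ := μ) c l (dropAt T (l.length + 1))
          (by rwa [below_dropAt (Nat.succ_ne_zero _).symm])
        exact Or.inr (Or.inl ⟨b, 𝔸, _, hb', by rw [arch_last h h', hb]⟩)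
    · exact Or.inr (Or.inr ⟨arch_types hT h h', h, h'⟩)

/-- By `exists_arch_eq_cons`, a leading bracketed architecture occurs only if the first child
contains selected nodes. -/
theorem ncard_arch_first (c : Forest A) (l : List (Forest A)) (k : ℕ) (𝔸 𝔸' : Architecture A M) :
    {T : Finset (List ℕ) | (node (c :: l)).IsIndependent k T ∧
      (node (c :: l)).arch μ T = Block.node 𝔸 :: 𝔸'}.ncard =
    ∑ k₁ ∈ Finset.Icc 1 k, {T : Finset (List ℕ) | c.IsIndependent k₁ T ∧ c.arch μ T = 𝔸}.ncard *
      {T : Finset (List ℕ) | (node l).IsIndependent (k - k₁) T ∧ (node l).arch μ T = 𝔸'}.ncard := by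
  rw [← (isSplitting_first c l).ncard_eq dropFirst (fun k₂ T₁ T₂ h => dropFirst_union h)
    (fun T => c.arch μ T = 𝔸) (fun T => (node l).arch μ T = 𝔸') k]
  congr 1
  ext T
  refine and_congr_right fun _ => ⟨fun h => ?_, fun ⟨h₁, h₂, h₃⟩ => ?_⟩
  · have hne : (below T 0).Nonempty := by
      by_contra hn
      obtain ⟨b, 𝔹, hb, hb'⟩ := exists_arch_eq_cons (μ := μ) c l T hn
      rw [h, List.cons.injEq] at hb
      exact hb' _ hb.1.symm
    rw [arch_first hne, List.cons.injEq, Block.node.injEq] at h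
    exact ⟨hne, h⟩
  · rw [arch_first h₁, h₂, h₃]

/-- As `b` is not a bracketed architecture, no selected node lies in the first child; as the word
has two blocks or more, it is neither a value nor a multiset of types. Only the case of the last
child remains. -/
theorem ncard_arch_last (l : List (Forest A)) (d : Forest A) (k : ℕ) (b : Block A M)
    (hb : ∀ 𝔹, b ≠ Block.node 𝔹) (𝔸 𝔸' : Architecture A M) :
    {T : Finset (List ℕ) | (node (l ++ [d])).IsIndependent k T ∧
      (node (l ++ [d])).arch μ T = b :: 𝔸 ++ [Block.node 𝔸']}.ncard =
    ∑ k₁ ∈ Finset.Icc 1 k, {T : Finset (List ℕ) | d.IsIndependent k₁ T ∧ d.arch μ T = 𝔸'}.ncard *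
      {T : Finset (List ℕ) | (node l).IsIndependent (k - k₁) T ∧
        (node l).arch μ T = b :: 𝔸}.ncard := by
  rw [← (isSplitting_last l d).ncard_eq (fun T => dropAt T l.length)
    (fun k₂ T₁ T₂ h => dropAt_union h)
    (fun T => d.arch μ T = 𝔸') (fun T => (node l).arch μ T = b :: 𝔸) k]
  congr 1
  ext T
  refine and_congr_right fun _ => ?_
  have hlen : ∀ x : Block A M, [x] ≠ b :: 𝔸 ++ [Block.node 𝔸'] := by
    intro x h
    have := congrArg List.length h
    simp at this
  rcases l with _ | ⟨c, l⟩
  -- With a single child, the last child is also the first, and the first takes precedence.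
  · constructor
    · intro h
      rw [List.nil_append] at h
      by_cases hT : T = ∅
      · subst hT
        rw [arch_empty] at h
        exact absurd h (hlen _)
      · by_cases h' : (below T 0).Nonempty
        · rw [arch_first h', List.cons_append, List.cons.injEq] at h
          exact absurd h.1.symm (hb _)
        · rw [arch_types hT h' (by simpa using h')] at h
          exact absurd h (hlen _)
    · rintro ⟨-, -, h⟩
      rw [arch_nil] at h
      simp at h
  · rw [List.cons_append, List.length_cons]
    constructor
    · intro h
      by_cases hT : T = ∅
      · subst hT
        rw [arch_empty] at h
        exact absurd h (hlen _)
      · by_cases h' : (below T 0).Nonempty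
        · rw [arch_first h', List.cons_append, List.cons.injEq] at h
          exact absurd h.1.symm (hb _)
        · by_cases h'' : (below T (l.length + 1)).Nonempty
          · rw [arch_last h' h''] at h
            obtain ⟨h₁, h₂⟩ := List.append_inj' h rfl
            exact ⟨h'', by simpa using h₂, h₁⟩
          · rw [arch_types hT h' (by simpa using h'')] at h
            exact absurd h (hlen _)
    · rintro ⟨h₁, h₂, h₃⟩
      have h' : ¬ (below T 0).Nonempty := by
        intro h'
        rw [arch_first (by rwa [below_dropAt (Nat.succ_ne_zero _).symm]), List.cons.injEq] at h₃
        exact hb _ h₃.1.symm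
      rw [arch_last h' h₁, h₂, h₃]

theorem types_eq_of_arch_eq {F : Forest A} {T : Finset (List ℕ)} {𝕋 : Multiset (NodeType A M)}
    (h : F.arch μ T = [Block.types 𝕋]) :
    F.types μ T = 𝕋 ∧ ∃ c l, F = node (c :: l) ∧ T ≠ ∅ ∧ ¬ (below T 0).Nonempty ∧
      ¬ (below T l.length).Nonempty := by
  rcases F with a | (_ | ⟨c, l⟩)
  · simp [arch_letter] at h
  · simp [arch_nil] at h
  · rcases eq_or_ne T ∅ with rfl | hT
    · simp [arch_empty] at h
    · rcases arch_cases (μ := μ) c l hT with ⟨𝔸, 𝔸', h'⟩ | ⟨b, 𝔸, 𝔸', -, h'⟩ | ⟨h', h₁, h₂⟩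
      · simp [h'] at h
      · have := congrArg List.length (h'.symm.trans h)
        simp at this
      · rw [h'] at h
        simp only [List.cons.injEq, Block.types.injEq, and_true] at h
        exact ⟨h, c, l, rfl, hT, h₁, h₂⟩

theorem card_of_arch_eq {F : Forest A} {k : ℕ} {T : Finset (List ℕ)}
    {𝕋 : Multiset (NodeType A M)} (hT : F.IsIndependent k T) (h : F.arch μ T = [Block.types 𝕋]) :
    k = 𝕋.card := by
  rw [← (types_eq_of_arch_eq h).1, types, Multiset.card_map, ← hT.1]
  rfl

/-- The architectures that consist of the types of the selected nodes. -/
theorem count_types_eq (μ : FreeMonoid A →* M) (K : ℕ) {𝕋 : Multiset (NodeType A M)}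
    {τ : NodeType A M} (hτ : τ ∈ 𝕋) : count μ K 𝕋.card [Block.types 𝕋] =
      countTypes μ K (τ.1.left * μ (FreeMonoid.ofList τ.1.word) * τ.1.right) 𝕋 := by
  classical
  funext w
  refine onForests_congr (fun F hF => ?_) w
  -- 𝕋 is non-empty, so some selected node is interior, which forces three children; its type τ
  -- gives the value of the forest by `NodeAt.value_eq`.
  have key : ∀ T : Finset (List ℕ), F.IsIndependent 𝕋.card T → F.arch μ T = [Block.types 𝕋] →
      (3 ≤ F.arity ∧ F.value μ = τ.1.left * μ (FreeMonoid.ofList τ.1.word) * τ.1.right) ∧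
        ∀ t ∈ T, IsInterior F t := by
    intro T hT h
    obtain ⟨h₁, c, l, rfl, hne, h₂, h₃⟩ := types_eq_of_arch_eq h
    have hint : ∀ t ∈ T, IsInterior (node (c :: l)) t := by
      intro t ht
      have hit := hT.2.1 t ht
      rcases t with _ | ⟨i, p⟩
      · exact absurd rfl hit.ne_nil
      · have hlt := hit.lt
        have hi₁ : i ≠ 0 := by
          rintro rfl
          exact h₂ ⟨p, mem_below.2 ht⟩
        have hi₂ : i ≠ l.length := by
          rintro rfl
          exact h₃ ⟨p, mem_below.2 ht⟩
        simp only [List.length_cons] at hlt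
        exact ⟨i, p, rfl, by omega, by simp only [Forest.arity, List.length_cons]; omega⟩
    rw [← h₁] at hτ
    obtain ⟨t, ht, rfl⟩ := Multiset.mem_map.1 hτ
    obtain ⟨i, p, -, hi, hi'⟩ := hint t ht
    obtain ⟨pre, G, post, hn⟩ := (hT.2.1 t ht).isNode
    exact ⟨⟨by omega, hn.value_eq hF.1⟩, hint⟩
  split_ifs with h
  · congr 1
    ext T
    refine and_congr_right fun hT => ⟨fun h' => ⟨(key T hT h').2, (types_eq_of_arch_eq h').1⟩, ?_⟩
    rintro ⟨hint, rfl⟩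
    rcases F with a | (_ | ⟨c, l⟩)
    · simp [Forest.arity] at h
    · simp [Forest.arity] at h
    · refine arch_types ?_ ?_ ?_
      · rintro rfl
        simp [types] at hτ
      · rintro ⟨p, hp⟩
        obtain ⟨i, q, h₁, h₂, -⟩ := hint _ (mem_below.1 hp)
        simp only [List.cons.injEq] at h₁
        omega
      · rintro ⟨p, hp⟩
        obtain ⟨i, q, h₁, -, h₂⟩ := hint _ (mem_below.1 hp)
        simp only [List.cons.injEq, Forest.arity, List.length_cons] at h₁ h₂
        omega
  · rw [show {T : Finset (List ℕ) | F.IsIndependent 𝕋.card T ∧ F.arch μ T = [Block.types 𝕋]} = ∅ from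
      Set.eq_empty_of_forall_notMem fun T hT => h (key T hT.1 hT.2).1, Set.ncard_empty]

theorem count_eq_zero {k : ℕ} {𝔸 : Architecture A M}
    (h : ∀ (F : Forest A) T, F.IsIndependent k T → F.arch μ T ≠ 𝔸) (w : List (Bracketed A)) :
    count μ K k 𝔸 w = 0 := by
  unfold count onForests
  split_ifs
  · exact (congrArg Set.ncard
      (Set.eq_empty_of_forall_notMem fun T hT => h _ T hT.1 hT.2)).trans (Set.ncard_empty _)
  · rfl

theorem isIndependent_ne_empty {F : Forest A} {k : ℕ} (hk : k ≠ 0) {T : Finset (List ℕ)}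
    (hT : F.IsIndependent k T) : T ≠ ∅ ∧ ∃ c l, F = node (c :: l) := by
  have hne : T ≠ ∅ := by
    rintro rfl
    exact hk hT.1.symm
  obtain ⟨t, ht⟩ := Finset.nonempty_iff_ne_empty.2 hne
  refine ⟨hne, ?_⟩
  rcases F with a | (_ | ⟨c, l⟩)
  · exact absurd (hT.2.1 t ht) (not_isIterable_letter a t)
  · exact absurd (hT.2.1 t ht) (not_isIterable_nil t)
  · exact ⟨c, l, rfl⟩

variable [Finite M]

open Classical in
-- Only the empty set is counted, and its architecture is read off the encoding: empty, a single
-- letter, or longer with a value in the monoid.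
theorem decomp_count_zero (μ : FreeMonoid A →* M) (K : ℕ) (𝔸 : Architecture A M) :
    Decomp (count μ K 0 𝔸) 0 := by
  have hR : Reg (Enc fun F : Forest A => F.IsFactorizationLE μ K ∧ F.arch μ ∅ = 𝔸) := by
    refine ((Reg.isFactorizationLE μ K).enc_word
      (((Reg.const (𝔸 = [])).and (Reg.eq_nil (B := Bracketed A))).or
        ((Reg.singleton fun b => ∃ a, b = Bracketed.letter a ∧ 𝔸 = [Block.letter a]).or
          ((Reg.eq_nil.not.and (Reg.singleton fun b => ∃ a, b = Bracketed.letter a).not).and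
            (Reg.of_hom (hat μ) fun m => 𝔸 = [Block.value m]))))).enc_congr fun F =>
              and_congr_right fun hF => ?_
    rcases F with a | (_ | ⟨c, l⟩)
    · simp [arch_letter, eq_comm]
    · simp [arch_nil, eq_comm]
    · rw [arch_empty, hat_encode]
      have h₁ : (node (c :: l)).encode ≠ [] := by simp [encode_cons]
      have h₂ : ∀ b, (node (c :: l)).encode ≠ [b] := by
        intro b h
        have := congrArg List.length h
        simp [encode_cons] at this
      simp [h₁, h₂, eq_comm]
  refine (Decomp.indicator hR).congr fun w => ?_
  by_cases hw : ∃ F : Forest A, F.IsFactorizationLE μ K ∧ F.encode = w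
  · obtain ⟨F, hF, rfl⟩ := hw
    rw [count, onForests_encode μ K _ F hF]
    simp only [enc_encode]
    have h₀ : F.IsIndependent 0 ∅ := ⟨rfl, by simp, by simp⟩
    split_ifs with h
    · rw [Set.ncard_eq_one]
      refine ⟨∅, Set.eq_singleton_iff_unique_mem.2 ⟨⟨h₀, h.2⟩, fun T hT => ?_⟩⟩
      exact Finset.card_eq_zero.1 hT.1.1
    · rw [show {T : Finset (List ℕ) | F.IsIndependent 0 T ∧ F.arch μ T = 𝔸} = ∅ from
        Set.eq_empty_of_forall_notMem fun T hT => h ⟨hF, Finset.card_eq_zero.1 hT.1.1 ▸ hT.2⟩,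
        Set.ncard_empty]
  · rw [count, onForests, dif_neg hw, if_neg]
    rintro ⟨F, hF, h⟩
    exact hw ⟨F, hF.1, h⟩

open Classical in
-- The indicator cuts the sum off outside the encodings of non-empty lists of children. There the
-- count is 0, as no node is iterable or the word is no factorization, but the rational functions
-- are uncontrolled.
theorem decomp_count_of_split {𝔸 : Architecture A M} {k : ℕ} (hk : k ≠ 0)
    {f g : ℕ → List (Bracketed A) → ℕ} (hf : ∀ k, Decomp (f k) k) (hg : ∀ k, Decomp (g k) k)
    {σ₁ σ₂ : List (Bracketed A) → List (Bracketed A)} (hσ₁ : IsRational σ₁) (hσ₂ : IsRational σ₂)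
    (h : ∀ (c : Forest A) l, (node (c :: l)).IsFactorizationLE μ K →
      {T : Finset (List ℕ) | (node (c :: l)).IsIndependent k T ∧
        (node (c :: l)).arch μ T = 𝔸}.ncard =
      ∑ k₁ ∈ Finset.Icc 1 k, f k₁ (σ₁ (node (c :: l)).encode) *
        g (k - k₁) (σ₂ (node (c :: l)).encode)) : Decomp (count μ K k 𝔸) k := by
  have hV : Reg (Enc fun F : Forest A => F.IsFactorizationLE μ K ∧
      (¬ F.encode = [] ∧ ¬ ∃ b, F.encode = [b] ∧ True)) :=
    (Reg.isFactorizationLE μ K).enc_word (Reg.eq_nil.not.and (Reg.singleton fun _ => True).not)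
  have hsum : Decomp (fun w => ∑ k₁ ∈ Finset.Icc 1 k, f k₁ (σ₁ w) * g (k - k₁) (σ₂ w)) k := by
    refine Decomp.sum fun k₁ hk₁ => ?_
    have := ((hf k₁).comp hσ₁).mul ((hg (k - k₁)).comp hσ₂)
    rwa [Nat.add_sub_cancel' (Finset.mem_Icc.1 hk₁).2] at this
  have hmul := (Decomp.indicator hV).mul hsum
  rw [zero_add] at hmul
  refine hmul.congr fun w => ?_
  by_cases hw : ∃ F : Forest A, F.IsFactorizationLE μ K ∧ F.encode = w
  · obtain ⟨F, hF, rfl⟩ := hw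
    rw [count, onForests_encode μ K _ F hF]
    simp only [enc_encode]
    by_cases hF' : ∃ c l, F = node (c :: l)
    · obtain ⟨c, l, rfl⟩ := hF'
      rw [h c l hF, if_pos, one_mul]
      refine ⟨hF, by simp [encode_cons], ?_⟩
      rintro ⟨b, h, -⟩
      have := congrArg List.length h
      simp [encode_cons] at this
    · rw [show {T : Finset (List ℕ) | F.IsIndependent k T ∧ F.arch μ T = 𝔸} = ∅ from
        Set.eq_empty_of_forall_notMem fun T hT => hF' (isIndependent_ne_empty hk hT.1).2,
        Set.ncard_empty, if_neg, zero_mul]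
      rintro ⟨-, h₁, h₂⟩
      rcases F with a | (_ | ⟨c, l⟩)
      · exact h₂ ⟨_, encode_letter a, trivial⟩
      · exact h₁ encode_nil
      · exact hF' ⟨c, l, rfl⟩
  · rw [count, onForests, dif_neg hw, if_neg, zero_mul]
    rintro ⟨F, hF, h⟩
    exact hw ⟨F, hF.1, h⟩

theorem decomp_count_first {𝔸 𝔸' : Architecture A M} {k : ℕ} (hk : k ≠ 0)
    (h : ∀ k, Decomp (count μ K k 𝔸) k) (h' : ∀ k, Decomp (count μ K k 𝔸') k) :
    Decomp (count μ K k (Block.node 𝔸 :: 𝔸')) k := by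
  obtain ⟨σ₁, hσ₁, h₁⟩ := exists_rational_first A K
  obtain ⟨σ₂, hσ₂, h₂⟩ := exists_rational_tail A K
  refine decomp_count_of_split hk h h' hσ₁ hσ₂ fun c l hF => ?_
  obtain ⟨hc, hc'⟩ := hF.of_mem' (c := c) (by simp)
  rw [h₁ c l hc, h₂ c l hc, ncard_arch_first]
  refine Finset.sum_congr rfl fun k₁ _ => ?_
  rw [count, count, onForests_encode μ K _ c hc', onForests_encode μ K _ (node l)
    (Forest.IsFactorizationLE.of_append (l₁ := [c]) hF).2]

theorem decomp_count_last {b : Block A M} (hb : ∀ 𝔹, b ≠ Block.node 𝔹) {𝔸 𝔸' : Architecture A M}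
    {k : ℕ} (hk : k ≠ 0) (h : ∀ k, Decomp (count μ K k (b :: 𝔸)) k)
    (h' : ∀ k, Decomp (count μ K k 𝔸') k) :
    Decomp (count μ K k (b :: 𝔸 ++ [Block.node 𝔸'])) k := by
  obtain ⟨σ₁, hσ₁, h₁⟩ := exists_rational_last A K
  obtain ⟨σ₂, hσ₂, h₂⟩ := exists_rational_init A K
  refine decomp_count_of_split hk h' h hσ₁ hσ₂ fun c l hF => ?_
  obtain ⟨l', d, hl⟩ : ∃ l' d, c :: l = l' ++ [d] :=
    ⟨_, _, (List.dropLast_append_getLast (List.cons_ne_nil c l)).symm⟩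
  rw [hl] at hF ⊢
  obtain ⟨hd, hd'⟩ := hF.of_mem' (c := d) (by simp)
  rw [h₁ l' d hd, h₂ l' d hd, ncard_arch_last l' d k b hb]
  refine Finset.sum_congr rfl fun k₁ _ => ?_
  rw [count, count, onForests_encode μ K _ d hd', onForests_encode μ K _ (node l') hF.of_append.1]

theorem sizeOf_lt_append_singleton {B : Type*} [SizeOf B] (l : List B) (b : B) :
    sizeOf l < sizeOf (l ++ [b]) := by
  induction l with
  | nil => simp
  | cons a l ih => simpa using ih

/-- Every counting function is a polyblind function plus a polyregular function of smaller
growth. -/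
theorem decomp_count (μ : FreeMonoid A →* M) (K : ℕ) (𝔸 : Architecture A M) (k : ℕ) :
    Decomp (count μ K k 𝔸) k := by
  induction h : sizeOf 𝔸 using Nat.strong_induction_on generalizing 𝔸 k with
  | _ n ih =>
  subst h
  rcases eq_or_ne k 0 with rfl | hk
  · exact decomp_count_zero μ K 𝔸
  have hzero : (∀ (F : Forest A) T, F.IsIndependent k T → F.arch μ T ≠ 𝔸) →
      Decomp (count μ K k 𝔸) k := fun h => (Decomp.zero k).congr (count_eq_zero h)
  by_cases h₁ : ∃ 𝔹 𝔸', 𝔸 = Block.node 𝔹 :: 𝔸'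
  · obtain ⟨𝔹, 𝔸', rfl⟩ := h₁
    refine decomp_count_first hk (fun k => ih _ ?_ 𝔹 k rfl) fun k => ih _ ?_ 𝔸' k rfl
    · simp only [List.cons.sizeOf_spec, Block.node.sizeOf_spec]
      omega
    · simp only [List.cons.sizeOf_spec, Block.node.sizeOf_spec]
      omega
  by_cases h₂ : ∃ b 𝔹 𝔸', (∀ 𝔻, b ≠ Block.node 𝔻) ∧ 𝔸 = b :: 𝔹 ++ [Block.node 𝔸']
  · obtain ⟨b, 𝔹, 𝔸', hb, rfl⟩ := h₂
    refine decomp_count_last hb hk (fun k => ih _ ?_ _ k rfl) fun k => ih _ ?_ 𝔸' k rfl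
    · exact sizeOf_lt_append_singleton _ _
    · have := List.sizeOf_lt_of_mem (show Block.node 𝔸' ∈ b :: 𝔹 ++ [Block.node 𝔸'] by simp)
      simp only [Block.node.sizeOf_spec] at this
      omega
  by_cases h₃ : ∃ 𝕋, 𝔸 = [Block.types 𝕋] ∧ k = 𝕋.card
  · obtain ⟨𝕋, rfl, rfl⟩ := h₃
    obtain ⟨τ, hτ⟩ := Multiset.card_pos_iff_exists_mem.1 (Nat.pos_of_ne_zero hk)
    rw [count_types_eq μ K hτ]
    exact decomp_countTypes μ K _ 𝕋
  -- By `arch_cases`, a non-empty set produces one of the shapes treated above, so no set is counted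
  -- here.
  · refine hzero fun F T hT hA => ?_
    obtain ⟨hne, c, l, rfl⟩ := isIndependent_ne_empty hk hT
    rcases arch_cases (μ := μ) c l hne with ⟨𝔹, 𝔸', h⟩ | ⟨b, 𝔹, 𝔸', hb, h⟩ | ⟨h, -⟩
    · exact h₁ ⟨𝔹, 𝔸', hA.symm.trans h⟩
    · exact h₂ ⟨b, 𝔹, 𝔸', hb, hA.symm.trans h⟩
    · exact h₃ ⟨_, hA.symm.trans h, card_of_arch_eq hT h⟩

end Architectures

end PolyCount

theorem mainTheorem5 {A : Type*} [Finite A] {M : Type*} [Monoid M] [Finite M]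
    (μ : FreeMonoid A →* M) (K k : ℕ) (𝔸 : PolyCount.Architecture A M)
    (h𝔸 : 𝔸 ∈ PolyCount.architectures μ K k) :
    -- the count is a polyblind function of growth at most `k` plus a polyregular function of
    -- growth at most `k - 1` (which is zero if `k = 0`)
    (∃ count' count'' : List (PolyCount.Bracketed A) → ℕ,
      (∀ w, PolyCount.count μ K k 𝔸 w = count' w + count'' w) ∧
      PolyCount.IsPolyblind count' ∧ PolyCount.HasGrowth count' k ∧
      PolyCount.IsPolyregular count'' ∧
      (1 ≤ k → PolyCount.HasGrowth count'' (k - 1)) ∧ (k = 0 → ∀ w, count'' w = 0)) ∧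
    -- decomposition along a type `τ` of least depth, of multiplicity `r`, if `𝔸 = ⟨𝕋⟩`
    (∀ (𝕋₁ : Multiset (PolyCount.NodeType A M)) (τ : PolyCount.NodeType A M) (r : ℕ),
      0 < r → τ ∉ 𝕋₁ → (∀ σ ∈ 𝕋₁, τ.2 ≤ σ.2) →
      𝔸 = [PolyCount.Block.types (𝕋₁ + Multiset.replicate r τ)] →
      PolyCount.IsPolyblind (PolyCount.sparseFactor μ K τ r 𝕋₁.card) ∧
      PolyCount.HasGrowth (PolyCount.sparseFactor μ K τ r 𝕋₁.card) r ∧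
      ∃ g'' : List (PolyCount.Bracketed A) → ℕ,
        PolyCount.IsPolyregular g'' ∧ PolyCount.HasGrowth g'' (k - 1) ∧
        ∀ w, PolyCount.count μ K k 𝔸 w =
          PolyCount.sparseFactor μ K τ r 𝕋₁.card w *
            PolyCount.countTypes μ K
              (τ.1.left * μ (FreeMonoid.ofList τ.1.word) * τ.1.right) 𝕋₁ w + g'' w) := by
  refine ⟨PolyCount.decomp_count μ K 𝔸 k, ?_⟩
  rintro 𝕋₁ τ r hr hτ hd rfl
  refine ⟨PolyCount.isPolyblind_sparseFactor μ K τ hr _,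
    PolyCount.hasGrowth_sparseFactor μ K τ hr _, ?_⟩
  -- That 𝔸 is realized by a set of k nodes identifies k with the size of the multiset of types.
  obtain ⟨F, T, -, hT, h⟩ := h𝔸
  obtain rfl := PolyCount.card_of_arch_eq hT h
  have hmem : τ ∈ 𝕋₁ + Multiset.replicate r τ :=
    Multiset.mem_add.2 (Or.inr (Multiset.mem_replicate.2 ⟨hr.ne', rfl⟩))
  obtain ⟨g'', h₁, h₂, h₃⟩ := PolyCount.exists_countTypes_eq μ K
    (τ.1.left * μ (FreeMonoid.ofList τ.1.word) * τ.1.right) hr hτ hd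
  refine ⟨g'', h₁, ?_, fun w => ?_⟩
  · rwa [Multiset.card_add, Multiset.card_replicate]
  · rw [PolyCount.count_types_eq μ K hmem]
    exact h₃ w
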